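/- Let $\mathbb{L}\cong\mathbb{Z}^r$ be a lattice, $K=\mathbb{L}\otimes\mathbb{C}^\times$, and let $D_1,\dots,D_R\in\mathbb{L}^*$ be nonzero characters of $K$ spanning a strictly convex full-dimensional cone in $\mathbb{L}^*\otimes\mathbb{Q}$ that contains $\omega$. Say that $I\subseteq[R]$ covers $\omega$ if $\omega=\sum_{i\in I}a_iD_i$ with all $a_i\in\mathbb{Q}_{>0}$, let $\mathcal{A}_\omega$ be the set of such $I$, and put $V_\omega=\bigcup_{I\in\mathcal{A}_\omega}(\mathbb{C}^\times)^I\times\mathbb{C}^{[R]\setminus I}$. Assume that $[V_\omega/K]$ is a toric orbifold, i.e. $K$ acts on $V_\omega$ with finite stabilizers and trivial generic stabilizer. Let $N=\mathbb{Z}^R/\mathbb{L}$, where $\mathbb{L}\to\mathbb{Z}^R$ is $\ell\mapsto(D_i(\ell))_i$, let $\rho_i\in N$ be the image of the $i$-th standard basis vector, let $\Sigma$ be the fan in $N\otimes\mathbb{Q}$ consisting of the cones spanned by $\{\rho_i\mid i\notin I\}$, $I\in\mathcal{A}_\omega$, and let $Y$ be the toric variety over $\mathbb{C}$ of $\Sigma$,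 which is the coarse moduli space of $[V_\omega/K]$. Let $B,S_1,\dots,S_k,U$ be a partition of $[R]$ ($k=0$ and $U=\varnothing$ are allowed) such that $\{D_b\mid b\in B\}$ is a basis of $\mathbb{L}^*$; $\omega$ is a non-negative linear combination of $\{D_b \mid b\in B\}$; each $S_j$ is non-empty; and each $L_j=\sum_{i\in S_j}D_i$ is a non-negative linear combination $\sum_{b\in B}l_{b,j}D_b$ and is convex as a line bundle on $[V_\omega/K]$, that is, nef and pulled back from $Y$. Let $N'=\{v\in N\mid u_1(v)=\dots=u_k(v)=0\}$, where $u_j\in\mathrm{Hom}(N,\mathbb{Z})$ takes the value $1$ on $\rho_i$ for $i\in S_j$ and $0$ on $\rho_i$ for $i\notin B\cup S_j$. Let $\Sigma'=\{\sigma\cap N'_{\mathbb{Q}}\mid\sigma\in\Sigma\}$ and let $X'$ be the toric variety over $\mathbb{C}$ of the fan $\Sigma'$ in $N'_{\mathbb Q}$. Let $s=(s_1,\dots,s_k)$ be a regular section of $\bigoplus_jL_j$ and let $X\subset Y$ be the complete intersection that it defines. Let $s'=(s'_1,\dots,s'_k)$, where $s'_j=\prod_{b\in B}x_b^{l_{b,j}}-\prod_{i\in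 S_j}x_i$ is a binomial section of $L_j$. Then there is a closed subscheme $\mathbb{X}\subset Y\times\mathbb{A}^1$, flat over $\mathbb{A}^1$, such that: (a) for all but finitely many $t\in\mathbb{C}$, and in particular for $t=0$ and $t=1$, the section $(1-t)s'+ts$ of $\bigoplus_jL_j$ is regular and the fibre $\mathbb{X}_t\subset Y$ is the complete intersection that it defines; (b) $\mathbb{X}_1=X$; (c) $\mathbb{X}_0$ is the subscheme $\{s'=0\}$ of $Y$, and it is isomorphic over $\mathbb{C}$ to the toric variety $X'$. -/

import Mathlib

open CategoryTheory AlgebraicGeometry TensorProduct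

namespace Toric

noncomputable section

/-- The pairing of `m ∈ M = Hom(N, ℤ)` with `N_ℚ = ℚ ⊗ N`. -/
def pair {N : Type} [AddCommGroup N] (m : Module.Dual ℤ N) : ℚ ⊗[ℤ] N →ₗ[ℚ] ℚ :=
  (TensorProduct.AlgebraTensorModule.rid ℤ ℚ ℚ).toLinearMap ∘ₗ LinearMap.baseChange ℚ m

lemma pair_tmul {N : Type} [AddCommGroup N] (m : Module.Dual ℤ N) (q : ℚ) (v : N) :
    pair m (q ⊗ₜ v) = q * (m v : ℚ) := by
  simp [pair, mul_comm]

lemma pair_add {N : Type} [AddCommGroup N] (m m' : Module.Dual ℤ N) (x : ℚ ⊗[ℤ] N) :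
    pair (m + m') x = pair m x + pair m' x := by
  simp [pair, LinearMap.baseChange_add]

lemma pair_nsmul {N : Type} [AddCommGroup N] (n : ℕ) (m : Module.Dual ℤ N) (x : ℚ ⊗[ℤ] N) :
    pair (n • m) x = n * pair m x := by
  induction n with
  | zero => simp [pair]
  | succ n ih => rw [succ_nsmul, pair_add, ih]; push_cast; ring

/-- The semigroup `σ^∨ ∩ M`. -/
def dualMonoid {N : Type} [AddCommGroup N] (σ : PointedCone ℚ (ℚ ⊗[ℤ] N)) :
    AddSubmonoid (Module.Dual ℤ N) where
  carrier := {m | ∀ x ∈ σ, 0 ≤ pair m x}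
  zero_mem' := by intro x _; simp [pair]
  add_mem' := by
    intro a b ha hb x hx
    rw [pair_add]
    exact add_nonneg (ha x hx) (hb x hx)

lemma dualMonoid_anti {N : Type} [AddCommGroup N] {σ τ : PointedCone ℚ (ℚ ⊗[ℤ] N)} (h : τ ≤ σ) :
    dualMonoid σ ≤ dualMonoid τ := fun _ hm x hx => hm x (h hx)

/-- `τ = σ ∩ m^⊥` for some `m ∈ σ^∨ ∩ M`, that is, `τ` is a face of the rational cone `σ`. -/
def IsLatticeFace {N : Type} [AddCommGroup N] (τ σ : PointedCone ℚ (ℚ ⊗[ℤ] N)) : Prop :=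
  ∃ m ∈ dualMonoid σ, ∀ x, x ∈ τ ↔ x ∈ σ ∧ pair m x = 0

/-- A fan in `N_ℚ`: a finite collection of strongly convex rational polyhedral cones, closed under
taking faces, such that any two cones meet along a common face. -/
structure Fan (N : Type) [AddCommGroup N] where
  cones : Set (PointedCone ℚ (ℚ ⊗[ℤ] N))
  finite : cones.Finite
  fg : ∀ σ ∈ cones, σ.FG
  salient : ∀ σ ∈ cones, (σ : ConvexCone ℚ (ℚ ⊗[ℤ] N)).Salient
  face_mem : ∀ σ ∈ cones, ∀ τ : PointedCone ℚ (ℚ ⊗[ℤ] N), τ.IsFaceOf σ → τ ∈ cones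
  inter_face : ∀ σ ∈ cones, ∀ τ ∈ cones, IsLatticeFace (σ ⊓ τ) σ

/-- The coordinate ring `ℂ[σ^∨ ∩ M]` of the affine toric variety of `σ`. -/
abbrev coordRing {N : Type} [AddCommGroup N] (σ : PointedCone ℚ (ℚ ⊗[ℤ] N)) : Type :=
  AddMonoidAlgebra ℂ (dualMonoid σ)

/-- For `τ ⊆ σ`, the inclusion `ℂ[σ^∨ ∩ M] → ℂ[τ^∨ ∩ M]`. -/
def restrictHom {N : Type} [AddCommGroup N] {σ τ : PointedCone ℚ (ℚ ⊗[ℤ] N)} (h : τ ≤ σ) :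
    coordRing σ →ₐ[ℂ] coordRing τ :=
  AddMonoidAlgebra.mapDomainAlgHom ℂ ℂ (AddSubmonoid.inclusion (dualMonoid_anti h))

lemma restrictHom_id {N : Type} [AddCommGroup N] (σ : PointedCone ℚ (ℚ ⊗[ℤ] N)) :
    restrictHom (le_refl σ) = AlgHom.id ℂ (coordRing σ) := by
  refine AddMonoidAlgebra.algHom_ext (fun m => ?_) (Subsingleton.elim _ _)
  simp [restrictHom]
  rfl

lemma restrictHom_comp {N : Type} [AddCommGroup N] {σ τ υ : PointedCone ℚ (ℚ ⊗[ℤ] N)} (h : τ ≤ σ)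
    (h' : υ ≤ τ) : (restrictHom h').comp (restrictHom h) = restrictHom (h'.trans h) := by
  refine AddMonoidAlgebra.algHom_ext (fun m => ?_) (Subsingleton.elim _ _)
  simp [restrictHom]
  rfl

lemma restrictHom_single {N : Type} [AddCommGroup N] {σ τ : PointedCone ℚ (ℚ ⊗[ℤ] N)} (h : τ ≤ σ)
    (m : dualMonoid σ) (c : ℂ) : restrictHom h (AddMonoidAlgebra.single m c) =
      AddMonoidAlgebra.single (AddSubmonoid.inclusion (dualMonoid_anti h) m) c := by
  simp [restrictHom]

/-- Along a face `τ = σ ∩ m^⊥` of a polyhedral cone, `τ^∨ ∩ M = σ^∨ ∩ M + ℕ (-m)`. -/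
lemma exists_add_nsmul_mem {N : Type} [AddCommGroup N] {σ τ : PointedCone ℚ (ℚ ⊗[ℤ] N)}
    (hσ : σ.FG) {m : Module.Dual ℤ N} (hm : m ∈ dualMonoid σ)
    (hτ : ∀ x, x ∈ τ ↔ x ∈ σ ∧ pair m x = 0) {u : Module.Dual ℤ N} (hu : u ∈ dualMonoid τ) :
    ∃ n : ℕ, u + n • m ∈ dualMonoid σ := by
  classical
  obtain ⟨s, rfl⟩ := hσ
  have key : ∀ t : Finset (ℚ ⊗[ℤ] N), t ⊆ s → ∃ n : ℕ, ∀ v ∈ t, 0 ≤ pair (u + n • m) v := by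
    intro t
    induction t using Finset.induction_on with
    | empty => intro _; exact ⟨0, by simp⟩
    | insert v t hv ih =>
      intro hts
      obtain ⟨n, hn⟩ := ih (fun x hx => hts (Finset.mem_insert_of_mem hx))
      have hvs : v ∈ Submodule.span {c : ℚ // 0 ≤ c} (s : Set (ℚ ⊗[ℤ] N)) :=
        Submodule.subset_span (hts (Finset.mem_insert_self v t))
      have hmv : 0 ≤ pair m v := hm v hvs
      rcases hmv.eq_or_lt with h0 | hpos
      · refine ⟨n, fun x hx => ?_⟩
        rcases Finset.mem_insert.1 hx with rfl | hx
        · rw [pair_add, pair_nsmul, ← h0]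
          simpa using hu x ((hτ x).2 ⟨hvs, h0.symm⟩)
        · exact hn x hx
      · obtain ⟨k, hk⟩ := exists_nat_gt (-(pair u v) / pair m v)
        refine ⟨n + k, fun x hx => ?_⟩
        rcases Finset.mem_insert.1 hx with rfl | hx
        · rw [pair_add, pair_nsmul]
          rw [div_lt_iff₀ hpos] at hk
          push_cast
          have : (0 : ℚ) ≤ n * pair m x := by positivity
          nlinarith
        · have h1 := hn x hx
          have h2 : 0 ≤ pair m x :=
            hm x (Submodule.subset_span (hts (Finset.mem_insert_of_mem hx)))
          rw [pair_add, pair_nsmul] at h1 ⊢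
          push_cast
          have : (0 : ℚ) ≤ k * pair m x := by positivity
          nlinarith
  obtain ⟨n, hn⟩ := key s (Finset.Subset.refl s)
  refine ⟨n, fun x hx => ?_⟩
  induction hx using Submodule.span_induction with
  | mem x hx => exact hn x hx
  | zero => simp
  | add x y _ _ hx hy => rw [map_add]; exact add_nonneg hx hy
  | smul a x _ hx =>
    have : pair (u + n • m) (a • x) = (a : ℚ) * pair (u + n • m) x := by
      rw [← smul_eq_mul, ← map_smul]; rfl
    rw [this]; exact mul_nonneg a.2 hx

/-- `ℂ[τ^∨ ∩ M]` is the localization of `ℂ[σ^∨ ∩ M]` at the character cutting out the face `τ`. -/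
lemma isLocalization_restrictHom {N : Type} [AddCommGroup N] {σ τ : PointedCone ℚ (ℚ ⊗[ℤ] N)}
    (hσ : σ.FG) (h : τ ≤ σ) {m : Module.Dual ℤ N} (hm : m ∈ dualMonoid σ)
    (hτ : ∀ x, x ∈ τ ↔ x ∈ σ ∧ pair m x = 0) :
    @IsLocalization.Away (coordRing σ) _ (AddMonoidAlgebra.single ⟨m, hm⟩ 1) (coordRing τ) _
      (restrictHom h).toRingHom.toAlgebra := by
  let := (restrictHom h).toRingHom.toAlgebra
  have hmap : ∀ x, algebraMap (coordRing σ) (coordRing τ) x = restrictHom h x := fun _ => rfl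
  have hmτ : m ∈ dualMonoid τ := dualMonoid_anti h hm
  have hmτ' : -m ∈ dualMonoid τ := by
    intro x hx
    have h0 := ((hτ x).1 hx).2
    have h1 := pair_add m (-m) x
    rw [add_neg_cancel, h0] at h1
    have h2 : pair (0 : Module.Dual ℤ N) x = 0 := by simp [pair]
    rw [h2] at h1
    linarith
  have hinj : Function.Injective (restrictHom h) := by
    apply AddMonoidAlgebra.mapDomain_injective
    exact AddSubmonoid.inclusion_injective (dualMonoid_anti h)
  refine (isLocalization_iff _ _).2 ⟨?_, ?_, ?_⟩
  · rintro ⟨_, n, rfl⟩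
    simp only [map_pow]
    refine IsUnit.pow n ?_
    rw [hmap, restrictHom_single]
    refine IsUnit.of_mul_eq_one (AddMonoidAlgebra.single ⟨-m, hmτ'⟩ 1) ?_
    rw [AddMonoidAlgebra.single_mul_single, AddMonoidAlgebra.one_def]
    congr 1
    · ext1; simp
    · simp
  · have key : ∀ z : coordRing τ, ∃ (n : ℕ) (x : coordRing σ),
        z * restrictHom h (AddMonoidAlgebra.single ⟨m, hm⟩ 1 ^ n) = restrictHom h x := by
      intro z
      induction z using AddMonoidAlgebra.induction_linear with
      | zero => exact ⟨0, 0, by simp⟩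
      | add f g hf hg =>
        obtain ⟨n, x, hx⟩ := hf
        obtain ⟨k, y, hy⟩ := hg
        refine ⟨n + k, x * AddMonoidAlgebra.single ⟨m, hm⟩ 1 ^ k +
          y * AddMonoidAlgebra.single ⟨m, hm⟩ 1 ^ n, ?_⟩
        simp only [map_add, map_mul, map_pow, pow_add] at hx hy ⊢
        rw [← hx, ← hy]
        ring
      | single u c =>
        obtain ⟨n, hn⟩ := exists_add_nsmul_mem hσ hm hτ u.2
        refine ⟨n, AddMonoidAlgebra.single ⟨_, hn⟩ c, ?_⟩
        rw [AddMonoidAlgebra.single_pow, restrictHom_single, restrictHom_single,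
          AddMonoidAlgebra.single_mul_single]
        congr 1
        simp
    intro z
    obtain ⟨n, x, hx⟩ := key z
    exact ⟨⟨x, ⟨_, n, rfl⟩⟩, hx⟩
  · intro x y hxy
    exact ⟨1, by rw [hinj hxy]⟩

lemma isOpenImmersion_restrict {N : Type} [AddCommGroup N] {σ τ : PointedCone ℚ (ℚ ⊗[ℤ] N)}
    (hσ : σ.FG) (h : τ ≤ σ) (hτ : IsLatticeFace τ σ) :
    IsOpenImmersion (Spec.map (CommRingCat.ofHom (restrictHom h).toRingHom)) := by
  obtain ⟨m, hm, hx⟩ := hτ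
  let := (restrictHom h).toRingHom.toAlgebra
  have := isLocalization_restrictHom hσ h hm hx
  exact IsOpenImmersion.of_isLocalization (AddMonoidAlgebra.single ⟨m, hm⟩ 1 : coordRing σ)

namespace Fan

variable {N : Type} [AddCommGroup N]

/-- The diagram `σ ↦ U_σ = Spec ℂ[σ^∨ ∩ M]` on the cones of the fan, ordered by inclusion. -/
def diagram (F : Fan N) : F.cones ⥤ Scheme.{0} where
  obj σ := Spec (CommRingCat.of (coordRing σ.1))
  map f := Spec.map (CommRingCat.ofHom (restrictHom (leOfHom f)).toRingHom)
  map_id σ := by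
    rw [← Spec.map_id]
    congr 1
    ext1
    change (restrictHom (le_refl σ.1)).toRingHom = RingHom.id _
    rw [restrictHom_id]
    rfl
  map_comp f g := by
    rw [← Spec.map_comp, ← CommRingCat.ofHom_comp]
    congr 2
    change _ = ((restrictHom (leOfHom f)).comp (restrictHom (leOfHom g))).toRingHom
    rw [restrictHom_comp]

instance (F : Fan N) {σ τ : F.cones} (f : τ ⟶ σ) : IsOpenImmersion (F.diagram.map f) := by
  refine isOpenImmersion_restrict (F.fg σ.1 σ.2) (leOfHom f) ?_
  have := F.inter_face σ.1 σ.2 τ.1 τ.2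
  rwa [inf_eq_right.2 (leOfHom f)] at this

lemma inter_mem (F : Fan N) {σ τ : PointedCone ℚ (ℚ ⊗[ℤ] N)} (hσ : σ ∈ F.cones)
    (hτ : τ ∈ F.cones) : σ ⊓ τ ∈ F.cones := by
  refine F.face_mem σ hσ _ ⟨inf_le_left, ?_⟩
  obtain ⟨m, hm, h⟩ := F.inter_face σ hσ τ hτ
  intro x y a hx hy ha hxy
  refine (h x).2 ⟨hx, ?_⟩
  have h1 := ((h _).1 hxy).2
  rw [map_add, map_smul, smul_eq_mul] at h1
  have h2 := hm x hx
  have h3 := hm y hy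
  have h4 : 0 ≤ a * pair m x := mul_nonneg ha.le h2
  have h5 : a * pair m x = 0 := by linarith
  exact (mul_eq_zero.1 h5).resolve_left ha.ne'

lemma range_diagram_map (F : Fan N) {σ τ : F.cones} (f : τ ⟶ σ) {m : Module.Dual ℤ N}
    (hm : m ∈ dualMonoid σ.1) (hx : ∀ x, x ∈ τ.1 ↔ x ∈ σ.1 ∧ pair m x = 0) :
    Set.range (F.diagram.map f) =
      {p : PrimeSpectrum (coordRing σ.1) | AddMonoidAlgebra.single ⟨m, hm⟩ 1 ∉ p.asIdeal} := by
  let := (restrictHom (leOfHom f)).toRingHom.toAlgebra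
  have := isLocalization_restrictHom (F.fg σ.1 σ.2) (leOfHom f) hm hx
  exact PrimeSpectrum.localization_away_comap_range (coordRing τ.1)
    (AddMonoidAlgebra.single ⟨m, hm⟩ 1 : coordRing σ.1)

instance (F : Fan N) : (F.diagram ⋙ Scheme.forget).IsLocallyDirected where
  cond := by
    intro σ τ υ f g x y hxy
    replace hxy : F.diagram.map f x = F.diagram.map g y := hxy
    obtain ⟨a, ha, ha'⟩ := F.inter_face υ.1 υ.2 σ.1 σ.2
    obtain ⟨b, hb, hb'⟩ := F.inter_face υ.1 υ.2 τ.1 τ.2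
    rw [inf_eq_right.2 (leOfHom f)] at ha'
    rw [inf_eq_right.2 (leOfHom g)] at hb'
    let ξ : F.cones := ⟨σ.1 ⊓ τ.1, F.inter_mem σ.2 τ.2⟩
    let fl : ξ ⟶ σ := homOfLE (inf_le_left : σ.1 ⊓ τ.1 ≤ σ.1)
    let gl : ξ ⟶ τ := homOfLE (inf_le_right : σ.1 ⊓ τ.1 ≤ τ.1)
    have hab : ∀ z, z ∈ ξ.1 ↔ z ∈ υ.1 ∧ pair (a + b) z = 0 := by
      intro z
      rw [pair_add]
      constructor
      · rintro ⟨h1, h2⟩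
        have h3 := (ha' z).1 h1
        have h4 := (hb' z).1 h2
        exact ⟨h3.1, by rw [h3.2, h4.2, add_zero]⟩
      · rintro ⟨h1, h2⟩
        have h3 := ha z h1
        have h4 := hb z h1
        exact ⟨(ha' z).2 ⟨h1, by linarith⟩, (hb' z).2 ⟨h1, by linarith⟩⟩
    have hx1 : F.diagram.map f x ∈ Set.range (F.diagram.map f) := ⟨x, rfl⟩
    have hy1 : F.diagram.map f x ∈ Set.range (F.diagram.map g) := ⟨y, hxy.symm⟩
    rw [range_diagram_map F f ha ha'] at hx1
    rw [range_diagram_map F g hb hb'] at hy1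
    have hz : F.diagram.map f x ∈ Set.range (F.diagram.map (fl ≫ f)) := by
      rw [range_diagram_map F (fl ≫ f) (add_mem ha hb) hab]
      intro hmem
      have : (AddMonoidAlgebra.single ⟨a + b, add_mem ha hb⟩ 1 : coordRing υ.1) =
          AddMonoidAlgebra.single ⟨a, ha⟩ 1 * AddMonoidAlgebra.single ⟨b, hb⟩ 1 := by
        rw [AddMonoidAlgebra.single_mul_single, mul_one]
        rfl
      rw [this] at hmem
      rcases (PrimeSpectrum.isPrime (F.diagram.map f x)).mem_or_mem hmem with h | h
      · exact hx1 h
      · exact hy1 h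
    obtain ⟨z, hz⟩ := hz
    refine ⟨ξ, fl, gl, z, ?_, ?_⟩
    · apply (F.diagram.map f).injective
      rw [← hz, F.diagram.map_comp]
      rfl
    · apply (F.diagram.map g).injective
      rw [← hxy, ← hz, show fl ≫ f = gl ≫ g from rfl, F.diagram.map_comp]
      rfl

/-- The toric variety of a fan, glued from the affine toric varieties of its cones. -/
def toricVariety (F : Fan N) : Scheme.{0} := Limits.colimit F.diagram

/-- The chart `U_σ → X_F`. -/
def chart (F : Fan N) (σ : PointedCone ℚ (ℚ ⊗[ℤ] N)) (hσ : σ ∈ F.cones) :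
    Spec (CommRingCat.of (coordRing σ)) ⟶ F.toricVariety :=
  Limits.colimit.ι F.diagram ⟨σ, hσ⟩

/-- The structure morphism of a toric variety over `ℂ`. -/
def structureMap (F : Fan N) : F.toricVariety ⟶ Spec (CommRingCat.of ℂ) :=
  Limits.colimit.desc F.diagram
    { pt := Spec (CommRingCat.of ℂ)
      ι := 
        { app := fun σ => Spec.map (CommRingCat.ofHom (algebraMap ℂ (coordRing σ.1)))
          naturality := by
            intro σ τ f
            change Spec.map _ ≫ Spec.map _ = Spec.map _ ≫ 𝟙 _
            rw [Category.comp_id, ← Spec.map_comp, ← CommRingCat.ofHom_comp]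
            congr 2
            exact (restrictHom (leOfHom f)).comp_algebraMap } }

end Fan

/-- The intersection of a polyhedral cone with a hyperplane is polyhedral. -/
lemma fg_inf_ker {E : Type} [AddCommGroup E] [Module ℚ E] {C : PointedCone ℚ E} (hC : C.FG)
    (f : E →ₗ[ℚ] ℚ) : (C ⊓ (PointedCone.ofSubmodule (LinearMap.ker f))).FG := by
  classical
  obtain ⟨s, rfl⟩ := hC
  let sp := s.filter (fun v => 0 < f v)
  let sn := s.filter (fun v => f v < 0)
  let sz := s.filter (fun v => f v = 0)
  let g : E × E → E := fun p => f p.1 • p.2 + (-f p.2) • p.1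
  let T : Finset E := sz ∪ (sp ×ˢ sn).image g
  refine ⟨T, le_antisymm ?_ ?_⟩
  · rw [Submodule.span_le]
    intro x hx
    rcases Finset.mem_union.1 (Finset.mem_coe.1 hx) with hx | hx
    · obtain ⟨h1, h2⟩ := Finset.mem_filter.1 hx
      exact ⟨Submodule.subset_span h1, h2⟩
    · obtain ⟨⟨v, w⟩, hvw, rfl⟩ := Finset.mem_image.1 hx
      obtain ⟨hv, hw⟩ := Finset.mem_product.1 hvw
      obtain ⟨hv1, hv2⟩ := Finset.mem_filter.1 hv
      obtain ⟨hw1, hw2⟩ := Finset.mem_filter.1 hw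
      refine ⟨?_, ?_⟩
      · refine add_mem ?_ ?_
        · exact PointedCone.smul_mem _ hv2.le (Submodule.subset_span hw1)
        · exact PointedCone.smul_mem _ (by simpa using hw2.le) (Submodule.subset_span hv1)
      · change f (f v • w + (-f w) • v) = 0
        simp [mul_comm]
  · rintro x ⟨hx, hfx⟩
    replace hfx : f x = 0 := hfx
    obtain ⟨c, -, hc⟩ := Submodule.mem_span_finset.1 hx
    let d : E → ℚ := fun v => (c v : ℚ)
    have hd : ∀ v, 0 ≤ d v := fun v => (c v).2
    have hxs : x = ∑ v ∈ s, d v • v := hc.symm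
    have split : ∀ {A : Type} [AddCommGroup A] (h : E → A), ∑ v ∈ s, h v =
        ∑ v ∈ sz, h v + (∑ v ∈ sp, h v + ∑ v ∈ sn, h v) := by
      intro A _ h
      rw [← Finset.sum_filter_add_sum_filter_not s (fun v => f v = 0)]
      congr 1
      rw [← Finset.sum_filter_add_sum_filter_not (s.filter (fun v => ¬ f v = 0)) (fun v => 0 < f v)]
      congr 1
      · refine Finset.sum_congr ?_ (fun _ _ => rfl)
        ext v
        simp only [sp, Finset.mem_filter]
        exact ⟨fun h => ⟨h.1.1, h.2⟩, fun h => ⟨⟨h.1, h.2.ne'⟩, h.2⟩⟩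
      · refine Finset.sum_congr ?_ (fun _ _ => rfl)
        ext v
        simp only [sn, Finset.mem_filter]
        exact ⟨fun h => ⟨h.1.1, lt_of_le_of_ne (not_lt.1 h.2) h.1.2⟩,
          fun h => ⟨⟨h.1, h.2.ne⟩, not_lt.2 h.2.le⟩⟩
    let S : ℚ := ∑ v ∈ sp, d v * f v
    have hS : S = ∑ w ∈ sn, d w * (-f w) := by
      have h1 : ∑ v ∈ s, d v * f v = 0 := by
        rw [← hfx, hxs, map_sum]; simp
      rw [split] at h1
      have h2 : ∑ v ∈ sz, d v * f v = 0 :=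
        Finset.sum_eq_zero fun v hv => by rw [(Finset.mem_filter.1 hv).2, mul_zero]
      simp only [mul_neg, Finset.sum_neg_distrib, S]
      linarith
    have hz : ∑ v ∈ sz, d v • v ∈ Submodule.span {c : ℚ // 0 ≤ c} (T : Set E) := by
      refine sum_mem fun v hv => PointedCone.smul_mem _ (hd v) (Submodule.subset_span ?_)
      exact Finset.mem_coe.2 (Finset.mem_union_left _ hv)
    have hS0 : 0 ≤ S := Finset.sum_nonneg fun v hv =>
      mul_nonneg (hd v) (Finset.mem_filter.1 hv).2.le
    rw [hxs, split]
    refine add_mem hz ?_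
    rcases hS0.eq_or_lt with h0 | hpos
    · have hp : ∀ v ∈ sp, d v = 0 := by
        intro v hv
        have := (Finset.sum_eq_zero_iff_of_nonneg (fun v hv =>
          mul_nonneg (hd v) (Finset.mem_filter.1 hv).2.le)).1 h0.symm v hv
        exact (mul_eq_zero.1 this).resolve_right (Finset.mem_filter.1 hv).2.ne'
      have hn : ∀ v ∈ sn, d v = 0 := by
        intro v hv
        have h1 : ∑ w ∈ sn, d w * (-f w) = 0 := by rw [← hS, ← h0]
        have := (Finset.sum_eq_zero_iff_of_nonneg (fun v hv =>
          mul_nonneg (hd v) (neg_pos.2 (Finset.mem_filter.1 hv).2).le)).1 h1 v hv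
        exact (mul_eq_zero.1 this).resolve_right (neg_pos.2 (Finset.mem_filter.1 hv).2).ne'
      rw [Finset.sum_eq_zero fun v hv => by rw [hp v hv, zero_smul],
        Finset.sum_eq_zero fun v hv => by rw [hn v hv, zero_smul], add_zero]
      exact zero_mem _
    · have key : ∑ v ∈ sp, d v • v + ∑ v ∈ sn, d v • v =
          ∑ p ∈ sp ×ˢ sn, (S⁻¹ * (d p.1 * d p.2)) • g p := by
        have e1 : ∑ p ∈ sp ×ˢ sn, (S⁻¹ * (d p.1 * d p.2)) • (f p.1 • p.2) =
            ∑ w ∈ sn, d w • w := by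
          rw [Finset.sum_product_right]
          refine Finset.sum_congr rfl fun w _ => ?_
          simp only [smul_smul]
          rw [← Finset.sum_smul]
          congr 1
          have : ∀ v ∈ sp, S⁻¹ * (d v * d w) * f v = S⁻¹ * d w * (d v * f v) := by
            intro v _; ring
          rw [Finset.sum_congr rfl this, ← Finset.mul_sum]
          change S⁻¹ * d w * S = d w
          field_simp
        have e2 : ∑ p ∈ sp ×ˢ sn, (S⁻¹ * (d p.1 * d p.2)) • ((-f p.2) • p.1) =
            ∑ v ∈ sp, d v • v := by
          rw [Finset.sum_product]
          refine Finset.sum_congr rfl fun v _ => ?_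
          simp only [smul_smul]
          rw [← Finset.sum_smul]
          congr 1
          have : ∀ w ∈ sn, S⁻¹ * (d v * d w) * (-f w) = S⁻¹ * d v * (d w * (-f w)) := by
            intro w _; ring
          rw [Finset.sum_congr rfl this, ← Finset.mul_sum, ← hS]
          field_simp
        rw [← e1, ← e2, ← Finset.sum_add_distrib]
        refine Finset.sum_congr rfl fun p _ => ?_
        rw [← smul_add, add_comm]
      rw [key]
      refine sum_mem fun p hp => PointedCone.smul_mem _ ?_ (Submodule.subset_span ?_)
      · exact mul_nonneg (inv_nonneg.2 hS0) (mul_nonneg (hd _) (hd _))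
      · exact Finset.mem_coe.2 (Finset.mem_union_right _ (Finset.mem_image_of_mem g hp))

lemma exists_tmul_eq {N : Type} [AddCommGroup N] (x : ℚ ⊗[ℤ] N) :
    ∃ (n : ℕ) (v : N), n ≠ 0 ∧ x = (n : ℚ)⁻¹ ⊗ₜ v := by
  induction x using TensorProduct.induction_on with
  | zero => exact ⟨1, 0, one_ne_zero, by simp⟩
  | tmul q v =>
    refine ⟨q.den, q.num • v, q.den_nz, ?_⟩
    rw [← TensorProduct.smul_tmul]
    congr 1
    rw [zsmul_eq_mul, ← div_eq_mul_inv, Rat.num_div_den]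
  | add x y hx hy =>
    obtain ⟨n, v, hn, rfl⟩ := hx
    obtain ⟨m, w, hm, rfl⟩ := hy
    refine ⟨n * m, (m : ℤ) • v + (n : ℤ) • w, mul_ne_zero hn hm, ?_⟩
    have hn' : (n : ℚ) ≠ 0 := by exact_mod_cast hn
    have hm' : (m : ℚ) ≠ 0 := by exact_mod_cast hm
    rw [TensorProduct.tmul_add, ← TensorProduct.smul_tmul, ← TensorProduct.smul_tmul]
    congr 2
    · rw [zsmul_eq_mul]; push_cast; field_simp
    · rw [zsmul_eq_mul]; push_cast; field_simp

/-- The sublattice `N ∩ H_{u_1} ∩ ⋯ ∩ H_{u_k}`, where `H_u = {v ∈ N | u(v) = 0}`. -/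
def hyperplaneInter {N : Type} [AddCommGroup N] {k : ℕ} (u : Fin k → Module.Dual ℤ N) :
    Submodule ℤ N := ⨅ j, LinearMap.ker (u j)

/-- The inclusion `N'_ℚ → N_ℚ` of a sublattice. -/
def inclQ {N : Type} [AddCommGroup N] (N' : Submodule ℤ N) : ℚ ⊗[ℤ] N' →ₗ[ℚ] ℚ ⊗[ℤ] N :=
  LinearMap.baseChange ℚ N'.subtype

lemma inclQ_injective {N : Type} [AddCommGroup N] (N' : Submodule ℤ N) :
    Function.Injective (inclQ N') :=
  Module.Flat.lTensor_preserves_injective_linearMap (M := ℚ) N'.subtype N'.injective_subtype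

lemma pair_comp_subtype {N : Type} [AddCommGroup N] (N' : Submodule ℤ N) (m : Module.Dual ℤ N)
    (x : ℚ ⊗[ℤ] N') : pair (m ∘ₗ N'.subtype) x = pair m (inclQ N' x) := by
  simp [pair, inclQ, LinearMap.baseChange_comp]

lemma mem_range_inclQ {N : Type} [AddCommGroup N] {k : ℕ} (u : Fin k → Module.Dual ℤ N)
    (x : ℚ ⊗[ℤ] N) : x ∈ LinearMap.range (inclQ (hyperplaneInter u)) ↔ ∀ j, pair (u j) x = 0 := by
  constructor
  · rintro ⟨y, rfl⟩ j
    rw [← pair_comp_subtype]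
    have : u j ∘ₗ (hyperplaneInter u).subtype = 0 := by
      ext v
      exact (Submodule.mem_iInf _).1 v.2 j
    rw [this]
    simp [pair]
  · intro h
    obtain ⟨n, v, hn, rfl⟩ := exists_tmul_eq x
    have hv : v ∈ hyperplaneInter u := by
      refine (Submodule.mem_iInf _).2 fun j => ?_
      have := h j
      rw [pair_tmul] at this
      have hn' : ((n : ℚ)⁻¹) ≠ 0 := inv_ne_zero (by exact_mod_cast hn)
      exact_mod_cast (mul_eq_zero.1 this).resolve_left hn'
    exact ⟨(n : ℚ)⁻¹ ⊗ₜ ⟨v, hv⟩, by simp [inclQ]⟩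

lemma fg_comap_inclQ {N : Type} [AddCommGroup N] {k : ℕ} (u : Fin k → Module.Dual ℤ N)
    {σ : PointedCone ℚ (ℚ ⊗[ℤ] N)} (hσ : σ.FG) :
    (σ.comap (inclQ (hyperplaneInter u))).FG := by
  classical
  have h1 : ∀ t : Finset (Fin k), ∃ τ : PointedCone ℚ (ℚ ⊗[ℤ] N), τ.FG ∧
      ∀ x, x ∈ τ ↔ x ∈ σ ∧ ∀ j ∈ t, pair (u j) x = 0 := by
    intro t
    induction t using Finset.induction_on with
    | empty => exact ⟨σ, hσ, by simp⟩
    | insert j t _ ih =>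
      obtain ⟨τ, hτ, h⟩ := ih
      refine ⟨_, fg_inf_ker hτ (pair (u j)), fun x => ?_⟩
      rw [Submodule.mem_inf, h, PointedCone.mem_ofSubmodule_iff, LinearMap.mem_ker]
      simp only [Finset.forall_mem_insert]
      tauto
  obtain ⟨τ, hτ, h⟩ := h1 Finset.univ
  refine Submodule.fg_of_fg_map_injective
    ((inclQ (hyperplaneInter u)).restrictScalars {c : ℚ // 0 ≤ c}) (inclQ_injective _) ?_
  convert hτ
  ext x
  rw [h]
  constructor
  · rintro ⟨y, hy, rfl⟩
    exact ⟨hy, fun j _ => (mem_range_inclQ u _).1 ⟨y, rfl⟩ j⟩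
  · rintro ⟨hx, hj⟩
    obtain ⟨y, rfl⟩ := (mem_range_inclQ u x).2 fun j => hj j (Finset.mem_univ j)
    exact ⟨y, hx, rfl⟩

/-- The fan `{σ ∩ N'_ℚ | σ ∈ F}` in the sublattice `N' = N ∩ H_{u_1} ∩ ⋯ ∩ H_{u_k}`. -/
def Fan.restrict {N : Type} [AddCommGroup N] (F : Fan N) {k : ℕ} (u : Fin k → Module.Dual ℤ N) :
    Fan (hyperplaneInter u) where
  cones := (fun σ => PointedCone.comap (inclQ (hyperplaneInter u)) σ) '' F.cones
  finite := F.finite.image _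
  fg := by
    rintro _ ⟨σ, hσ, rfl⟩
    exact fg_comap_inclQ u (F.fg σ hσ)
  salient := by
    rintro _ ⟨σ, hσ, rfl⟩ x hx hx0 hxn
    refine F.salient σ hσ (inclQ _ x) hx ?_ ?_
    · exact fun h => hx0 (inclQ_injective _ (by rw [h, map_zero]))
    · rw [← map_neg]
      exact hxn
  face_mem := by
    rintro _ ⟨σ, hσ, rfl⟩ τ hτ
    let f := inclQ (hyperplaneInter u)
    -- the smallest face of `σ` that contains `τ`
    let S : Set (PointedCone ℚ (ℚ ⊗[ℤ] N)) := {υ | υ.IsFaceOf σ ∧ PointedCone.map f τ ≤ υ}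
    refine ⟨σ ⊓ sInf S, F.face_mem σ hσ _ (PointedCone.IsFaceOf.sInf S fun υ hυ => hυ.1), ?_⟩
    let υ : PointedCone ℚ (ℚ ⊗[ℤ] N) :=
      { carrier := {v | v ∈ σ ∧ ∃ w ∈ τ, f w - v ∈ σ}
        zero_mem' := ⟨zero_mem _, 0, zero_mem _, by simp⟩
        add_mem' := by
          rintro a b ⟨ha, w, hw, hw'⟩ ⟨hb, z, hz, hz'⟩
          refine ⟨add_mem ha hb, w + z, add_mem hw hz, ?_⟩
          rw [map_add, add_sub_add_comm]
          exact add_mem hw' hz'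
        smul_mem' := by
          rintro c a ⟨ha, w, hw, hw'⟩
          refine ⟨Submodule.smul_mem _ c ha, c • w, Submodule.smul_mem _ c hw, ?_⟩
          have : f (c • w) = c • f w := map_smul f (c : ℚ) w
          have h2 : c • f w - c • a = c • (f w - a) := (smul_sub (c : ℚ) _ _).symm
          rw [this, h2]
          exact Submodule.smul_mem _ c hw' }
    have hυ : υ ∈ S := by
      refine ⟨⟨fun v hv => hv.1, ?_⟩, ?_⟩
      · rintro x y a hx hy ha ⟨-, w, hw, hw'⟩
        refine ⟨hx, a⁻¹ • w, PointedCone.smul_mem _ (inv_nonneg.2 ha.le) hw, ?_⟩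
        have : f (a⁻¹ • w) - x = a⁻¹ • ((f w - (a • x + y)) + y) := by
          rw [map_smul]
          have : f w - (a • x + y) + y = f w - a • x := by abel
          rw [this, smul_sub, smul_smul, inv_mul_cancel₀ ha.ne', one_smul]
        rw [this]
        exact PointedCone.smul_mem _ (inv_nonneg.2 ha.le) (add_mem hw' hy)
      · rintro _ ⟨w, hw, rfl⟩
        refine ⟨hτ.le hw, w, hw, ?_⟩
        change f w - f w ∈ σ
        simp
    ext x
    constructor
    · rintro ⟨hx, hx'⟩
      obtain ⟨-, w, hw, hw'⟩ := (Submodule.mem_sInf.1 hx') υ hυ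
      refine hτ.mem_of_add_mem_left (y := w - x) hx ?_ ?_
      · change f (w - x) ∈ σ
        rw [map_sub]
        exact hw'
      · rwa [add_sub_cancel]
    · intro hx
      refine ⟨hτ.le hx, Submodule.mem_sInf.2 fun υ' hυ' => hυ'.2 ⟨x, hx, rfl⟩⟩
  inter_face := by
    rintro _ ⟨σ, hσ, rfl⟩ _ ⟨τ, hτ, rfl⟩
    obtain ⟨m, hm, h⟩ := F.inter_face σ hσ τ hτ
    refine ⟨m ∘ₗ (hyperplaneInter u).subtype, fun x hx => ?_, fun x => ?_⟩
    · rw [pair_comp_subtype]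
      exact hm _ hx
    · rw [pair_comp_subtype]
      exact h (inclQ _ x)

/-- The character `χ ∈ 𝕃^*` as an element of `𝕃^* ⊗ ℚ = Hom(𝕃, ℚ)`. -/
def toQ {𝕃 : Type} [AddCommGroup 𝕃] (χ : Module.Dual ℤ 𝕃) : 𝕃 →ₗ[ℤ] ℚ :=
  Algebra.linearMap ℤ ℚ ∘ₗ χ

lemma toQ_apply {𝕃 : Type} [AddCommGroup 𝕃] (χ : Module.Dual ℤ 𝕃) (x : 𝕃) :
    toQ χ x = (χ x : ℚ) := rfl

/-- GIT data `(K; 𝕃; D_1, …, D_R; ω)`, where `𝕃` is the lattice of one-parameter subgroups of the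
torus `K = 𝕃 ⊗ ℂˣ`, the `D_i` are characters of `K`, and `ω ∈ 𝕃^* ⊗ ℚ`. The characters are nonzero
and span a strictly convex cone (some `ℓ ∈ 𝕃` is positive on all of them) which is full-dimensional
and contains `ω`. -/
structure GITData (𝕃 : Type) [AddCommGroup 𝕃] (R : ℕ) where
  D : Fin R → Module.Dual ℤ 𝕃
  ω : 𝕃 →ₗ[ℤ] ℚ
  strictly_convex : ∃ ℓ : 𝕃, ∀ i, 0 < D i ℓ
  full_dim : Submodule.span ℚ (Set.range fun i => toQ (D i)) = ⊤
  ω_mem : ω ∈ PointedCone.hull ℚ (Set.range fun i => toQ (D i))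

namespace GITData

variable {𝕃 : Type} [AddCommGroup 𝕃] {R : ℕ} (Θ : GITData 𝕃 R)

/-- The set `𝒜_ω` of subsets `I ⊆ [R]` that cover `ω`. The semistable locus `V_ω ⊆ ℂ^R` is the union
over `I ∈ 𝒜_ω` of the open sets `(ℂˣ)^I × ℂ^{[R] ∖ I}`, and `Y` is the quotient of `V_ω` by `K`. -/
def covers : Set (Finset (Fin R)) :=
  {I | ∃ a : Fin R → ℚ, (∀ i ∈ I, 0 < a i) ∧ Θ.ω = ∑ i ∈ I, a i • toQ (Θ.D i)}

/-- `[V_ω / K]` is a toric orbifold: all stabilizers are finite (the characters `D_i`, `i ∈ I`, of a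
point with nonzero coordinates `I` span `𝕃^* ⊗ ℚ`), and the generic stabilizer is trivial. -/
structure IsOrbifold : Prop where
  finite_stabilizers : ∀ I ∈ Θ.covers,
    Submodule.span ℚ ((fun i => toQ (Θ.D i)) '' (I : Set (Fin R))) = ⊤
  trivial_generic_stabilizer : Submodule.span ℤ (Set.range Θ.D) = ⊤

/-- The map `𝕃 → ℤ^R` dual to `e_i ↦ D_i`. -/
def embed : 𝕃 →ₗ[ℤ] (Fin R → ℤ) := LinearMap.pi Θ.D

/-- The lattice `N`, the cokernel of `𝕃 → ℤ^R`. -/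
abbrev N : Type := (Fin R → ℤ) ⧸ LinearMap.range Θ.embed

/-- `ρ_i ∈ N`, the image of the `i`-th standard basis vector. -/
def ρ (i : Fin R) : Θ.N := Submodule.Quotient.mk (Pi.single i 1)

/-- An integral relation `∑ z_i D_i = 0`, viewed as an element of `M = Hom(N, ℤ)`. -/
def ofRelation (z : Fin R → ℤ) (hz : ∑ i, z i • Θ.D i = 0) : Module.Dual ℤ Θ.N :=
  Submodule.liftQ _ (∑ i, z i • (LinearMap.proj i : (Fin R → ℤ) →ₗ[ℤ] ℤ)) (by
    rintro _ ⟨x, rfl⟩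
    have := LinearMap.congr_fun hz x
    simpa [embed, LinearMap.sum_apply] using this)

lemma ofRelation_ρ (z : Fin R → ℤ) (hz : ∑ i, z i • Θ.D i = 0) (i : Fin R) :
    Θ.ofRelation z hz (Θ.ρ i) = z i := by
  rw [ofRelation, ρ, Submodule.liftQ_apply]
  simp [LinearMap.sum_apply, Pi.single_apply]

lemma relation (m : Module.Dual ℤ Θ.N) : ∑ i, m (Θ.ρ i) • Θ.D i = 0 := by
  ext x
  have h : (Submodule.Quotient.mk (Θ.embed x) : Θ.N) = 0 :=
    (Submodule.Quotient.mk_eq_zero _).2 ⟨x, rfl⟩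
  have h2 : Θ.embed x = ∑ i, Θ.D i x • (Pi.single i 1 : Fin R → ℤ) := by
    ext j
    simp [embed, Pi.single_apply]
  have h3 := congrArg m h
  rw [h2, map_zero, ← Submodule.mkQ_apply, map_sum, map_sum] at h3
  simp only [map_smul, Submodule.mkQ_apply] at h3
  rw [LinearMap.sum_apply, LinearMap.zero_apply, ← h3]
  refine Finset.sum_congr rfl fun i _ => ?_
  rw [LinearMap.smul_apply, smul_eq_mul, smul_eq_mul, mul_comm]
  rfl

lemma exists_dual (a : Fin R → ℚ) (ha : ∑ i, a i • toQ (Θ.D i) = 0) :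
    ∃ (n : ℕ) (m : Module.Dual ℤ Θ.N), 0 < n ∧ ∀ i, (m (Θ.ρ i) : ℚ) = n * a i := by
  let n : ℕ := ∏ i, (a i).den
  have hn : 0 < n := Finset.prod_pos fun i _ => (a i).den_pos
  have hz : ∀ i, ∃ z : ℤ, (z : ℚ) = n * a i := by
    intro i
    obtain ⟨c, hc⟩ : (a i).den ∣ n := Finset.dvd_prod_of_mem _ (Finset.mem_univ i)
    refine ⟨c * (a i).num, ?_⟩
    rw [hc]
    push_cast
    rw [mul_comm ((a i).den : ℚ), mul_assoc, Rat.den_mul_eq_num]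
  choose z hz using hz
  have hrel : ∑ i, z i • Θ.D i = 0 := by
    ext x
    have h := LinearMap.congr_fun ha x
    simp only [LinearMap.sum_apply, LinearMap.smul_apply, toQ_apply, smul_eq_mul,
      LinearMap.zero_apply] at h ⊢
    have : ((∑ i, z i * Θ.D i x : ℤ) : ℚ) = n * ∑ i, a i * (Θ.D i x : ℚ) := by
      push_cast
      rw [Finset.mul_sum]
      exact Finset.sum_congr rfl fun i _ => by rw [hz, mul_assoc]
    rw [h, mul_zero] at this
    exact_mod_cast this
  exact ⟨n, Θ.ofRelation z hrel, hn, fun i => by rw [ofRelation_ρ, hz]⟩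

/-- The cone `σ_I ⊆ N_ℚ` spanned by the `ρ_i` with `i ∉ I`. -/
def cone (I : Finset (Fin R)) : PointedCone ℚ (ℚ ⊗[ℤ] Θ.N) :=
  PointedCone.hull ℚ ((fun i => (1 : ℚ) ⊗ₜ[ℤ] Θ.ρ i) '' {i | i ∉ I})

lemma ray_mem_cone {I : Finset (Fin R)} {i : Fin R} (hi : i ∉ I) :
    (1 : ℚ) ⊗ₜ[ℤ] Θ.ρ i ∈ Θ.cone I :=
  Submodule.subset_span ⟨i, hi, rfl⟩

lemma sum_mem_cone {I : Finset (Fin R)} {c : Fin R → ℚ} (h0 : ∀ i, 0 ≤ c i)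
    (hI : ∀ i ∈ I, c i = 0) : ∑ i, c i • ((1 : ℚ) ⊗ₜ[ℤ] Θ.ρ i) ∈ Θ.cone I := by
  refine sum_mem fun i _ => ?_
  by_cases hi : i ∈ I
  · rw [hI i hi, zero_smul]
    exact zero_mem _
  · exact PointedCone.smul_mem _ (h0 i) (Θ.ray_mem_cone hi)

lemma exists_of_mem_cone {I : Finset (Fin R)} {x : ℚ ⊗[ℤ] Θ.N} (hx : x ∈ Θ.cone I) :
    ∃ c : Fin R → ℚ, (∀ i, 0 ≤ c i) ∧ (∀ i ∈ I, c i = 0) ∧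
      x = ∑ i, c i • ((1 : ℚ) ⊗ₜ[ℤ] Θ.ρ i) := by
  classical
  induction hx using Submodule.span_induction with
  | mem x hx =>
    obtain ⟨i, hi, rfl⟩ := hx
    refine ⟨Pi.single i 1, fun j => ?_, fun j hj => ?_, ?_⟩
    · by_cases h : j = i
      · subst h; simp
      · simp [h]
    · have : j ≠ i := fun h => hi (h ▸ hj)
      simp [this]
    · rw [Finset.sum_eq_single i]
      · simp
      · intro j _ hj
        simp [hj]
      · simp
  | zero => exact ⟨0, by simp, by simp, by simp⟩
  | add x y _ _ hx hy =>
    obtain ⟨c, h1, h2, rfl⟩ := hx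
    obtain ⟨d, h3, h4, rfl⟩ := hy
    refine ⟨c + d, fun i => add_nonneg (h1 i) (h3 i), fun i hi => ?_, ?_⟩
    · simp [h2 i hi, h4 i hi]
    · simp [add_smul, Finset.sum_add_distrib]
  | smul q x _ hx =>
    obtain ⟨c, h1, h2, rfl⟩ := hx
    refine ⟨fun i => (q : ℚ) * c i, fun i => mul_nonneg q.2 (h1 i), fun i hi => ?_, ?_⟩
    · simp [h2 i hi]
    · change (q : ℚ) • (∑ i, c i • ((1 : ℚ) ⊗ₜ[ℤ] Θ.ρ i)) = _
      rw [Finset.smul_sum]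
      exact Finset.sum_congr rfl fun i _ => (mul_smul _ _ _).symm

lemma pair_sum (m : Module.Dual ℤ Θ.N) (c : Fin R → ℚ) :
    pair m (∑ i, c i • ((1 : ℚ) ⊗ₜ[ℤ] Θ.ρ i)) = ∑ i, c i * (m (Θ.ρ i) : ℚ) := by
  rw [map_sum]
  refine Finset.sum_congr rfl fun i _ => ?_
  rw [map_smul, pair_tmul, one_mul, smul_eq_mul]

lemma covers_insert {Θ : GITData 𝕃 R} (h : Θ.IsOrbifold) {I : Finset (Fin R)} (hI : I ∈ Θ.covers)
    (j : Fin R) : insert j I ∈ Θ.covers := by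
  by_cases hj : j ∈ I
  · rwa [Finset.insert_eq_of_mem hj]
  have hsp := h.finite_stabilizers I hI
  obtain ⟨a, ha, hω⟩ := hI
  have hmem : toQ (Θ.D j) ∈ Submodule.span ℚ ((fun i => toQ (Θ.D i)) '' (I : Set (Fin R))) := by
    rw [hsp]; trivial
  obtain ⟨c, hc⟩ := Submodule.mem_span_image_finset_iff_exists_fun' ℚ |>.1 hmem
  have hε : ∀ J : Finset (Fin R), J ⊆ I → ∃ ε : ℚ, 0 < ε ∧ ∀ i ∈ J, 0 < a i - ε * c i := by
    intro J
    induction J using Finset.induction_on with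
    | empty => intro _; exact ⟨1, one_pos, by simp⟩
    | insert i J _ ih =>
      intro hJ
      obtain ⟨ε, h0, h1⟩ := ih fun x hx => hJ (Finset.mem_insert_of_mem hx)
      have hai := ha i (hJ (Finset.mem_insert_self i J))
      let δ : ℚ := a i / (|c i| + 1)
      have hδ : 0 < δ := by positivity
      have hb : ∀ x, 0 < a x → ∀ η θ : ℚ, 0 < η → η ≤ θ → 0 < a x - θ * c x →
          0 < a x - η * c x := by
        intro x hx η θ h2 h3 h4
        rcases le_or_gt (c x) 0 with h5 | h5
        · nlinarith
        · nlinarith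
      refine ⟨min ε δ, lt_min h0 hδ, fun x hx => ?_⟩
      rcases Finset.mem_insert.1 hx with rfl | hx
      · refine hb x hai _ δ (lt_min h0 hδ) (min_le_right _ _) ?_
        have h6 : δ * (|c x| + 1) = a x := div_mul_cancel₀ _ (by positivity)
        have h7 : c x ≤ |c x| := le_abs_self _
        nlinarith
      · exact hb x (ha x (hJ (Finset.mem_insert_of_mem hx))) _ ε (lt_min h0 hδ)
          (min_le_left _ _) (h1 x hx)
  obtain ⟨ε, h0, h1⟩ := hε I (Finset.Subset.refl I)
  refine ⟨fun i => if i = j then ε else a i - ε * c i, fun i hi => ?_, ?_⟩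
  · rcases Finset.mem_insert.1 hi with rfl | hi
    · simpa using h0
    · have : i ≠ j := fun h => hj (h ▸ hi)
      simpa [this] using h1 i hi
  · rw [Finset.sum_insert hj, hω]
    have : ∀ i ∈ I, (if i = j then ε else a i - ε * c i) • toQ (Θ.D i) =
        a i • toQ (Θ.D i) - ε • (c i • toQ (Θ.D i)) := by
      intro i hi
      have : i ≠ j := fun h => hj (h ▸ hi)
      rw [if_neg this, sub_smul, mul_smul]
    rw [Finset.sum_congr rfl this, Finset.sum_sub_distrib, ← Finset.smul_sum, hc]
    simp only [if_true]
    abel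

lemma covers_mono {Θ : GITData 𝕃 R} (h : Θ.IsOrbifold) {I J : Finset (Fin R)} (hI : I ∈ Θ.covers)
    (hIJ : I ⊆ J) : J ∈ Θ.covers := by
  have : ∀ T : Finset (Fin R), I ∪ T ∈ Θ.covers := by
    intro T
    induction T using Finset.induction_on with
    | empty => rwa [Finset.union_empty]
    | insert j T _ ih => rw [Finset.union_insert]; exact covers_insert h ih j
  rw [← Finset.union_eq_right.2 hIJ]
  exact this J

/-- The fan `Σ` of `Y`, whose cones are the cones spanned by `{ρ_i | i ∈ I}` with
`[R] ∖ I ∈ 𝒜_ω`. -/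
def fan (h : Θ.IsOrbifold) : Fan Θ.N where
  cones := Θ.cone '' Θ.covers
  finite := (Set.toFinite _).image _
  fg := by
    rintro _ ⟨I, -, rfl⟩
    exact Submodule.fg_span (Set.toFinite _)
  salient := by
    rintro _ ⟨I, hI, rfl⟩ x hx hx0 hxn
    have hmem : -∑ j ∈ Finset.univ \ I, toQ (Θ.D j) ∈
        Submodule.span ℚ ((fun i => toQ (Θ.D i)) '' (I : Set (Fin R))) := by
      rw [h.finite_stabilizers I hI]; trivial
    obtain ⟨c, hc⟩ := Submodule.mem_span_image_finset_iff_exists_fun' ℚ |>.1 hmem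
    obtain ⟨n, m, hn, hm⟩ := Θ.exists_dual (fun i => if i ∈ I then c i else 1) (by
      have e1 : ∑ i ∈ Finset.univ \ I, (if i ∈ I then c i else 1) • toQ (Θ.D i) =
          ∑ i ∈ Finset.univ \ I, toQ (Θ.D i) :=
        Finset.sum_congr rfl fun i hi => by rw [if_neg (Finset.mem_sdiff.1 hi).2, one_smul]
      have e2 : ∑ i ∈ I, (if i ∈ I then c i else 1) • toQ (Θ.D i) =
          ∑ i ∈ I, c i • toQ (Θ.D i) :=
        Finset.sum_congr rfl fun i hi => by rw [if_pos hi]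
      rw [← Finset.sum_sdiff (Finset.subset_univ I), e1, e2, hc, add_neg_cancel])
    have hpos : ∀ i, i ∉ I → 0 < (m (Θ.ρ i) : ℚ) := by
      intro i hi
      rw [hm, if_neg hi, mul_one]
      exact_mod_cast hn
    have hnn : ∀ y ∈ Θ.cone I, 0 ≤ pair m y := by
      intro y hy
      obtain ⟨d, h1, h2, rfl⟩ := Θ.exists_of_mem_cone hy
      rw [pair_sum]
      refine Finset.sum_nonneg fun i _ => ?_
      by_cases hi : i ∈ I
      · rw [h2 i hi, zero_mul]
      · exact mul_nonneg (h1 i) (hpos i hi).le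
    have e1 := hnn x hx
    have e2 := hnn (-x) hxn
    rw [map_neg] at e2
    have e3 : pair m x = 0 := by linarith
    apply hx0
    obtain ⟨d, h1, h2, rfl⟩ := Θ.exists_of_mem_cone hx
    rw [pair_sum] at e3
    have e4 := (Finset.sum_eq_zero_iff_of_nonneg fun i _ => by
      by_cases hi : i ∈ I
      · rw [h2 i hi, zero_mul]
      · exact mul_nonneg (h1 i) (hpos i hi).le).1 e3
    refine Finset.sum_eq_zero fun i hi => ?_
    by_cases hiI : i ∈ I
    · rw [h2 i hiI, zero_smul]
    · rw [(mul_eq_zero.1 (e4 i hi)).resolve_right (hpos i hiI).ne', zero_smul]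
  face_mem := by
    classical
    rintro _ ⟨I, hI, rfl⟩ τ hτ
    let J : Finset (Fin R) := I ∪ Finset.univ.filter fun i => (1 : ℚ) ⊗ₜ[ℤ] Θ.ρ i ∉ τ
    refine ⟨J, covers_mono h hI Finset.subset_union_left, le_antisymm ?_ ?_⟩
    · refine Submodule.span_le.2 ?_
      rintro _ ⟨i, hi, rfl⟩
      by_contra hiτ
      exact hi (Finset.mem_union_right _ (Finset.mem_filter.2 ⟨Finset.mem_univ i, hiτ⟩))
    · intro x hx
      obtain ⟨c, h1, h2, rfl⟩ := Θ.exists_of_mem_cone (hτ.le hx)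
      refine Θ.sum_mem_cone h1 fun i hi => ?_
      rcases Finset.mem_union.1 hi with hi | hi
      · exact h2 i hi
      · by_contra hci
        have hciI : i ∉ I := fun h => hci (h2 i h)
        refine (Finset.mem_filter.1 hi).2 (hτ.mem_of_smul_add_mem (Θ.ray_mem_cone hciI)
          (y := ∑ j, (if j = i then 0 else c j) • ((1 : ℚ) ⊗ₜ[ℤ] Θ.ρ j)) (a := c i) ?_
          (lt_of_le_of_ne (h1 i) (Ne.symm hci)) ?_)
        · refine Θ.sum_mem_cone (fun j => ?_) fun j hj => ?_
          · split_ifs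
            · exact le_rfl
            · exact h1 j
          · split_ifs
            · rfl
            · exact h2 j hj
        · convert hx using 1
          rw [← Finset.add_sum_erase _ _ (Finset.mem_univ i),
            ← Finset.add_sum_erase _ (fun j => c j • ((1 : ℚ) ⊗ₜ[ℤ] Θ.ρ j)) (Finset.mem_univ i)]
          rw [if_pos rfl, zero_smul, zero_add]
          congr 1
          refine Finset.sum_congr rfl fun j hj => ?_
          rw [if_neg (Finset.ne_of_mem_erase hj)]
  inter_face := by
    classical
    rintro _ ⟨I, ⟨a, ha, haω⟩, rfl⟩ _ ⟨J, ⟨b, hb, hbω⟩, rfl⟩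
    obtain ⟨n, m, hn, hm⟩ := Θ.exists_dual
      (fun i => (if i ∈ J then b i else 0) - (if i ∈ I then a i else 0)) (by
        simp only [sub_smul, ite_smul, zero_smul, Finset.sum_sub_distrib, Finset.sum_ite_mem,
          Finset.univ_inter]
        rw [← haω, ← hbω, sub_self])
    have hn' : (0 : ℚ) < n := by exact_mod_cast hn
    have hI : ∀ i, i ∉ I → 0 ≤ (m (Θ.ρ i) : ℚ) := by
      intro i hi
      rw [hm, if_neg hi, sub_zero]
      split_ifs with h
      · exact mul_nonneg hn'.le (hb i h).le
      · simp
    have hIJ : ∀ i, i ∉ I → i ∈ J → 0 < (m (Θ.ρ i) : ℚ) := by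
      intro i hi hj
      rw [hm, if_neg hi, sub_zero, if_pos hj]
      exact mul_pos hn' (hb i hj)
    have hJ : ∀ i, i ∉ J → (m (Θ.ρ i) : ℚ) ≤ 0 := by
      intro i hi
      rw [hm, if_neg hi, zero_sub]
      split_ifs with h
      · exact mul_nonpos_of_nonneg_of_nonpos hn'.le (neg_nonpos.2 (ha i h).le)
      · simp
    have hnn : m ∈ dualMonoid (Θ.cone I) := by
      intro y hy
      obtain ⟨d, h1, h2, rfl⟩ := Θ.exists_of_mem_cone hy
      rw [pair_sum]
      refine Finset.sum_nonneg fun i _ => ?_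
      by_cases hi : i ∈ I
      · rw [h2 i hi, zero_mul]
      · exact mul_nonneg (h1 i) (hI i hi)
    refine ⟨m, hnn, fun x => ⟨?_, ?_⟩⟩
    · rintro ⟨hx, hx'⟩
      refine ⟨hx, le_antisymm ?_ (hnn x hx)⟩
      obtain ⟨d, h1, h2, rfl⟩ := Θ.exists_of_mem_cone hx'
      rw [pair_sum]
      refine Finset.sum_nonpos fun i _ => ?_
      by_cases hi : i ∈ J
      · rw [h2 i hi, zero_mul]
      · exact mul_nonpos_of_nonneg_of_nonpos (h1 i) (hJ i hi)
    · rintro ⟨hx, hx0⟩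
      refine ⟨hx, ?_⟩
      obtain ⟨d, h1, h2, rfl⟩ := Θ.exists_of_mem_cone hx
      rw [pair_sum] at hx0
      have h3 := (Finset.sum_eq_zero_iff_of_nonneg fun i _ => by
        by_cases hi : i ∈ I
        · rw [h2 i hi, zero_mul]
        · exact mul_nonneg (h1 i) (hI i hi)).1 hx0
      refine Θ.sum_mem_cone h1 fun i hi => ?_
      by_cases hiI : i ∈ I
      · exact h2 i hiI
      · exact (mul_eq_zero.1 (h3 i (Finset.mem_univ i))).resolve_right (hIJ i hiI hi).ne'

/-- The toric variety `Y = X_Σ`, the coarse moduli space of the toric orbifold `[V_ω / K]`. -/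
abbrev Y (h : Θ.IsOrbifold) : Scheme.{0} := (Θ.fan h).toricVariety

/-- The ring of functions on the open set `(ℂˣ)^I × ℂ^{[R] ∖ I}` of `ℂ^R`: the Laurent polynomials
in `x_1, …, x_R` whose exponents at all `i ∉ I` are nonnegative. -/
def coxChart (R : ℕ) (I : Finset (Fin R)) : Subalgebra ℂ (AddMonoidAlgebra ℂ (Fin R → ℤ)) where
  carrier := {f | ∀ e ∈ f.coeff.support, ∀ i, i ∉ I → 0 ≤ e i}
  mul_mem' := by
    classical
    intro f g hf hg e he i hi
    obtain ⟨a, ha, b, hb, rfl⟩ := Finset.mem_add.1 (AddMonoidAlgebra.support_coeff_mul_subset f g he)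
    exact add_nonneg (hf a ha i hi) (hg b hb i hi)
  add_mem' := by
    classical
    intro f g hf hg e he i hi
    rw [AddMonoidAlgebra.coeff_add] at he
    rcases Finset.mem_union.1 (Finsupp.support_add he) with h | h
    · exact hf e h i hi
    · exact hg e h i hi
  algebraMap_mem' := by
    classical
    intro c e he i _
    have : e = 0 := by
      by_contra hne
      refine Finsupp.mem_support_iff.1 he ?_
      rw [AddMonoidAlgebra.coe_algebraMap]
      simp [AddMonoidAlgebra.coeff_single, Ne.symm hne]
    rw [this]
    rfl

lemma single_mem_coxChart {R : ℕ} {I : Finset (Fin R)} {e : Fin R → ℤ} (he : ∀ i, i ∉ I → 0 ≤ e i)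
    (c : ℂ) : AddMonoidAlgebra.single e c ∈ coxChart R I := by
  classical
  intro e' he' i hi
  have : e' = e := by
    by_contra hne
    refine Finsupp.mem_support_iff.1 he' ?_
    simp [AddMonoidAlgebra.coeff_single, Ne.symm hne]
  rw [this]
  exact he i hi

/-- The space `H⁰(Y, χ)` of sections of the line bundle `χ`: the regular functions on
`V_ω = ⋃ (ℂˣ)^I × ℂ^{[R] ∖ I}` on which `K` acts with character `χ`. -/
def sections (χ : Module.Dual ℤ 𝕃) : Submodule ℂ (AddMonoidAlgebra ℂ (Fin R → ℤ)) where
  carrier := {f | (∀ I ∈ Θ.covers, f ∈ coxChart R I) ∧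
    ∀ e ∈ f.coeff.support, ∑ i, e i • Θ.D i = χ}
  zero_mem' := ⟨fun I _ => zero_mem _, fun e he => by simp at he⟩
  add_mem' := by
    classical
    intro f g hf hg
    refine ⟨fun I hI => add_mem (hf.1 I hI) (hg.1 I hI), fun e he => ?_⟩
    rw [AddMonoidAlgebra.coeff_add] at he
    rcases Finset.mem_union.1 (Finsupp.support_add he) with h | h
    · exact hf.2 e h
    · exact hg.2 e h
  smul_mem' := by
    intro c f hf
    refine ⟨fun I hI => Subalgebra.smul_mem _ (hf.1 I hI) c, fun e he => ?_⟩
    rw [AddMonoidAlgebra.coeff_smul] at he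
    exact hf.2 e (Finsupp.support_smul he)

/-- The exponent vector `(⟨m, ρ_1⟩, …, ⟨m, ρ_R⟩)` of the Laurent monomial on `ℂ^R` given by `m`. -/
def exponent : Module.Dual ℤ Θ.N →+ (Fin R → ℤ) where
  toFun m i := m (Θ.ρ i)
  map_zero' := rfl
  map_add' _ _ := rfl

lemma exponent_nonneg {I : Finset (Fin R)} (m : dualMonoid (Θ.cone I)) (i : Fin R) (hi : i ∉ I) :
    0 ≤ Θ.exponent m.1 i := by
  have := m.2 _ (Θ.ray_mem_cone hi)
  rw [pair_tmul, one_mul] at this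
  exact_mod_cast this

/-- The map `ℂ[σ_I^∨ ∩ M] → ℂ[x_1, …, x_R][x_i⁻¹ | i ∈ I]`, `χ^m ↦ ∏ x_i^{⟨m, ρ_i⟩}`, given by the
quotient map from `(ℂˣ)^I × ℂ^{[R] ∖ I}` to the chart `U_{σ_I}` of `Y`. -/
def chartHom (I : Finset (Fin R)) : coordRing (Θ.cone I) →ₐ[ℂ] coxChart R I :=
  (AddMonoidAlgebra.mapDomainAlgHom ℂ ℂ (Θ.exponent.comp (dualMonoid (Θ.cone I)).subtype)).codRestrict
    (coxChart R I) (by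
      intro f
      induction f using AddMonoidAlgebra.induction_linear with
      | zero => rw [map_zero]; exact zero_mem _
      | add f g hf hg => rw [map_add]; exact add_mem hf hg
      | single m c =>
        simp only [AddMonoidAlgebra.mapDomainAlgHom_apply, AddMonoidAlgebra.mapDomain_single]
        exact single_mem_coxChart (Θ.exponent_nonneg m) c)

variable {k : ℕ} {χ : Fin k → Module.Dual ℤ 𝕃}

/-- The ideal `(s_1, …, s_k)` of the ring of functions on `(ℂˣ)^I × ℂ^{[R] ∖ I}`. -/
def coxIdeal (s : ∀ j, Θ.sections (χ j)) (I : Θ.covers) : Ideal (coxChart R I.1) :=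
  Ideal.span (Set.range fun j => ⟨(s j).1, (s j).2.1 I.1 I.2⟩)

/-- The ideal of the zero locus of `(s_1, …, s_k)` in the chart `U_{σ_I}` of `Y`. -/
def chartIdeal (s : ∀ j, Θ.sections (χ j)) (I : Θ.covers) : Ideal (coordRing (Θ.cone I.1)) :=
  (Θ.coxIdeal s I).comap (Θ.chartHom I.1)

/-- The ideal sheaf on `Y` of the zero locus of `(s_1, …, s_k)`: the functions on `Y` that vanish on
the zero locus in every chart. -/
def zeroIdeal (h : Θ.IsOrbifold) (s : ∀ j, Θ.sections (χ j)) : (Θ.Y h).IdealSheafData :=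
  ⨅ I : Θ.covers,
    (Spec.map (CommRingCat.ofHom (Ideal.Quotient.mk (Θ.chartIdeal s I))) ≫
      (Θ.fan h).chart (Θ.cone I.1) ⟨I.1, I.2, rfl⟩).ker

/-- The closed subscheme of `Y` cut out by sections `s_1, …, s_k` of line bundles on `Y`. -/
abbrev zeroScheme (h : Θ.IsOrbifold) (s : ∀ j, Θ.sections (χ j)) : Scheme.{0} :=
  (Θ.zeroIdeal h s).subscheme

/-- The section `(s_1, …, s_k)` is regular: at each point of its zero locus in `V_ω`, the germs of
`s_1, …, s_k` form a regular sequence in the local ring. -/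
def IsRegularSection (s : ∀ j, Θ.sections (χ j)) : Prop :=
  ∀ I : Θ.covers, ∀ p : Ideal (coxChart R I.1), ∀ _ : p.IsPrime, Θ.coxIdeal s I ≤ p →
    RingTheory.Sequence.IsRegular (Localization.AtPrime p)
      (List.ofFn fun j => algebraMap (coxChart R I.1) (Localization.AtPrime p)
        ⟨(s j).1, (s j).2.1 I.1 I.2⟩)

/-- The line bundle `χ` on `[V_ω / K]` is pulled back from the coarse moduli space: `χ` is trivial on
the stabilizer `⋂_{i ∈ I} ker D_i` of each point of `V_ω`, `I` being its set of nonzero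
coordinates. -/
def DescendsToCoarse (χ : Module.Dual ℤ 𝕃) : Prop :=
  ∀ I ∈ Θ.covers, χ ∈ Submodule.span ℤ (Θ.D '' (I : Set (Fin R)))

/-- The line bundle `χ` on `Y` is nef: for each chart `U_{σ_I}` it is represented by an effective
torus-invariant `ℚ`-divisor `∑ a_i {x_i = 0}` whose support does not meet the chart. The coefficients
`a_i` are unconstrained when `x_i` vanishes nowhere on `V_ω`. -/
def IsNef (χ : Module.Dual ℤ 𝕃) : Prop :=
  ∀ I ∈ Θ.covers, ∃ a : Fin R → ℚ, (∀ i, i ∉ I → a i = 0) ∧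
    (∀ i, Finset.univ.erase i ∈ Θ.covers → 0 ≤ a i) ∧ toQ χ = ∑ i, a i • toQ (Θ.D i)

/-- A line bundle is convex if it is nef and pulled back from the coarse moduli space. -/
def IsConvex (χ : Module.Dual ℤ 𝕃) : Prop := Θ.IsNef χ ∧ Θ.DescendsToCoarse χ

end GITData

/-- A convex partition with basis `B, S_1, …, S_k, U` of `[R]`. -/
structure ConvexPartition {𝕃 : Type} [AddCommGroup 𝕃] {R : ℕ} (Θ : GITData 𝕃 R) (k : ℕ) where
  B : Finset (Fin R)
  S : Fin k → Finset (Fin R)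
  U : Finset (Fin R)
  cover : ∀ i, i ∈ B ∨ (∃ j, i ∈ S j) ∨ i ∈ U
  disjoint_B_S : ∀ j, Disjoint B (S j)
  disjoint_B_U : Disjoint B U
  disjoint_S_U : ∀ j, Disjoint (S j) U
  disjoint_S_S : ∀ j j', j ≠ j' → Disjoint (S j) (S j')
  linearIndependent : LinearIndependent ℤ fun b : B => Θ.D b
  span_eq_top : ⊤ ≤ Submodule.span ℤ (Set.range fun b : B => Θ.D b)
  ω_nonneg : ∃ c : B → ℚ, (∀ b, 0 ≤ c b) ∧ Θ.ω = ∑ b, c b • toQ (Θ.D b)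
  S_nonempty : ∀ j, (S j).Nonempty
  convex : ∀ j, Θ.IsConvex (∑ i ∈ S j, Θ.D i)
  L_nonneg : ∀ j, ∃ c : B → ℤ, (∀ b, 0 ≤ c b) ∧ ∑ i ∈ S j, Θ.D i = ∑ b, c b • Θ.D b

namespace ConvexPartition

variable {𝕃 : Type} [AddCommGroup 𝕃] {R : ℕ} {Θ : GITData 𝕃 R} {k : ℕ} (P : ConvexPartition Θ k)

/-- The line bundle `L_j = ∑_{i ∈ S_j} D_i`. -/
def L (j : Fin k) : Module.Dual ℤ 𝕃 := ∑ i ∈ P.S j, Θ.D i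

/-- The basis `{D_b | b ∈ B}` of `𝕃^*`. -/
def basis : Module.Basis P.B ℤ (Module.Dual ℤ 𝕃) :=
  Module.Basis.mk P.linearIndependent P.span_eq_top

/-- The entry `m_{b,i}` of the weight matrix: `D_i = ∑_b m_{b,i} D_b`. -/
def weight (b : P.B) (i : Fin R) : ℤ := P.basis.repr (Θ.D i) b

/-- `l_{b,j} = ∑_{i ∈ S_j} m_{b,i}`. -/
def l (b : P.B) (j : Fin k) : ℤ := ∑ i ∈ P.S j, P.weight b i

lemma sum_l (j : Fin k) : ∑ b, P.l b j • Θ.D b = P.L j := by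
  have h := P.basis.sum_repr (P.L j)
  rw [← h]
  refine Finset.sum_congr rfl fun b _ => ?_
  congr 1
  · simp [l, weight, L, map_sum, Finsupp.finsetSum_apply]
  · simp [basis]

lemma l_nonneg (b : P.B) (j : Fin k) : 0 ≤ P.l b j := by
  obtain ⟨c, hc, h⟩ := P.L_nonneg j
  have h1 : P.l b j = P.basis.repr (P.L j) b := by
    simp [l, weight, L, map_sum, Finsupp.finsetSum_apply]
  have h2 : P.L j = ∑ b, c b • P.basis b := by
    rw [L, h]
    simp [basis]
  rw [h1, h2, Module.Basis.repr_sum_self]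
  exact hc b

/-- The exponent vector of `∏_{b ∈ B} x_b^{l_{b,j}}`. -/
def expB (j : Fin k) : Fin R → ℤ := fun i => if h : i ∈ P.B then P.l ⟨i, h⟩ j else 0

/-- The exponent vector of `∏_{i ∈ S_j} x_i`. -/
def expS (j : Fin k) : Fin R → ℤ := fun i => if i ∈ P.S j then 1 else 0

lemma sum_expB (j : Fin k) : ∑ i, P.expB j i • Θ.D i = P.L j := by
  rw [← P.sum_l j, ← Finset.sum_subset (Finset.subset_univ P.B), ← Finset.sum_coe_sort]
  · refine Finset.sum_congr rfl fun b _ => ?_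
    simp [expB]
  · intro i _ hi
    simp [expB, hi]

lemma sum_expS (j : Fin k) : ∑ i, P.expS j i • Θ.D i = P.L j := by
  simp [expS, L, ite_smul, Finset.sum_ite_mem]

/-- The binomial section `∏_{b ∈ B} x_b^{l_{b,j}} - ∏_{i ∈ S_j} x_i` of `L_j`. -/
def binomial (j : Fin k) : Θ.sections (P.L j) :=
  ⟨AddMonoidAlgebra.single (P.expB j) 1 - AddMonoidAlgebra.single (P.expS j) 1, by
    classical
    have aux : ∀ e : Fin R → ℤ, (∀ i, 0 ≤ e i) → ∑ i, e i • Θ.D i = P.L j →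
        AddMonoidAlgebra.single e (1 : ℂ) ∈ Θ.sections (P.L j) := by
      intro e he hL
      refine ⟨fun I _ => GITData.single_mem_coxChart (fun i _ => he i) 1, fun e' he' => ?_⟩
      have : e' = e := by
        by_contra hne
        refine Finsupp.mem_support_iff.1 he' ?_
        simp [AddMonoidAlgebra.coeff_single, Ne.symm hne]
      rw [this, hL]
    refine sub_mem (aux _ (fun i => ?_) (P.sum_expB j)) (aux _ (fun i => ?_) (P.sum_expS j))
    · unfold expB
      split_ifs
      · exact P.l_nonneg _ j
      · exact le_rfl
    · unfold expS
      split_ifs <;> simp⟩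

/-- `u_j ∈ M`, with `u_j(ρ_i)` equal to `1` for `i ∈ S_j` and to `0` for all other `i ∉ B`. -/
def u (j : Fin k) : Module.Dual ℤ Θ.N :=
  Θ.ofRelation (P.expS j - P.expB j) (by
    simp [sub_smul, Finset.sum_sub_distrib, P.sum_expB, P.sum_expS])

lemma u_ρ_of_notMem_B (j : Fin k) (i : Fin R) (hi : i ∉ P.B) :
    P.u j (Θ.ρ i) = if i ∈ P.S j then 1 else 0 := by
  rw [u, GITData.ofRelation_ρ]
  simp [expS, expB, hi]

lemma u_ρ_of_mem_B (j : Fin k) (b : P.B) : P.u j (Θ.ρ b) = -P.l b j := by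
  rw [u, GITData.ofRelation_ρ]
  have : (b : Fin R) ∉ P.S j := Finset.disjoint_left.1 (P.disjoint_B_S j) b.2
  simp [expS, expB, this]

/-- The fan `Σ' = Σ ∩ H_{u_1} ∩ ⋯ ∩ H_{u_k}` in `N' = N ∩ H_{u_1} ∩ ⋯ ∩ H_{u_k}`. -/
def fan' (h : Θ.IsOrbifold) : Fan (hyperplaneInter P.u) := (Θ.fan h).restrict P.u

/-- The pencil `(1 - t) s'_j + t s_j` joining the binomial sections `s'_j` to sections `s_j`. -/
def pencil (s : ∀ j, Θ.sections (P.L j)) (t : ℂ) : ∀ j, Θ.sections (P.L j) :=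
  fun j => (1 - t) • P.binomial j + t • s j

end ConvexPartition

/-- The affine line `𝔸¹` over `ℂ`. -/
abbrev affineLine : Scheme.{0} := Spec (CommRingCat.of (Polynomial ℂ))

/-- The structure morphism of `𝔸¹`. -/
def affineLineMap : affineLine ⟶ Spec (CommRingCat.of ℂ) :=
  Spec.map (CommRingCat.ofHom Polynomial.C)

/-- The closed point `t` of `𝔸¹`. -/
def affineLinePoint (t : ℂ) : Spec (CommRingCat.of ℂ) ⟶ affineLine :=
  Spec.map (CommRingCat.ofHom (Polynomial.evalRingHom t))

lemma affineLinePoint_comp (t : ℂ) :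
    affineLinePoint t ≫ affineLineMap = 𝟙 (Spec (CommRingCat.of ℂ)) := by
  rw [affineLinePoint, affineLineMap, ← Spec.map_comp, ← CommRingCat.ofHom_comp]
  have : (Polynomial.evalRingHom t).comp Polynomial.C = RingHom.id ℂ := by
    ext x
    simp
  rw [this]
  exact Spec.map_id _

/-- The product `Y × 𝔸¹` over `ℂ`. -/
abbrev timesLine {Y : Scheme.{0}} (f : Y ⟶ Spec (CommRingCat.of ℂ)) : Scheme.{0} :=
  Limits.pullback f affineLineMap

/-- The embedding of a `ℂ`-scheme `Z → Y` into the slice `Y × {t}` of `Y × 𝔸¹`. -/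
def slice {Y Z : Scheme.{0}} (f : Y ⟶ Spec (CommRingCat.of ℂ)) (g : Z ⟶ Y) (t : ℂ) :
    Z ⟶ timesLine f :=
  Limits.pullback.lift g ((g ≫ f) ≫ affineLinePoint t) (by
    rw [Category.assoc, Category.assoc, affineLinePoint_comp, Category.comp_id])

/-- The fibre over `t` of a family `i : 𝕏 → Y × 𝔸¹` of subschemes of `Y` is `g : Z → Y`. -/
def IsEmbeddedFiber {𝕏 Y Z : Scheme.{0}} (f : Y ⟶ Spec (CommRingCat.of ℂ)) (i : 𝕏 ⟶ timesLine f)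
    (t : ℂ) (g : Z ⟶ Y) : Prop :=
  ∃ j : Z ⟶ 𝕏, j ≫ i = slice f g t ∧
    IsPullback j (g ≫ f) (i ≫ Limits.pullback.snd f affineLineMap) (affineLinePoint t)

/-- The fibre over `t` of a family `π : 𝕏 → 𝔸¹` is isomorphic over `ℂ` to `q : Z → Spec ℂ`. -/
def HasFiber {𝕏 Z : Scheme.{0}} (π : 𝕏 ⟶ affineLine) (t : ℂ) (q : Z ⟶ Spec (CommRingCat.of ℂ)) :
    Prop :=
  ∃ j : Z ⟶ 𝕏, IsPullback j q π (affineLinePoint t)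

end

end Toric

/-! The family is the closure in `Y × 𝔸¹` of the zero locus of the pencil over the generic point of
`𝔸¹`. Let `A` be the ring of functions on `(ℂˣ)^I × ℂ^{[R] ∖ I}`. In `A[X]` the pencil generates an
ideal; `torsionClosure` adds everything that a nonzero polynomial in `ℂ[X]` multiplies into it, and
`familyIdeal` contracts the result to the degree-zero part, which is the coordinate ring of `U_σ ×
𝔸¹`. Both operations commute with inverting a monomial of degree zero, so the local ideals glue
(`map_familyIdeal`, `comap_iInf_map`). The quotients are torsion-free over the Dedekind domain
`ℂ[X]`, so the family is flat by construction.

Fibres. At a point of the slice over `t`, the specialised sequence `r(t)` is regular iff `(X - t,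
r)` is regular in the local ring of the total space. Regular sequences in a Noetherian local ring
can be permuted, so this holds iff `r` is regular and `X - t` is a nonzerodivisor modulo `r`
(`isWeaklyRegular_evalAt_iff`). Hence, if `r(t)` is regular, taking the closure adds nothing over
`t` (`evalAt_mem_of_mem_torsionClosure`). Together with the grading, which lifts degree-zero
elements of the ideal of `r(t)` to the family, this identifies the fibre (`map_evalAt_familyIdeal`).

The binomials. Substituting monomials so as to identify the two terms of each binomial is a
homomorphism to the Laurent polynomial ring, and its kernel is generated by exactly those binomials
(`ker_reduceHom`). So any subset of the binomials generates a prime ideal, which contains no further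
binomial; the sequence is therefore regular. For the full set, the substitution on degree-zero
monomials is restriction of characters from `N` to `N'`, so the zero locus in `U_σ` has the kernel
of `ℂ[σ^∨ ∩ M] → ℂ[(σ ∩ N')^∨ ∩ M']` as its ideal. This map is onto because a character of `N'` that
is nonnegative on `σ ∩ N'` extends to one that is nonnegative on `σ` (`restrictDual_surjective`);
this uses that the `l_{b,j}` are nonnegative. So `X'` embeds in `Y` as the binomial locus.

Finiteness of the bad set. Regularity at `t` can fail in two ways. Either `X - t` is a zero divisor
modulo `r`, which happens for finitely many `t` because there are finitely many associated primes
(`finite_zeroDivisors`), or `r` itself fails to be regular at a point of the slice. The second locus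
is closed and misses the slice over `0`, so properness of `Y` should keep it away from all but
finitely many slices. Properness enters as a graded Nakayama lemma (`exists_mul_pow_mem`): strict
convexity makes each degree of the polynomial ring finite-dimensional, and in suitable degrees every
monomial is divisible by a high power of a monomial of some cover (`exists_degree`). -/

namespace Toric

noncomputable section

/-! ### Ideal sheaves on affine schemes, and their gluing -/

section IdealSheaves

/-- The quasi-coherent ideal sheaf on `Spec R` of an ideal of `R`. -/
def specIdeal {R : CommRingCat.{0}} (a : Ideal R) : (Spec R).IdealSheafData :=
  (Spec.map (CommRingCat.ofHom (Ideal.Quotient.mk a))).ker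

lemma ker_specMap {R S : CommRingCat.{0}} (f : R ⟶ S) :
    (Spec.map f).ker = Scheme.IdealSheafData.ofIdealTop
      ((RingHom.ker f.hom).comap (Scheme.ΓSpecIso R).hom.hom) := by
  rw [Scheme.ker_of_isAffine]
  congr 1
  ext x
  have h := Scheme.ΓSpecIso_naturality f
  have hx : (Scheme.ΓSpecIso S).hom.hom ((Spec.map f).appTop.hom x) =
      f.hom ((Scheme.ΓSpecIso R).hom.hom x) := by
    exact congrArg (fun g => g.hom x) h
  rw [RingHom.mem_ker, Ideal.mem_comap, RingHom.mem_ker, ← hx]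
  have hinj : Function.Injective (Scheme.ΓSpecIso S).hom.hom :=
    (ConcreteCategory.bijective_of_isIso (Scheme.ΓSpecIso S).hom).1
  exact (map_eq_zero_iff _ hinj).symm

lemma ker_specMap_eq_specIdeal {R S : CommRingCat.{0}} (f : R ⟶ S) :
    (Spec.map f).ker = specIdeal (RingHom.ker f.hom) := by
  rw [specIdeal, ker_specMap, ker_specMap]
  simp only [CommRingCat.hom_ofHom, Ideal.mk_ker]
  rfl

lemma specIdeal_le_iff {R : CommRingCat.{0}} {a b : Ideal R} : specIdeal a ≤ specIdeal b ↔ a ≤ b := by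
  rw [specIdeal, specIdeal, ker_specMap, ker_specMap]
  have : ∀ c : Ideal Γ(Spec R, ⊤), Scheme.IdealSheafData.ofIdealTop c =
    Scheme.IdealSheafData.equivOfIsAffine.symm c := fun _ => rfl
  rw [this, this, map_le_map_iff]
  simp only [CommRingCat.hom_ofHom, Ideal.mk_ker]
  refine ⟨fun h x hx => ?_, fun h => Ideal.comap_mono h⟩
  obtain ⟨y, rfl⟩ := (ConcreteCategory.bijective_of_isIso (Scheme.ΓSpecIso R).hom).2 x
  exact h hx

/-- With `specIdeal_le_iff`, this makes `specIdeal` an order isomorphism between ideals of `R` and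
ideal sheaves on `Spec R`. -/
lemma exists_eq_specIdeal {R : CommRingCat.{0}} (I : (Spec R).IdealSheafData) :
    ∃ a : Ideal R, I = specIdeal a := by
  refine ⟨(Scheme.IdealSheafData.equivOfIsAffine I).comap (Scheme.ΓSpecIso R).inv.hom, ?_⟩
  rw [specIdeal, ker_specMap]
  have : I = Scheme.IdealSheafData.equivOfIsAffine.symm
    (Scheme.IdealSheafData.equivOfIsAffine I) := (OrderRingIso.symm_apply_apply _ I).symm
  conv_lhs => rw [this, Scheme.IdealSheafData.equivOfIsAffine_symm_apply]
  simp only [CommRingCat.hom_ofHom, Ideal.mk_ker]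
  congr 1
  ext x
  exact iff_of_eq (congrArg (· ∈ _) (congrArg (fun g => g.hom x)
    (Scheme.ΓSpecIso R).hom_inv_id).symm)

lemma specIdeal_map {R S : CommRingCat.{0}} (f : R ⟶ S) (a : Ideal S) :
    (specIdeal a).map (Spec.map f) = specIdeal (a.comap f.hom) := by
  rw [specIdeal, Scheme.IdealSheafData.map_ker, ← Spec.map_comp, ker_specMap_eq_specIdeal]
  congr 1
  ext x
  simp [RingHom.mem_ker, Ideal.Quotient.eq_zero_iff_mem]

/-- Pullback is left adjoint to pushforward, which `specIdeal_map` computes as contraction; the left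
adjoint of contraction is extension. It suffices to compare upper bounds of the form `specIdeal b`,
since there are no others. -/
lemma specIdeal_comap {R S : CommRingCat.{0}} (f : R ⟶ S) (a : Ideal R) :
    (specIdeal a).comap (Spec.map f) = specIdeal (a.map f.hom) := by
  have key : ∀ b : Ideal S, (specIdeal a).comap (Spec.map f) ≤ specIdeal b ↔
      specIdeal (a.map f.hom) ≤ specIdeal b := by
    intro b
    rw [← Scheme.IdealSheafData.le_map_iff_comap_le, specIdeal_map, specIdeal_le_iff,
      specIdeal_le_iff, Ideal.map_le_iff_le_comap]
  apply le_antisymm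
  · exact (key _).2 le_rfl
  · obtain ⟨b, hb⟩ := exists_eq_specIdeal ((specIdeal a).comap (Spec.map f))
    rw [hb]
    exact (key b).1 hb.le

lemma comap_iInf_of_isOpenImmersion {X U : Scheme.{0}} {ι : Type} [Finite ι]
    (I : ι → X.IdealSheafData) (c : U ⟶ X) [IsOpenImmersion c] :
    (⨅ i, I i).comap c = ⨅ i, (I i).comap c := by
  ext1
  funext W
  rw [Scheme.IdealSheafData.ideal_comap_of_isOpenImmersion, Scheme.IdealSheafData.ideal_iInf,
    Scheme.IdealSheafData.ideal_iInf]
  simp only [iInf_apply, Ideal.comap_iInf]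
  refine iInf_congr fun i => ?_
  rw [Scheme.IdealSheafData.ideal_comap_of_isOpenImmersion]

lemma ker_comap_of_isPullback {X Y U V : Scheme.{0}} {f : X ⟶ Y} {f' : U ⟶ V} {iU : U ⟶ X}
    {iV : V ⟶ Y} [IsOpenImmersion iV] [QuasiCompact f] (H : IsPullback f' iU iV f) :
    f.ker.comap iV = f'.ker := by
  ext1
  funext W
  rw [Scheme.IdealSheafData.ideal_comap_of_isOpenImmersion,
    Scheme.ker_ideal_of_isPullback_of_isOpenImmersion f f' iU iV H]

/-- `I.map f` is the kernel of the composite `I.subschemeι ≫ f`. Pasting the pullback square of the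
subscheme with `H` reduces base change to the case of kernels. -/
lemma comap_map_of_isPullback {X Y U V : Scheme.{0}} {f : X ⟶ Y} {f' : U ⟶ V} {iU : U ⟶ X}
    {iV : V ⟶ Y} [IsOpenImmersion iV] [QuasiCompact f] (H : IsPullback f' iU iV f)
    (I : X.IdealSheafData) : (I.map f).comap iV = (I.comap iU).map f' := by
  have h1 : IsPullback ((I.comapIso iU).hom ≫ Limits.pullback.snd iU I.subschemeι)
      (I.comap iU).subschemeι I.subschemeι iU := by
    refine IsPullback.of_iso (IsPullback.of_hasPullback iU I.subschemeι).flip (I.comapIso iU).symm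
      (Iso.refl _) (Iso.refl _) (Iso.refl _) ?_ ?_ ?_ ?_
    · rw [Iso.symm_hom, Iso.inv_hom_id_assoc, Iso.refl_hom, Category.comp_id]
    · simp
    · simp
    · simp
  have h2 := h1.flip.paste_horiz H
  exact ker_comap_of_isPullback h2

/-- Ideal sheaves on the members of a finite open cover that agree on the intersections glue. -/
lemma comap_iInf_map {X : Scheme.{0}} {ι : Type} [Finite ι] {U : ι → Scheme.{0}}
    (c : ∀ i, U i ⟶ X) [∀ i, IsOpenImmersion (c i)] [∀ i, QuasiCompact (c i)]
    (I : ∀ i, (U i).IdealSheafData)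
    (h : ∀ i j, ∃ (V : Scheme.{0}) (a : V ⟶ U i) (b : V ⟶ U j), IsPullback b a (c j) (c i) ∧
      (I i).comap a = (I j).comap b) (j : ι) :
    (⨅ i, (I i).map (c i)).comap (c j) = I j := by
  rw [comap_iInf_of_isOpenImmersion]
  apply le_antisymm
  · exact (iInf_le _ j).trans (Scheme.IdealSheafData.comap_map_le _ _)
  · refine le_iInf fun i => ?_
    obtain ⟨V, a, b, H, hab⟩ := h i j
    rw [comap_map_of_isPullback H, hab]
    exact Scheme.IdealSheafData.le_map_comap _ _

lemma ext_of_comap_eq {X : Scheme.{0}} {ι : Type} {U : ι → Scheme.{0}} [∀ i, IsAffine (U i)]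
    (c : ∀ i, U i ⟶ X) [∀ i, IsOpenImmersion (c i)] (hc : ∀ x, ∃ i, x ∈ Set.range (c i))
    {I J : X.IdealSheafData} (h : ∀ i, I.comap (c i) = J.comap (c i)) : I = J := by
  refine Scheme.IdealSheafData.ext_of_iSup_eq_top
    (fun i => ⟨(c i) ''ᵁ ⊤, (isAffineOpen_top (U i)).image_of_isOpenImmersion (c i)⟩) ?_ ?_
  · refine top_le_iff.1 fun x _ => ?_
    obtain ⟨i, y, hy⟩ := hc x
    exact TopologicalSpace.Opens.mem_iSup.2 ⟨i, y, trivial, hy⟩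
  · intro i
    have h1 := congrArg (fun K => K.ideal ⟨⊤, isAffineOpen_top (U i)⟩) (h i)
    simp only [Scheme.IdealSheafData.ideal_comap_of_isOpenImmersion] at h1
    exact Ideal.comap_injective_of_surjective _
      (ConcreteCategory.bijective_of_isIso ((c i).appIso ⊤).inv).2 h1

end IdealSheaves


/-! ### Charts of a toric variety and their overlaps -/

namespace Fan

variable {N : Type} [AddCommGroup N] (F : Fan N)

instance isOpenImmersion_chart (σ : PointedCone ℚ (ℚ ⊗[ℤ] N)) (hσ : σ ∈ F.cones) :
    IsOpenImmersion (F.chart σ hσ) :=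
  inferInstanceAs (IsOpenImmersion (Limits.colimit.ι F.diagram ⟨σ, hσ⟩))

lemma exists_mem_range_chart (x : F.toricVariety) :
    ∃ (σ : PointedCone ℚ (ℚ ⊗[ℤ] N)) (hσ : σ ∈ F.cones), x ∈ Set.range (F.chart σ hσ) := by
  obtain ⟨σ, y, hy⟩ := Scheme.IsLocallyDirected.ι_jointly_surjective F.diagram x
  exact ⟨σ.1, σ.2, y, hy⟩

/-- The open immersion `U_τ → U_σ` for cones `τ ⊆ σ`. -/
abbrev incl {σ τ : PointedCone ℚ (ℚ ⊗[ℤ] N)} (h : τ ≤ σ) :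
    Spec (CommRingCat.of (coordRing τ)) ⟶ Spec (CommRingCat.of (coordRing σ)) :=
  Spec.map (CommRingCat.ofHom (restrictHom h).toRingHom)

lemma incl_chart {σ τ : PointedCone ℚ (ℚ ⊗[ℤ] N)} (hσ : σ ∈ F.cones) (hτ : τ ∈ F.cones)
    (h : τ ≤ σ) : incl h ≫ F.chart σ hσ = F.chart τ hτ :=
  Limits.colimit.w F.diagram (homOfLE h : (⟨τ, hτ⟩ : F.cones) ⟶ ⟨σ, hσ⟩)

lemma incl_incl {σ τ υ : PointedCone ℚ (ℚ ⊗[ℤ] N)} (h : τ ≤ σ) (h' : υ ≤ τ) :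
    incl h' ≫ incl h = incl (h'.trans h) := by
  rw [← Spec.map_comp, ← CommRingCat.ofHom_comp]
  congr 2
  exact congrArg AlgHom.toRingHom (restrictHom_comp h h')

lemma isOpenImmersion_incl {σ τ : PointedCone ℚ (ℚ ⊗[ℤ] N)} (hσ : σ ∈ F.cones) (hτ : τ ∈ F.cones)
    (h : τ ≤ σ) : IsOpenImmersion (incl h) :=
  inferInstanceAs (IsOpenImmersion (F.diagram.map (homOfLE h : (⟨τ, hτ⟩ : F.cones) ⟶ ⟨σ, hσ⟩)))

/-- The gluing diagram is locally directed, so two chart points become equal only if they both come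
from a chart `U_υ` with `υ` contained in both cones. -/
lemma mem_range_chart_inf {σ τ : PointedCone ℚ (ℚ ⊗[ℤ] N)} (hσ : σ ∈ F.cones) (hτ : τ ∈ F.cones)
    {x : F.toricVariety} (h : x ∈ Set.range (F.chart σ hσ)) (h' : x ∈ Set.range (F.chart τ hτ)) :
    x ∈ Set.range (F.chart (σ ⊓ τ) (F.inter_mem hσ hτ)) := by
  obtain ⟨y, hy⟩ := h
  obtain ⟨z, hz⟩ := h'
  obtain ⟨υ, f, g, w, hw, -⟩ : ∃ (υ : F.cones) (f : υ ⟶ ⟨σ, hσ⟩) (g : υ ⟶ ⟨τ, hτ⟩)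
      (w : Spec (CommRingCat.of (coordRing υ.1))),
      incl (leOfHom f) w = y ∧ incl (leOfHom g) w = z :=
    (Scheme.IsLocallyDirected.ι_eq_ι_iff F.diagram
      (i := ⟨σ, hσ⟩) (j := ⟨τ, hτ⟩) (xi := y) (xj := z)).1 (hy.trans hz.symm)
  have hle : υ.1 ≤ σ ⊓ τ := le_inf (leOfHom f) (leOfHom g)
  have e1 : F.chart υ.1 υ.2 w = F.chart σ hσ y := by
    rw [← F.incl_chart hσ υ.2 (leOfHom f), Scheme.Hom.comp_apply]
    exact congrArg _ hw
  rw [← hy, ← e1, ← F.incl_chart (F.inter_mem hσ hτ) υ.2 hle, Scheme.Hom.comp_apply]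
  exact ⟨_, rfl⟩

/-- For open immersions a square is cartesian as soon as the images match, so this is a statement
about points. -/
lemma isPullback_chart {σ τ : PointedCone ℚ (ℚ ⊗[ℤ] N)} (hσ : σ ∈ F.cones) (hτ : τ ∈ F.cones) :
    IsPullback (incl (inf_le_left : σ ⊓ τ ≤ σ)) (incl (inf_le_right : σ ⊓ τ ≤ τ))
      (F.chart σ hσ) (F.chart τ hτ) := by
  have := F.isOpenImmersion_incl hτ (F.inter_mem hσ hτ) inf_le_right
  refine (IsOpenImmersion.isPullback _ _ _ _ ?_ ?_)
  · rw [F.incl_chart _ (F.inter_mem hσ hτ), F.incl_chart _ (F.inter_mem hσ hτ)]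
  · ext z
    constructor
    · intro hz
      obtain ⟨w, hw⟩ := F.mem_range_chart_inf hσ hτ hz ⟨z, rfl⟩
      refine ⟨w, (F.chart τ hτ).injective ?_⟩
      rw [← hw, ← Scheme.Hom.comp_apply, F.incl_chart _ (F.inter_mem hσ hτ)]
    · rintro ⟨w, rfl⟩
      refine ⟨incl inf_le_left w, ?_⟩
      rw [← Scheme.Hom.comp_apply, ← Scheme.Hom.comp_apply, F.incl_chart _ (F.inter_mem hσ hτ),
        F.incl_chart _ (F.inter_mem hσ hτ)]

instance quasiCompact_chart (σ : PointedCone ℚ (ℚ ⊗[ℤ] N)) (hσ : σ ∈ F.cones) :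
    QuasiCompact (F.chart σ hσ) := by
  have : ∀ τ : F.cones, IsAffine ((Scheme.IsLocallyDirected.openCover F.diagram).X τ) :=
    fun τ => inferInstanceAs (IsAffine (Spec (CommRingCat.of (coordRing τ.1))))
  refine (@HasAffineProperty.iff_of_openCover _ _
    instHasAffinePropertyQuasiCompactCompactSpaceCarrierCarrierCommRingCat _ _ _
    (Scheme.IsLocallyDirected.openCover F.diagram) this).2 fun τ => ?_
  -- The preimage of the chart `U_τ` is the affine scheme `U_{σ ∩ τ}`.
  exact (Scheme.homeoOfIso (F.isPullback_chart hσ τ.2).isoPullback).compactSpace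

lemma chart_structureMap (σ : PointedCone ℚ (ℚ ⊗[ℤ] N)) (hσ : σ ∈ F.cones) :
    F.chart σ hσ ≫ F.structureMap =
      Spec.map (CommRingCat.ofHom (algebraMap ℂ (coordRing σ))) :=
  Limits.colimit.ι_desc _ _

lemma hom_ext {X : Scheme.{0}} {f g : F.toricVariety ⟶ X}
    (h : ∀ σ hσ, F.chart σ hσ ≫ f = F.chart σ hσ ≫ g) : f = g :=
  Limits.colimit.hom_ext fun σ => h σ.1 σ.2

/-! ### The morphism of toric varieties given by the sublattice `N'` -/

section restrict

variable {k : ℕ} (u : Fin k → Module.Dual ℤ N)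

/-- The cone `σ ∩ N'_ℚ`. -/
abbrev restrictCone (σ : PointedCone ℚ (ℚ ⊗[ℤ] N)) : PointedCone ℚ (ℚ ⊗[ℤ] hyperplaneInter u) :=
  PointedCone.comap (inclQ (hyperplaneInter u)) σ

/-- Restriction of characters `σ^∨ ∩ M → (σ ∩ N'_ℚ)^∨ ∩ M'`. -/
def restrictDual (σ : PointedCone ℚ (ℚ ⊗[ℤ] N)) :
    dualMonoid σ →+ dualMonoid (restrictCone u σ) where
  toFun m := ⟨m.1 ∘ₗ (hyperplaneInter u).subtype, fun x hx => by
    rw [pair_comp_subtype]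
    exact m.2 _ hx⟩
  map_zero' := by ext1; simp
  map_add' a b := by ext1; simp [LinearMap.add_comp]

/-- The homomorphism `ℂ[σ^∨ ∩ M] → ℂ[(σ ∩ N'_ℚ)^∨ ∩ M']`. -/
def sublatticeHom (σ : PointedCone ℚ (ℚ ⊗[ℤ] N)) :
    coordRing σ →ₐ[ℂ] coordRing (restrictCone u σ) :=
  AddMonoidAlgebra.mapDomainAlgHom ℂ ℂ (restrictDual u σ)

lemma restrictCone_mono {σ τ : PointedCone ℚ (ℚ ⊗[ℤ] N)} (h : τ ≤ σ) :
    restrictCone u τ ≤ restrictCone u σ := fun _ hx => h hx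

lemma sublatticeHom_comp {σ τ : PointedCone ℚ (ℚ ⊗[ℤ] N)} (h : τ ≤ σ) :
    (sublatticeHom u τ).comp (restrictHom h) =
      (restrictHom (restrictCone_mono u h)).comp (sublatticeHom u σ) := by
  refine AddMonoidAlgebra.algHom_ext (fun m => ?_) (Subsingleton.elim _ _)
  simp [restrictHom, sublatticeHom]
  rfl

/-- The morphism of affine toric varieties `U_{σ ∩ N'} → U_σ`. -/
abbrev sublatticeMap (σ : PointedCone ℚ (ℚ ⊗[ℤ] N)) :
    Spec (CommRingCat.of (coordRing (restrictCone u σ))) ⟶ Spec (CommRingCat.of (coordRing σ)) :=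
  Spec.map (CommRingCat.ofHom (sublatticeHom u σ).toRingHom)

lemma incl_sublatticeMap {σ τ : PointedCone ℚ (ℚ ⊗[ℤ] N)} (h : τ ≤ σ) :
    incl (restrictCone_mono u h) ≫ sublatticeMap u σ = sublatticeMap u τ ≫ incl h := by
  rw [← Spec.map_comp, ← Spec.map_comp, ← CommRingCat.ofHom_comp, ← CommRingCat.ofHom_comp]
  congr 2
  exact (congrArg AlgHom.toRingHom (sublatticeHom_comp u h)).symm

lemma restrictCone_mem {σ : PointedCone ℚ (ℚ ⊗[ℤ] N)} (hσ : σ ∈ F.cones) :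
    restrictCone u σ ∈ (F.restrict u).cones := ⟨σ, hσ, rfl⟩

/-- The morphism `U_{σ'} → X_F`, for a cone `σ' = σ ∩ N'_ℚ` of the restricted fan. -/
def restrictChart (σ' : (F.restrict u).cones) :
    Spec (CommRingCat.of (coordRing σ'.1)) ⟶ F.toricVariety :=
  incl (σ'.2.choose_spec.2.ge) ≫ sublatticeMap u σ'.2.choose ≫
    F.chart σ'.2.choose σ'.2.choose_spec.1

/-- Different cones can have the same trace on `N'_ℚ`, and `restrictChart` chooses one of them. The
choice does not matter: both sides factor through the chart of `σ ⊓ τ`. -/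
lemma sublatticeMap_chart_eq {σ τ : PointedCone ℚ (ℚ ⊗[ℤ] N)} (hσ : σ ∈ F.cones)
    (hτ : τ ∈ F.cones) {υ : PointedCone ℚ (ℚ ⊗[ℤ] hyperplaneInter u)}
    (h : υ ≤ restrictCone u σ) (h' : υ ≤ restrictCone u τ) :
    incl h ≫ sublatticeMap u σ ≫ F.chart σ hσ = incl h' ≫ sublatticeMap u τ ≫ F.chart τ hτ := by
  have key : ∀ {ξ ζ : PointedCone ℚ (ℚ ⊗[ℤ] N)} (hξ : ξ ∈ F.cones) (hζ : ζ ∈ F.cones)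
      (hζξ : ζ ≤ ξ) (h : υ ≤ restrictCone u ζ) (h' : υ ≤ restrictCone u ξ),
      incl h ≫ sublatticeMap u ζ ≫ F.chart ζ hζ = incl h' ≫ sublatticeMap u ξ ≫ F.chart ξ hξ := by
    intro ξ ζ hξ hζ hζξ h h'
    rw [← F.incl_chart hξ hζ hζξ, ← Category.assoc (sublatticeMap u ζ), ← incl_sublatticeMap,
      Category.assoc, ← Category.assoc (incl h), incl_incl]
  have hinf : υ ≤ restrictCone u (σ ⊓ τ) := fun x hx => ⟨h hx, h' hx⟩
  rw [← key hσ (F.inter_mem hσ hτ) inf_le_left hinf h,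
    ← key hτ (F.inter_mem hσ hτ) inf_le_right hinf h']

/-- The morphism of toric varieties induced by the inclusion `N' → N`. -/
def restrictMap : (F.restrict u).toricVariety ⟶ F.toricVariety :=
  Limits.colimit.desc (F.restrict u).diagram
    { pt := F.toricVariety
      ι :=
        { app := fun σ' => F.restrictChart u σ'
          naturality := by
            intro σ' τ' f
            change incl (leOfHom f) ≫ F.restrictChart u τ' = F.restrictChart u σ' ≫ 𝟙 _
            rw [Category.comp_id]
            refine Eq.trans ?_ (F.sublatticeMap_chart_eq u τ'.2.choose_spec.1 σ'.2.choose_spec.1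
              ((show σ'.1 ≤ τ'.1 from leOfHom f).trans τ'.2.choose_spec.2.ge) σ'.2.choose_spec.2.ge)
            rw [restrictChart, ← incl_incl τ'.2.choose_spec.2.ge (leOfHom f), Category.assoc] } }

lemma chart_restrictMap {σ : PointedCone ℚ (ℚ ⊗[ℤ] N)} (hσ : σ ∈ F.cones) :
    (F.restrict u).chart (restrictCone u σ) (F.restrictCone_mem u hσ) ≫ F.restrictMap u =
      sublatticeMap u σ ≫ F.chart σ hσ := by
  have h1 : (F.restrict u).chart (restrictCone u σ) (F.restrictCone_mem u hσ) ≫ F.restrictMap u =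
      F.restrictChart u ⟨_, F.restrictCone_mem u hσ⟩ := Limits.colimit.ι_desc _ _
  have h2 : incl (le_refl (restrictCone u σ)) = 𝟙 _ := by
    rw [incl, restrictHom_id]
    exact Spec.map_id _
  rw [h1, restrictChart, F.sublatticeMap_chart_eq u _ hσ _ (le_refl (restrictCone u σ)), h2,
    Category.id_comp]

lemma restrictMap_structureMap : F.restrictMap u ≫ F.structureMap = (F.restrict u).structureMap := by
  refine hom_ext _ ?_
  rintro _ ⟨σ, hσ, rfl⟩
  change (F.restrict u).chart (restrictCone u σ) (F.restrictCone_mem u hσ) ≫ _ =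
    (F.restrict u).chart (restrictCone u σ) (F.restrictCone_mem u hσ) ≫ _
  rw [(F.restrict u).chart_structureMap, ← Category.assoc, F.chart_restrictMap u hσ, Category.assoc,
    chart_structureMap, ← Spec.map_comp, ← CommRingCat.ofHom_comp]
  congr 2
  exact (sublatticeHom u σ).comp_algebraMap

lemma mem_range_incl {σ τ : PointedCone ℚ (ℚ ⊗[ℤ] N)} (hσ : σ.FG) (h : τ ≤ σ)
    {m : Module.Dual ℤ N} (hm : m ∈ dualMonoid σ) (hx : ∀ x, x ∈ τ ↔ x ∈ σ ∧ pair m x = 0)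
    (p : PrimeSpectrum (coordRing σ)) :
    p ∈ Set.range (incl h) ↔ AddMonoidAlgebra.single ⟨m, hm⟩ 1 ∉ p.asIdeal := by
  let := (restrictHom h).toRingHom.toAlgebra
  have := isLocalization_restrictHom hσ h hm hx
  exact iff_of_eq (congrArg (p ∈ ·) (PrimeSpectrum.localization_away_comap_range (coordRing τ)
    (AddMonoidAlgebra.single ⟨m, hm⟩ 1 : coordRing σ)))

/-- The preimage of `U_σ` is exactly `U_{σ ∩ N'}`. A point of `U_{τ ∩ N'}` that lands in `U_σ` lands
in `U_{τ ∩ σ}`, where the character `m` cutting out the face `τ ∩ σ` of `τ` does not vanish. The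
restriction of `m` to `N'` cuts out the face `τ ∩ σ ∩ N'`, so the point lies in that smaller chart.
-/
lemma isPullback_restrictMap {σ : PointedCone ℚ (ℚ ⊗[ℤ] N)} (hσ : σ ∈ F.cones) :
    IsPullback (sublatticeMap u σ) ((F.restrict u).chart (restrictCone u σ) (F.restrictCone_mem u hσ))
      (F.chart σ hσ) (F.restrictMap u) := by
  refine (IsOpenImmersion.isPullback _ _ _ _ (F.chart_restrictMap u hσ) ?_)
  ext x
  constructor
  swap
  · rintro ⟨w, rfl⟩
    refine ⟨sublatticeMap u σ w, ?_⟩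
    rw [← Scheme.Hom.comp_apply, ← F.chart_restrictMap u hσ, Scheme.Hom.comp_apply]
  · intro hx
    obtain ⟨_, ⟨τ, hτ, rfl⟩, y, rfl⟩ := (F.restrict u).exists_mem_range_chart x
    change F.restrictMap u ((F.restrict u).chart (restrictCone u τ) (F.restrictCone_mem u hτ) y) ∈
      Set.range (F.chart σ hσ) at hx
    rw [← Scheme.Hom.comp_apply, F.chart_restrictMap u hτ, Scheme.Hom.comp_apply] at hx
    have hmem := F.inter_mem hτ hσ
    obtain ⟨w, hw⟩ := F.mem_range_chart_inf hτ hσ ⟨_, rfl⟩ hx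
    rw [← F.incl_chart hτ hmem inf_le_left, Scheme.Hom.comp_apply] at hw
    have hw := (F.chart τ hτ).injective hw
    obtain ⟨m, hm, hface⟩ := F.inter_face τ hτ σ hσ
    have h1 := (mem_range_incl (F.fg τ hτ) inf_le_left hm hface _).1 ⟨w, hw⟩
    have hm' : m ∘ₗ (hyperplaneInter u).subtype ∈ dualMonoid (restrictCone u τ) :=
      (restrictDual u τ ⟨m, hm⟩).2
    have h2 : y ∈ Set.range (incl (restrictCone_mono u (inf_le_left : τ ⊓ σ ≤ τ))) := by
      refine (mem_range_incl (fg_comap_inclQ u (F.fg τ hτ)) _ hm' (fun x => ?_) y).2 ?_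
      · rw [pair_comp_subtype]
        exact hface (inclQ _ x)
      · intro hy
        refine h1 ?_
        change sublatticeHom u τ (AddMonoidAlgebra.single ⟨m, hm⟩ 1) ∈ y.asIdeal
        rw [sublatticeHom, AddMonoidAlgebra.mapDomainAlgHom_apply,
          AddMonoidAlgebra.mapDomain_single]
        exact hy
    obtain ⟨z, rfl⟩ := h2
    refine ⟨incl (restrictCone_mono u (inf_le_right : τ ⊓ σ ≤ σ)) z, ?_⟩
    have e1 := (F.restrict u).incl_chart (F.restrictCone_mem u hσ) (F.restrictCone_mem u hmem)
      (restrictCone_mono u inf_le_right)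
    have e2 := (F.restrict u).incl_chart (F.restrictCone_mem u hτ) (F.restrictCone_mem u hmem)
      (restrictCone_mono u inf_le_left)
    rw [← Scheme.Hom.comp_apply, e1, ← e2, Scheme.Hom.comp_apply]

end restrict

end Fan


/-! ### Charts and slices of `Y × 𝔸¹` -/

section Line

/-- Applied to `ℂ → B` this says `Spec B[X] = Spec B × 𝔸¹`; applied to a restriction map it gives
the overlaps of such charts. -/
lemma isPushout_polynomial {A B : Type} [CommRing A] [CommRing B] (f : A →+* B) :
    IsPushout (CommRingCat.ofHom f) (CommRingCat.ofHom (Polynomial.C : A →+* Polynomial A))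
      (CommRingCat.ofHom (Polynomial.C : B →+* Polynomial B))
      (CommRingCat.ofHom (Polynomial.mapRingHom f)) := by
  refine ⟨⟨?_⟩, ⟨Limits.PushoutCocone.IsColimit.mk _
    (fun s => CommRingCat.ofHom (Polynomial.eval₂RingHom s.inl.hom (s.inr.hom Polynomial.X)))
    ?_ ?_ ?_⟩⟩
  · ext x
    simp
  · intro s
    ext x
    simp
  · intro s
    have hs : ∀ x, s.inl.hom (f x) = s.inr.hom (Polynomial.C x) := fun x =>
      congrArg (fun g => g.hom x) s.condition
    refine CommRingCat.hom_ext (Polynomial.ringHom_ext (fun x => ?_) ?_)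
    · simpa using hs x
    · simp
  · intro s m h1 h2
    refine CommRingCat.hom_ext (Polynomial.ringHom_ext (fun x => ?_) ?_)
    · have := congrArg (fun g => g.hom x) h1
      simpa using this
    · have := congrArg (fun g => g.hom Polynomial.X) h2
      simpa using this

variable {Y : Scheme.{0}} (f : Y ⟶ Spec (CommRingCat.of ℂ))

lemma isPullback_slice (t : ℂ) :
    IsPullback (slice f (𝟙 Y) t) f (Limits.pullback.snd f affineLineMap) (affineLinePoint t) := by
  refine IsPullback.of_right (h₁₂ := Limits.pullback.fst f affineLineMap) (h₂₂ := affineLineMap)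
    (v₁₃ := f) ?_ ?_ (IsPullback.of_hasPullback f affineLineMap)
  · have e1 : slice f (𝟙 Y) t ≫ Limits.pullback.fst f affineLineMap = 𝟙 Y :=
      Limits.pullback.lift_fst _ _ _
    rw [e1, affineLinePoint_comp]
    exact IsPullback.of_horiz_isIso ⟨by simp⟩
  · rw [slice, Limits.pullback.lift_snd, Category.id_comp]

lemma slice_comp {Z : Scheme.{0}} (g : Z ⟶ Y) (t : ℂ) : g ≫ slice f (𝟙 Y) t = slice f g t := by
  refine Limits.pullback.hom_ext ?_ ?_
  · rw [slice, slice, Category.assoc, Limits.pullback.lift_fst, Limits.pullback.lift_fst,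
      Category.comp_id]
  · rw [slice, slice, Category.assoc, Limits.pullback.lift_snd, Limits.pullback.lift_snd,
      Category.id_comp, Category.assoc]

/-- A closed subscheme of the slice `Y × {t}` is the fibre of a closed subscheme of `Y × 𝔸¹` if its
ideal is the restriction of the ideal of that subscheme. -/
lemma isEmbeddedFiber_of_ker_eq {Z : Scheme.{0}} (I : (timesLine f).IdealSheafData) (t : ℂ)
    (g : Z ⟶ Y) [IsClosedImmersion g] (h : g.ker = I.comap (slice f (𝟙 Y) t)) :
    IsEmbeddedFiber f I.subschemeι t g := by
  have hle : I.subschemeι.ker ≤ (slice f g t).ker := by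
    rw [Scheme.IdealSheafData.ker_subschemeι, ← slice_comp, Scheme.Hom.ker_comp,
      Scheme.IdealSheafData.le_map_iff_comap_le, h]
  have hfac := IsClosedImmersion.lift_fac I.subschemeι (slice f g t) hle
  refine ⟨IsClosedImmersion.lift I.subschemeι (slice f g t) hle, hfac, ?_⟩
  have h1 := isPullback_of_isClosedImmersion g I.subschemeι
    (IsClosedImmersion.lift I.subschemeι (slice f g t) hle) (slice f (𝟙 Y) t)
    (by rw [slice_comp, hfac]) (by rw [Scheme.IdealSheafData.ker_subschemeι, h])
  exact h1.flip.paste_vert (isPullback_slice f t)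

variable {B : Type} [CommRing B] [Algebra ℂ B] (c : Spec (CommRingCat.of B) ⟶ Y)
  (hc : c ≫ f = Spec.map (CommRingCat.ofHom (algebraMap ℂ B)))

/-- The morphism `Spec B[t] → Y × 𝔸¹` given by a morphism `Spec B → Y`. -/
def lineChart : Spec (CommRingCat.of (Polynomial B)) ⟶ timesLine f :=
  Limits.pullback.lift (Spec.map (CommRingCat.ofHom Polynomial.C) ≫ c)
    (Spec.map (CommRingCat.ofHom (Polynomial.mapRingHom (algebraMap ℂ B)))) (by
      rw [Category.assoc, hc, affineLineMap, ← Spec.map_comp, ← Spec.map_comp]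
      rw [(isPushout_polynomial (algebraMap ℂ B)).w])

lemma lineChart_fst : lineChart f c hc ≫ Limits.pullback.fst f affineLineMap =
    Spec.map (CommRingCat.ofHom Polynomial.C) ≫ c := Limits.pullback.lift_fst _ _ _

lemma lineChart_snd : lineChart f c hc ≫ Limits.pullback.snd f affineLineMap =
    Spec.map (CommRingCat.ofHom (Polynomial.mapRingHom (algebraMap ℂ B))) :=
  Limits.pullback.lift_snd _ _ _

/-- Pasted with the square defining `Y × 𝔸¹`, this square becomes `Spec` of the polynomial pushout.
As a base change of `c`, the line chart inherits being an open immersion and quasi-compact. -/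
lemma isPullback_lineChart : IsPullback (lineChart f c hc)
    (Spec.map (CommRingCat.ofHom (Polynomial.C : B →+* Polynomial B)))
    (Limits.pullback.fst f affineLineMap) c := by
  have h := isPullback_SpecMap_of_isPushout _ _ _ _ (isPushout_polynomial (algebraMap ℂ B))
  refine IsPullback.of_right (h₁₂ := Limits.pullback.snd f affineLineMap) (h₂₂ := f)
    (v₁₃ := affineLineMap) ?_ (lineChart_fst f c hc) (IsPullback.of_hasPullback f affineLineMap).flip
  rw [hc, lineChart_snd]
  exact h.flip

instance [IsOpenImmersion c] : IsOpenImmersion (lineChart f c hc) :=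
  MorphismProperty.of_isPullback (isPullback_lineChart f c hc).flip inferInstance

instance [QuasiCompact c] : QuasiCompact (lineChart f c hc) :=
  MorphismProperty.of_isPullback (isPullback_lineChart f c hc).flip inferInstance

lemma mem_range_lineChart {w : timesLine f}
    (hw : Limits.pullback.fst f affineLineMap w ∈ Set.range c) :
    w ∈ Set.range (lineChart f c hc) := by
  obtain ⟨y, hy⟩ := hw
  obtain ⟨z, hz, -⟩ := Scheme.Pullback.exists_preimage_pullback w y hy.symm
  refine ⟨(isPullback_lineChart f c hc).isoPullback.inv z, ?_⟩
  rw [← hz, ← Scheme.Hom.comp_apply, IsPullback.isoPullback_inv_fst]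

lemma isPullback_lineChart_inter {B₁ B₂ B₃ : Type} [CommRing B₁] [Algebra ℂ B₁] [CommRing B₂]
    [Algebra ℂ B₂] [CommRing B₃] (c₁ : Spec (CommRingCat.of B₁) ⟶ Y)
    (hc₁ : c₁ ≫ f = Spec.map (CommRingCat.ofHom (algebraMap ℂ B₁)))
    (c₂ : Spec (CommRingCat.of B₂) ⟶ Y)
    (hc₂ : c₂ ≫ f = Spec.map (CommRingCat.ofHom (algebraMap ℂ B₂)))
    (g₁ : B₁ →+* B₃) (g₂ : B₂ →+* B₃)
    (hg : g₁.comp (algebraMap ℂ B₁) = g₂.comp (algebraMap ℂ B₂))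
    (h : IsPullback (Spec.map (CommRingCat.ofHom g₁)) (Spec.map (CommRingCat.ofHom g₂)) c₁ c₂) :
    IsPullback (Spec.map (CommRingCat.ofHom (Polynomial.mapRingHom g₁)))
      (Spec.map (CommRingCat.ofHom (Polynomial.mapRingHom g₂)))
      (lineChart f c₁ hc₁) (lineChart f c₂ hc₂) := by
  have h1 := isPullback_SpecMap_of_isPushout _ _ _ _ (isPushout_polynomial g₁)
  have h2 := h1.flip.paste_vert h
  refine IsPullback.of_bot (h₃₁ := c₂)
    (v₂₁ := Spec.map (CommRingCat.ofHom (Polynomial.C : B₂ →+* Polynomial B₂)))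
    (v₂₂ := Limits.pullback.fst f affineLineMap) ?_ ?_ (isPullback_lineChart f c₂ hc₂)
  · rw [lineChart_fst, ← Spec.map_comp, ← (isPushout_polynomial g₂).w, Spec.map_comp]
    exact h2
  · refine Limits.pullback.hom_ext ?_ ?_
    · rw [Category.assoc, Category.assoc, lineChart_fst, lineChart_fst, ← Spec.map_comp_assoc,
        ← Spec.map_comp_assoc, ← (isPushout_polynomial g₁).w, ← (isPushout_polynomial g₂).w,
        Spec.map_comp_assoc, Spec.map_comp_assoc, h.w]
    · rw [Category.assoc, Category.assoc, lineChart_snd, lineChart_snd, ← Spec.map_comp,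
        ← Spec.map_comp, ← CommRingCat.ofHom_comp, ← CommRingCat.ofHom_comp,
        Polynomial.mapRingHom_comp, Polynomial.mapRingHom_comp, hg]

/-- In a chart, restricting to the slice over `t` is evaluating polynomials at `t`; this turns the
computation of fibres into algebra. -/
lemma chart_slice (t : ℂ) : c ≫ slice f (𝟙 Y) t =
    Spec.map (CommRingCat.ofHom (Polynomial.evalRingHom (algebraMap ℂ B t))) ≫
      lineChart f c hc := by
  rw [slice_comp]
  refine Limits.pullback.hom_ext ?_ ?_
  · rw [slice, Limits.pullback.lift_fst, Category.assoc, lineChart_fst, ← Spec.map_comp_assoc,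
      ← CommRingCat.ofHom_comp]
    have : (Polynomial.evalRingHom (algebraMap ℂ B t)).comp Polynomial.C = RingHom.id B := by
      ext x
      simp
    rw [this, CommRingCat.ofHom_id, Spec.map_id, Category.id_comp]
  · rw [slice, Limits.pullback.lift_snd, Category.assoc, Category.assoc, lineChart_snd,
      ← Spec.map_comp, ← CommRingCat.ofHom_comp, ← Category.assoc, hc, affineLinePoint, ← Spec.map_comp, ← CommRingCat.ofHom_comp]
    congr 2
    refine Polynomial.ringHom_ext (fun x => ?_) ?_ <;> simp

end Line

/-! ### Flatness over `𝔸¹` as absence of torsion -/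

section Flat

open Polynomial

/-- `ℂ[X]` is a Dedekind domain, over which flat means torsion-free. -/
lemma flat_of_forall_mul_eq_zero {S : Type} [CommRing S] (f : ℂ[X] →+* S)
    (h : ∀ p, p ≠ 0 → ∀ x, f p * x = 0 → x = 0) : f.Flat := by
  algebraize [f]
  change Module.Flat ℂ[X] S
  rw [IsDedekindDomain.flat_iff_torsion_eq_bot, eq_bot_iff]
  rintro x ⟨⟨p, hp⟩, hx⟩
  exact h p (nonZeroDivisors.ne_zero hp) x hx

lemma flat_of_flat_comp_isIso {A B C : CommRingCat.{0}} {f : A ⟶ B} {g : B ⟶ C} [IsIso g]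
    (h : (f ≫ g).hom.Flat) : f.hom.Flat := by
  have h1 : f = (f ≫ g) ≫ inv g := by simp
  rw [h1, CommRingCat.hom_comp]
  exact RingHom.Flat.comp h (RingHom.Flat.of_bijective (ConcreteCategory.bijective_of_isIso (inv g)))

variable {Y : Scheme.{0}} (f : Y ⟶ Spec (CommRingCat.of ℂ))

/-- The schemes `Spec (B[X] ⧸ J)` form an open cover of the subscheme, and `hJ` says that their
rings have no `ℂ[X]`-torsion. Flatness is then read off on stalks, which an open immersion does not
change. -/
lemma flat_subschemeι_snd (𝓘 : (timesLine f).IdealSheafData) {ι : Type} (B : ι → Type)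
    [∀ i, CommRing (B i)] [∀ i, Algebra ℂ (B i)] (c : ∀ i, Spec (CommRingCat.of (B i)) ⟶ Y)
    [∀ i, IsOpenImmersion (c i)] (hY : ∀ y, ∃ i, y ∈ Set.range (c i))
    (hc : ∀ i, c i ≫ f = Spec.map (CommRingCat.ofHom (algebraMap ℂ (B i))))
    (J : ∀ i, Ideal (B i)[X])
    (h𝓘 : ∀ i, 𝓘.comap (lineChart f (c i) (hc i)) = specIdeal (R := CommRingCat.of (B i)[X]) (J i))
    (hJ : ∀ i (p : ℂ[X]), p ≠ 0 → ∀ g, mapRingHom (algebraMap ℂ (B i)) p * g ∈ J i → g ∈ J i) :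
    Flat (𝓘.subschemeι ≫ Limits.pullback.snd f affineLineMap) := by
  let q : ∀ i, Spec (CommRingCat.of ((B i)[X] ⧸ J i)) ⟶ Spec (CommRingCat.of (B i)[X]) :=
    fun i => Spec.map (CommRingCat.ofHom (Ideal.Quotient.mk (J i)))
  have hq : ∀ i, (q i).ker = 𝓘.comap (lineChart f (c i) (hc i)) := fun i => (h𝓘 i).symm
  have hcl : ∀ i, IsClosedImmersion (q i) := fun i =>
    IsClosedImmersion.spec_of_surjective _ Ideal.Quotient.mk_surjective
  have hle : ∀ i, 𝓘.subschemeι.ker ≤ (q i ≫ lineChart f (c i) (hc i)).ker := by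
    intro i
    rw [Scheme.IdealSheafData.ker_subschemeι, Scheme.Hom.ker_comp,
      Scheme.IdealSheafData.le_map_iff_comap_le, hq]
  let j : ∀ i, Spec (CommRingCat.of ((B i)[X] ⧸ J i)) ⟶ 𝓘.subscheme := fun i =>
    IsClosedImmersion.lift 𝓘.subschemeι (q i ≫ lineChart f (c i) (hc i)) (hle i)
  have hj : ∀ i, j i ≫ 𝓘.subschemeι = q i ≫ lineChart f (c i) (hc i) := fun i =>
    IsClosedImmersion.lift_fac _ _ (hle i)
  have hpb : ∀ i, IsPullback (q i) (j i) (lineChart f (c i) (hc i)) 𝓘.subschemeι := by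
    intro i
    exact isPullback_of_isClosedImmersion (q i) 𝓘.subschemeι (j i) (lineChart f (c i) (hc i))
      (hj i).symm (by rw [Scheme.IdealSheafData.ker_subschemeι, hq])
  have hjo : ∀ i, IsOpenImmersion (j i) := fun i =>
    MorphismProperty.of_isPullback (hpb i) inferInstance
  have hcov : ∀ x : 𝓘.subscheme, ∃ i, x ∈ Set.range (j i) := by
    intro x
    obtain ⟨i, hi⟩ := hY (Limits.pullback.fst f affineLineMap (𝓘.subschemeι x))
    obtain ⟨w, hw⟩ := mem_range_lineChart f (c i) (hc i) hi
    obtain ⟨z, hz, hz'⟩ := Scheme.Pullback.exists_preimage_pullback w x hw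
    refine ⟨i, (hpb i).isoPullback.inv z, ?_⟩
    rw [← hz', ← Scheme.Hom.comp_apply, IsPullback.isoPullback_inv_snd]
  have hfl : ∀ i, Flat (j i ≫ 𝓘.subschemeι ≫ Limits.pullback.snd f affineLineMap) := by
    intro i
    rw [← Category.assoc, hj, Category.assoc, lineChart_snd, ← Spec.map_comp, Flat.SpecMap_iff]
    refine flat_of_forall_mul_eq_zero _ fun p hp x hx => ?_
    obtain ⟨g, rfl⟩ := Ideal.Quotient.mk_surjective x
    have hx' : Ideal.Quotient.mk (J i) (mapRingHom (algebraMap ℂ (B i)) p * g) = 0 := by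
      rw [map_mul]
      exact hx
    rw [Ideal.Quotient.eq_zero_iff_mem] at hx' ⊢
    exact hJ i p hp g hx'
  rw [Flat.iff_flat_stalkMap]
  intro x
  obtain ⟨i, z, rfl⟩ := hcov x
  have h1 := (Flat.iff_flat_stalkMap _).1 (hfl i) z
  rw [Scheme.Hom.stalkMap_comp] at h1
  exact flat_of_flat_comp_isIso h1

end Flat


/-! ### Regular sequences in terms of ideal membership -/

section RegularSequence

open RingTheory.Sequence

variable {S T : Type} [CommRing S] [CommRing T]

lemma isWeaklyRegular_iff_mem (rs : List S) : IsWeaklyRegular S rs ↔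
    ∀ (i : ℕ) (hi : i < rs.length) (a : S), a * rs[i] ∈ Ideal.ofList (rs.take i) →
      a ∈ Ideal.ofList (rs.take i) := by
  rw [isWeaklyRegular_iff]
  refine forall_congr' fun i => forall_congr' fun hi => ?_
  have hq : (Ideal.ofList (rs.take i) • ⊤ : Submodule S S) = Ideal.ofList (rs.take i) := by simp
  rw [isSMulRegular_iff_right_eq_zero_of_smul]
  constructor
  · intro h a ha
    have h1 := h (Submodule.Quotient.mk a) (by
      rw [← Submodule.Quotient.mk_smul, Submodule.Quotient.mk_eq_zero, hq, smul_eq_mul, mul_comm]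
      exact ha)
    rwa [Submodule.Quotient.mk_eq_zero, hq] at h1
  · intro h x hx
    obtain ⟨a, rfl⟩ := Submodule.Quotient.mk_surjective _ x
    rw [← Submodule.Quotient.mk_smul, Submodule.Quotient.mk_eq_zero, hq, smul_eq_mul,
      mul_comm] at hx
    rw [Submodule.Quotient.mk_eq_zero, hq]
    exact h a hx

/-- `T` is `S / (x)`, and the initial ideals of `x :: rs` are the preimages of those of the image of
`rs` in `T`. -/
lemma isWeaklyRegular_cons_iff_of_surjective {h : S →+* T} (hs : Function.Surjective h) {x : S}
    (hk : RingHom.ker h = Ideal.span {x}) (hx : IsSMulRegular S x) (rs : List S) :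
    IsWeaklyRegular S (x :: rs) ↔ IsWeaklyRegular T (rs.map h) := by
  have key : ∀ i, Ideal.ofList ((x :: rs).take (i + 1)) =
      (Ideal.ofList ((rs.map h).take i)).comap h := by
    intro i
    rw [← List.map_take, ← Ideal.map_ofList, Ideal.comap_map_of_surjective' h hs, hk,
      List.take_succ_cons, Ideal.ofList_cons, sup_comm]
  rw [isWeaklyRegular_iff_mem, isWeaklyRegular_iff_mem]
  constructor
  · intro H i hi a ha
    obtain ⟨b, rfl⟩ := hs a
    have h1 := H (i + 1) (by simpa using hi) b
    rw [key] at h1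
    simpa using h1 (by simpa using ha)
  · rintro H (_ | i) hi a ha
    · simp only [List.take_zero, Ideal.ofList_nil, Ideal.mem_bot, List.getElem_cons_zero] at ha ⊢
      exact isSMulRegular_iff_right_eq_zero_of_smul.1 hx a (by rwa [smul_eq_mul, mul_comm])
    · rw [key] at ha ⊢
      exact H i (by simpa using hi) _ (by simpa using ha)

/-- In a Noetherian local ring a regular sequence inside the maximal ideal may be permuted, so `x`
can be tested last instead of first. -/
lemma isWeaklyRegular_cons_iff_of_isLocalRing [IsLocalRing S] [IsNoetherianRing S] {x : S}
    {rs : List S} (hm : ∀ r ∈ x :: rs, r ∈ IsLocalRing.maximalIdeal S) :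
    IsWeaklyRegular S (x :: rs) ↔ IsWeaklyRegular S rs ∧
      ∀ a, a * x ∈ Ideal.ofList rs → a ∈ Ideal.ofList rs := by
  have hperm : (x :: rs).Perm (rs ++ [x]) := (List.perm_append_singleton x rs).symm
  have h1 : IsWeaklyRegular S (x :: rs) ↔ IsWeaklyRegular S (rs ++ [x]) :=
    ⟨fun h => IsLocalRing.isWeaklyRegular_of_perm_of_subset_maximalIdeal h hperm hm,
      fun h => IsLocalRing.isWeaklyRegular_of_perm_of_subset_maximalIdeal h hperm.symm
        fun r hr => hm r (hperm.mem_iff.2 hr)⟩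
  rw [h1, isWeaklyRegular_iff_mem, isWeaklyRegular_iff_mem]
  constructor
  · intro H
    refine ⟨fun i hi a ha => ?_, fun a ha => ?_⟩
    · have := H i (by rw [List.length_append]; omega) a
      rw [List.take_append_of_le_length hi.le, List.getElem_append_left hi] at this
      exact this ha
    · have := H rs.length (by simp) a
      rw [List.take_left, List.getElem_concat_length rfl] at this
      exact this ha
  · rintro ⟨H, H'⟩ i hi a ha
    rcases lt_or_ge i rs.length with h | h
    · rw [List.take_append_of_le_length h.le] at ha ⊢
      rw [List.getElem_append_left h] at ha
      exact H i h a ha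
    · obtain rfl : i = rs.length := le_antisymm (by simp at hi; omega) h
      rw [List.take_left] at ha ⊢
      rw [List.getElem_concat_length rfl] at ha
      exact H' a ha

lemma ofList_take_ofFn {k : ℕ} (r : Fin k → S) (i : Fin k) :
    Ideal.ofList ((List.ofFn r).take i) = Ideal.span (r '' Set.Iio i) := by
  refine congrArg Ideal.span (Set.ext fun x => ?_)
  change x ∈ (List.ofFn r).take i ↔ _
  rw [List.mem_take_iff_getElem]
  constructor
  · rintro ⟨j, hj, rfl⟩
    rw [List.length_ofFn] at hj
    exact ⟨⟨j, by omega⟩, by simp [Fin.lt_def]; omega, by simp⟩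
  · rintro ⟨j, hj, rfl⟩
    exact ⟨j, by simpa using hj, by simp⟩

lemma ofList_ofFn {k : ℕ} (r : Fin k → S) :
    Ideal.ofList (List.ofFn r) = Ideal.span (Set.range r) := by
  refine congrArg Ideal.span (Set.ext fun x => ?_)
  exact List.mem_ofFn

lemma isWeaklyRegular_ofFn_iff {k : ℕ} (r : Fin k → S) : IsWeaklyRegular S (List.ofFn r) ↔
    ∀ (i : Fin k) (a : S), a * r i ∈ Ideal.span (r '' Set.Iio i) →
      a ∈ Ideal.span (r '' Set.Iio i) := by
  rw [isWeaklyRegular_iff_mem]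
  constructor
  · intro h i a ha
    have := h i (by simp) a
    rw [ofList_take_ofFn] at this
    exact this (by simpa using ha)
  · intro h i hi a ha
    rw [List.length_ofFn] at hi
    have := h ⟨i, hi⟩ a
    rw [← ofList_take_ofFn] at this
    exact this (by simpa using ha)

/-- The sequence `r` is weakly regular on the localization at the prime `p`. -/
def IsWeaklyRegularAt {k : ℕ} (r : Fin k → S) (p : Ideal S) : Prop :=
  ∀ (i : Fin k) (a : S), a * r i ∈ Ideal.span (r '' Set.Iio i) →
    ∃ u ∉ p, u * a ∈ Ideal.span (r '' Set.Iio i)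

lemma isWeaklyRegular_atPrime_iff {k : ℕ} (r : Fin k → S) (p : Ideal S) [p.IsPrime] :
    IsWeaklyRegular (Localization.AtPrime p)
      (List.ofFn fun i => algebraMap S (Localization.AtPrime p) (r i)) ↔
    IsWeaklyRegularAt r p := by
  have himg : ∀ i, Ideal.span ((fun i => algebraMap S (Localization.AtPrime p) (r i)) '' Set.Iio i) =
      (Ideal.span (r '' Set.Iio i)).map (algebraMap S (Localization.AtPrime p)) := by
    intro i
    rw [Ideal.map_span, Set.image_image]
  rw [isWeaklyRegular_ofFn_iff]
  refine forall_congr' fun i => ?_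
  rw [himg]
  constructor
  · intro h a ha
    have := h (algebraMap S _ a) (by rw [← map_mul]; exact Ideal.mem_map_of_mem _ ha)
    rw [IsLocalization.algebraMap_mem_map_algebraMap_iff p.primeCompl] at this
    exact this
  · intro h a ha
    -- Clearing the denominator of `a`, and then the one hidden in membership in the extended ideal,
    -- leaves a statement in `S`.
    obtain ⟨⟨b, u⟩, hb⟩ := IsLocalization.surj p.primeCompl a
    have h1 : algebraMap S (Localization.AtPrime p) (b * r i) ∈
        (Ideal.span (r '' Set.Iio i)).map (algebraMap S (Localization.AtPrime p)) := by
      rw [map_mul, ← hb, mul_right_comm]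
      exact Ideal.mul_mem_right _ _ ha
    rw [IsLocalization.algebraMap_mem_map_algebraMap_iff p.primeCompl] at h1
    obtain ⟨v, hv, h1⟩ := h1
    rw [← mul_assoc] at h1
    obtain ⟨w, hw, h2⟩ := h _ h1
    have h3 : algebraMap S (Localization.AtPrime p) (w * v) * algebraMap S _ b ∈
        (Ideal.span (r '' Set.Iio i)).map (algebraMap S (Localization.AtPrime p)) := by
      rw [← map_mul, mul_assoc]
      exact Ideal.mem_map_of_mem _ h2
    have hu : IsUnit (algebraMap S (Localization.AtPrime p) (w * v * u)) :=
      IsLocalization.map_units _ (⟨w * v, p.primeCompl.mul_mem hw hv⟩ * u : p.primeCompl)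
    rw [← hb, mul_comm a, ← mul_assoc, ← map_mul] at h3
    exact (Ideal.unit_mul_mem_iff_mem _ hu).1 h3

end RegularSequence


/-! ### Specialising a sequence in `A[X]` to a value of `X` -/

section Pencil

open RingTheory.Sequence Polynomial

variable {A : Type} [CommRing A] [Algebra ℂ A]

/-- Evaluation at `t ∈ ℂ`. -/
abbrev evalAt (A : Type) [CommRing A] [Algebra ℂ A] (t : ℂ) : A[X] →+* A :=
  evalRingHom (algebraMap ℂ A t)

lemma ker_evalAt (t : ℂ) : RingHom.ker (evalAt A t) = Ideal.span {X - C (algebraMap ℂ A t)} :=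
  ker_evalRingHom _

lemma evalAt_C (t : ℂ) (a : A) : evalAt A t (C a) = a := eval_C

lemma evalAt_surjective (t : ℂ) : Function.Surjective (evalAt A t) := fun a => ⟨C a, evalAt_C t a⟩

/-- The elements of `A[t]` that some nonzero polynomial in `ℂ[t]` multiplies into the ideal `I`. -/
def torsionClosure (I : Ideal A[X]) : Ideal A[X] where
  carrier := {a | ∃ f : ℂ[X], f ≠ 0 ∧ f.map (algebraMap ℂ A) * a ∈ I}
  zero_mem' := ⟨1, one_ne_zero, by simp⟩
  add_mem' := by
    rintro a b ⟨f, hf, hfa⟩ ⟨g, hg, hgb⟩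
    refine ⟨f * g, mul_ne_zero hf hg, ?_⟩
    rw [Polynomial.map_mul, mul_add]
    refine add_mem ?_ ?_
    · rw [mul_comm (f.map _), mul_assoc]
      exact Ideal.mul_mem_left _ _ hfa
    · rw [mul_assoc]
      exact Ideal.mul_mem_left _ _ hgb
  smul_mem' := by
    rintro c a ⟨f, hf, hfa⟩
    refine ⟨f, hf, ?_⟩
    rw [smul_eq_mul, mul_left_comm]
    exact Ideal.mul_mem_left _ _ hfa

lemma le_torsionClosure (I : Ideal A[X]) : I ≤ torsionClosure I :=
  fun a ha => ⟨1, one_ne_zero, by simpa using ha⟩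

lemma mem_torsionClosure_of_mul_mem {I : Ideal A[X]} {a : A[X]} {f : ℂ[X]} (hf : f ≠ 0)
    (h : f.map (algebraMap ℂ A) * a ∈ torsionClosure I) : a ∈ torsionClosure I := by
  obtain ⟨g, hg, h⟩ := h
  exact ⟨g * f, mul_ne_zero hg hf, by rwa [Polynomial.map_mul, mul_assoc]⟩

/-- The local ring of `Spec A × 𝔸¹` at the point `p` of the slice over `t` maps onto the local ring
of `Spec A` at `p`. -/
def localEvalAt (t : ℂ) (p : Ideal A) [p.IsPrime] :
    Localization.AtPrime (p.comap (evalAt A t)) →+* Localization.AtPrime p :=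
  Localization.localRingHom _ p (evalAt A t) rfl

lemma localEvalAt_algebraMap (t : ℂ) (p : Ideal A) [p.IsPrime] (a : A[X]) :
    localEvalAt t p (algebraMap _ _ a) = algebraMap _ _ (evalAt A t a) :=
  Localization.localRingHom_to_map _ _ _ _ _

lemma localEvalAt_surjective (t : ℂ) (p : Ideal A) [p.IsPrime] :
    Function.Surjective (localEvalAt t p) := by
  intro z
  obtain ⟨a, u, rfl⟩ := IsLocalization.exists_mk'_eq p.primeCompl z
  refine ⟨IsLocalization.mk' _ (C a) (⟨C u, fun h => u.2 (by simpa using h)⟩ :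
    (p.comap (evalAt A t)).primeCompl), ?_⟩
  rw [localEvalAt, Localization.localRingHom_mk']
  congr 1
  · simp
  · ext1
    simp

variable [IsDomain A]

lemma ker_localEvalAt (t : ℂ) (p : Ideal A) [p.IsPrime] :
    RingHom.ker (localEvalAt t p) =
      Ideal.span {algebraMap _ _ (X - C (algebraMap ℂ A t) : A[X])} := by
  apply le_antisymm
  · intro z hz
    obtain ⟨b, u, rfl⟩ := IsLocalization.exists_mk'_eq (p.comap (evalAt A t)).primeCompl z
    rw [RingHom.mem_ker, localEvalAt, Localization.localRingHom_mk',
      IsLocalization.mk'_eq_zero_iff] at hz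
    obtain ⟨v, hv⟩ := hz
    have hb : b ∈ RingHom.ker (evalAt A t) :=
      (mul_eq_zero.1 hv).resolve_left fun h => v.2 (by rw [h]; exact zero_mem p)
    rw [ker_evalAt, Ideal.mem_span_singleton] at hb
    obtain ⟨c, rfl⟩ := hb
    rw [Ideal.mem_span_singleton]
    exact ⟨IsLocalization.mk' _ c u, (IsLocalization.mul_mk'_eq_mk'_of_mul _ _ _).symm⟩
  · rw [Ideal.span_le, Set.singleton_subset_iff, SetLike.mem_coe, RingHom.mem_ker,
      localEvalAt_algebraMap]
    simp

variable [IsNoetherianRing A] {k : ℕ}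

/-- The local ring of the slice is the local ring of the total space modulo the nonzerodivisor `X -
t`, so the specialised sequence is regular iff `(X - t, r)` is. Moving `X - t` to the end splits
this into regularity of `r` upstairs and injectivity of `X - t` modulo `r`. -/
lemma isWeaklyRegular_evalAt_iff (r : Fin k → A[X]) (t : ℂ) (p : Ideal A) [p.IsPrime]
    (hp : ∀ i, evalAt A t (r i) ∈ p) :
    IsWeaklyRegular (Localization.AtPrime p)
      (List.ofFn fun i => algebraMap A (Localization.AtPrime p) (evalAt A t (r i))) ↔
    IsWeaklyRegular (Localization.AtPrime (p.comap (evalAt A t)))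
      (List.ofFn fun i => algebraMap A[X] (Localization.AtPrime (p.comap (evalAt A t))) (r i)) ∧
    ∀ a, a * algebraMap _ _ (X - C (algebraMap ℂ A t)) ∈
        (Ideal.span (Set.range r)).map
          (algebraMap A[X] (Localization.AtPrime (p.comap (evalAt A t)))) →
      a ∈ (Ideal.span (Set.range r)).map
        (algebraMap A[X] (Localization.AtPrime (p.comap (evalAt A t)))) := by
  have hx : algebraMap A[X] (Localization.AtPrime (p.comap (evalAt A t)))
      (X - C (algebraMap ℂ A t)) ≠ 0 := by
    exact (map_ne_zero_iff _ (IsLocalization.injective _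
      (Ideal.primeCompl_le_nonZeroDivisors (p.comap (evalAt A t))))).2 (X_sub_C_ne_zero _)
  have hxr : IsSMulRegular (Localization.AtPrime (p.comap (evalAt A t)))
      (algebraMap A[X] (Localization.AtPrime (p.comap (evalAt A t)))
      (X - C (algebraMap ℂ A t))) :=
    isSMulRegular_iff_right_eq_zero_of_smul.2 fun m hm => (mul_eq_zero.1 hm).resolve_left hx
  have h1 := isWeaklyRegular_cons_iff_of_surjective (localEvalAt_surjective t p)
    (ker_localEvalAt t p) hxr
    (List.ofFn fun i => algebraMap A[X] (Localization.AtPrime (p.comap (evalAt A t))) (r i))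
  have h2 := isWeaklyRegular_cons_iff_of_isLocalRing
    (x := algebraMap A[X] (Localization.AtPrime (p.comap (evalAt A t)))
      (X - C (algebraMap ℂ A t)))
    (rs := List.ofFn fun i =>
      algebraMap A[X] (Localization.AtPrime (p.comap (evalAt A t))) (r i)) (by
        intro y hy
        rcases List.mem_cons.1 hy with rfl | hy
        · rw [IsLocalization.AtPrime.to_map_mem_maximal_iff _ (p.comap (evalAt A t))]
          simp
        · obtain ⟨i, rfl⟩ := List.mem_ofFn.1 hy
          rw [IsLocalization.AtPrime.to_map_mem_maximal_iff _ (p.comap (evalAt A t))]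
          exact hp i)
  rw [List.map_ofFn] at h1
  have e : (localEvalAt t p ∘ fun i =>
      algebraMap A[X] (Localization.AtPrime (p.comap (evalAt A t))) (r i)) =
      fun i => algebraMap A (Localization.AtPrime p) (evalAt A t (r i)) :=
    funext fun i => localEvalAt_algebraMap t p (r i)
  rw [e] at h1
  rw [← h1, h2, ofList_ofFn, Ideal.map_span, ← Set.range_comp]
  rfl

end Pencil


/-! ### Irregularity ideals, exceptional values and torsion -/

section Pencil

open RingTheory.Sequence Polynomial

/-- The ideal of all `c` with `c · (I : r_j) ⊆ I`, where `I = (r_i | i < j)`. It cuts out the locus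
where multiplication by `r_j` is not injective modulo `I`. -/
def irregularityIdeal {S : Type} [CommRing S] {k : ℕ} (r : Fin k → S) (j : Fin k) : Ideal S where
  carrier := {c | ∀ a, a * r j ∈ Ideal.span (r '' Set.Iio j) → c * a ∈ Ideal.span (r '' Set.Iio j)}
  zero_mem' := fun a _ => by simp
  add_mem' := fun {x y} hx hy a ha => by
    rw [add_mul]
    exact add_mem (hx a ha) (hy a ha)
  smul_mem' := fun x y hy a ha => by
    rw [smul_eq_mul, mul_assoc]
    exact Ideal.mul_mem_left _ _ (hy a ha)

/-- The ideal `(I : r_j)` is finitely generated; the product of the multipliers of its generators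
works for all its elements and still avoids the prime. -/
lemma exists_mem_irregularityIdeal {S : Type} [CommRing S] [IsNoetherianRing S] {k : ℕ}
    (r : Fin k → S) (P : Ideal S) [P.IsPrime] (j : Fin k)
    (h : ∀ a, a * r j ∈ Ideal.span (r '' Set.Iio j) → ∃ u ∉ P, u * a ∈ Ideal.span (r '' Set.Iio j)) :
    ∃ c ∈ irregularityIdeal r j, c ∉ P := by
  let Q : Ideal S := Submodule.comap (LinearMap.mulRight S (r j)) (Ideal.span (r '' Set.Iio j))
  obtain ⟨T, hT⟩ := (isNoetherian_def.1 (inferInstanceAs (IsNoetherian S S))) Q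
  have hTQ : ∀ a ∈ T, a ∈ Q := fun a ha => hT ▸ Submodule.subset_span ha
  choose! u hu hua using fun a (ha : a ∈ T) => h a (hTQ a ha)
  refine ⟨∏ a ∈ T, u a, fun a ha => ?_, fun hm => ?_⟩
  · have haQ : a ∈ Submodule.span S (T : Set S) := hT ▸ (show a ∈ Q from ha)
    induction haQ using Submodule.span_induction with
    | mem x hx =>
      obtain ⟨c, hc⟩ := Finset.dvd_prod_of_mem u (Finset.mem_coe.1 hx)
      rw [hc, mul_right_comm]
      exact Ideal.mul_mem_right _ _ (hua x hx)
    | zero => simp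
    | add x y hx hy h1 h2 =>
      rw [mul_add]
      exact add_mem (h1 (show x ∈ Q from hT ▸ hx)) (h2 (show y ∈ Q from hT ▸ hy))
    | smul c x hx h1 =>
      rw [smul_eq_mul, mul_left_comm]
      exact Ideal.mul_mem_left _ _ (h1 (show x ∈ Q from hT ▸ hx))
  · obtain ⟨a, ha, ha'⟩ := (Ideal.IsPrime.prod_mem_iff).1 hm
    exact hu a ha ha'

lemma mem_map_of_mul_mem_map {S L : Type} [CommRing S] [CommRing L] [Algebra S L] (M : Submonoid S)
    [IsLocalization M L] {I : Ideal S} {x : S} (h : ∀ a, a * x ∈ I → a ∈ I) {a : L}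
    (ha : a * algebraMap S L x ∈ I.map (algebraMap S L)) : a ∈ I.map (algebraMap S L) := by
  obtain ⟨⟨b, u⟩, hb⟩ := IsLocalization.surj M a
  have h1 : algebraMap S L (b * x) ∈ I.map (algebraMap S L) := by
    rw [map_mul, ← hb, mul_right_comm]
    exact Ideal.mul_mem_right _ _ ha
  rw [IsLocalization.algebraMap_mem_map_algebraMap_iff M] at h1
  obtain ⟨v, hv, h1⟩ := h1
  rw [← mul_assoc] at h1
  have h2 := Ideal.mem_map_of_mem (algebraMap S L) (h _ h1)
  have hu : IsUnit (algebraMap S L (v * u)) := IsLocalization.map_units _ (⟨v, hv⟩ * u : M)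
  rw [map_mul, ← hb, mul_comm a, ← mul_assoc, ← map_mul] at h2
  exact (Ideal.unit_mul_mem_iff_mem _ hu).1 h2

variable {A : Type} [CommRing A] [Algebra ℂ A] [IsNoetherianRing A] {k : ℕ}

/-- The zero divisors modulo `I` are the union of finitely many associated primes. No prime contains
both `X - t` and `X - t'` for `t ≠ t'`, as their difference is a unit. -/
lemma finite_zeroDivisors (I : Ideal A[X]) :
    {t : ℂ | ∃ a ∉ I, a * (X - C (algebraMap ℂ A t)) ∈ I}.Finite := by
  have hfin := associatedPrimes.finite A[X] (A[X] ⧸ I)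
  have hsub : ∀ t ∈ {t : ℂ | ∃ a ∉ I, a * (X - C (algebraMap ℂ A t)) ∈ I},
      ∃ q ∈ associatedPrimes A[X] (A[X] ⧸ I), X - C (algebraMap ℂ A t) ∈ q := by
    rintro t ⟨a, ha, hat⟩
    have h1 : X - C (algebraMap ℂ A t) ∈
        {x : A[X] | ∃ y : A[X] ⧸ I, y ≠ 0 ∧ x • y = 0} := by
      refine ⟨Ideal.Quotient.mk I a, fun h => ha (Ideal.Quotient.eq_zero_iff_mem.1 h), ?_⟩
      rw [← Ideal.Quotient.mk_eq_mk, ← Submodule.Quotient.mk_smul, Submodule.Quotient.mk_eq_zero,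
        smul_eq_mul, mul_comm]
      exact hat
    rw [← biUnion_associatedPrimes_eq_zero_divisors] at h1
    simpa using h1
  choose! q hq hqt using hsub
  refine Set.Finite.of_finite_image (f := q) (hfin.subset ?_) ?_
  · rintro _ ⟨t, ht, rfl⟩
    exact hq t ht
  · intro t ht t' ht' h
    by_contra hne
    have hp : (q t).IsPrime := (hq t ht).isPrime
    have h1 := sub_mem (hqt t' ht') (h ▸ hqt t ht)
    have h2 : (X - C (algebraMap ℂ A t')) - (X - C (algebraMap ℂ A t)) =
        C (algebraMap ℂ A (t - t')) := by
      simp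
    rw [h2] at h1
    refine hp.ne_top (h ▸ Ideal.eq_top_of_isUnit_mem _ h1 ?_)
    exact ((IsUnit.mk0 _ (sub_ne_zero.2 hne)).map (algebraMap ℂ A)).map C

variable [IsDomain A]

lemma isWeaklyRegularAt_evalAt_iff (r : Fin k → A[X]) (t : ℂ) (p : Ideal A) [p.IsPrime]
    (hp : ∀ i, evalAt A t (r i) ∈ p) : IsWeaklyRegularAt (fun i => evalAt A t (r i)) p ↔
    IsWeaklyRegularAt r (p.comap (evalAt A t)) ∧
    ∀ a, a * algebraMap _ _ (X - C (algebraMap ℂ A t)) ∈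
        (Ideal.span (Set.range r)).map
          (algebraMap A[X] (Localization.AtPrime (p.comap (evalAt A t)))) →
      a ∈ (Ideal.span (Set.range r)).map
        (algebraMap A[X] (Localization.AtPrime (p.comap (evalAt A t)))) := by
  rw [← isWeaklyRegular_atPrime_iff, ← isWeaklyRegular_atPrime_iff,
    isWeaklyRegular_evalAt_iff r t p hp]

/-- The sufficient condition to be checked at general `t`. The point lies on the zero locus, so the
summand of `c` in `(r)` vanishes there and the other one is a multiplier outside the prime. -/
lemma isWeaklyRegularAt_of_mem_irregularityIdeal {r : Fin k → A[X]} {t : ℂ} {p : Ideal A}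
    [hp : p.IsPrime] (hr : ∀ i, evalAt A t (r i) ∈ p)
    (h : ∀ j, ∃ c ∈ irregularityIdeal r j ⊔ Ideal.span (Set.range r), evalAt A t c ∉ p)
    (ht : ∀ a, a * (X - C (algebraMap ℂ A t)) ∈ Ideal.span (Set.range r) →
      a ∈ Ideal.span (Set.range r)) : IsWeaklyRegularAt (fun i => evalAt A t (r i)) p := by
  rw [isWeaklyRegularAt_evalAt_iff r t p hr]
  refine ⟨fun j a ha => ?_, fun a ha => ?_⟩
  · obtain ⟨c, hc, hu⟩ := h j
    obtain ⟨x, hx, y, hy, rfl⟩ := Submodule.mem_sup.1 hc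
    refine ⟨x, fun hxp => hu ?_, hx a ha⟩
    have hy' : y ∈ p.comap (evalAt A t) := by
      refine (Ideal.span_le.2 ?_) hy
      rintro _ ⟨i, rfl⟩
      exact hr i
    rw [map_add]
    exact add_mem hxp hy'
  · exact mem_map_of_mul_mem_map (p.comap (evalAt A t)).primeCompl ht ha

/-- If no power of `x` were in the image of the ideal, some prime containing the image would avoid
`x`. That prime is a point of the zero locus where the sequence is regular, so the irregularity
ideal contains an element outside it. -/
lemma exists_pow_eq_evalAt {r : Fin k → A[X]} {t : ℂ} {x : A}
    (h : ∀ p : Ideal A, p.IsPrime → (∀ i, evalAt A t (r i) ∈ p) → x ∉ p →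
      IsWeaklyRegularAt (fun i => evalAt A t (r i)) p) (j : Fin k) :
    ∃ (n : ℕ) (c : A[X]), c ∈ irregularityIdeal r j ⊔ Ideal.span (Set.range r) ∧
      evalAt A t c = x ^ n := by
  let J := (irregularityIdeal r j ⊔ Ideal.span (Set.range r)).map (evalAt A t)
  suffices hJ : ∃ n, x ^ n ∈ J by
    obtain ⟨n, hn⟩ := hJ
    rw [Ideal.mem_map_iff_of_surjective _ (evalAt_surjective t)] at hn
    obtain ⟨c, hc, hcn⟩ := hn
    exact ⟨n, c, hc, hcn⟩
  by_contra! hJ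
  obtain ⟨p, hp, hJp, hdisj⟩ := Ideal.exists_le_prime_disjoint J (Submonoid.powers x)
    (Set.disjoint_left.2 fun y hy hxy => by
      obtain ⟨n, rfl⟩ := hxy
      exact hJ n hy)
  have hr : ∀ i, evalAt A t (r i) ∈ p := fun i =>
    hJp (Ideal.mem_map_of_mem _ (Ideal.mem_sup_right (Ideal.subset_span ⟨i, rfl⟩)))
  have h1 := ((isWeaklyRegularAt_evalAt_iff r t p hr).1 (h p hp hr fun hx =>
    Set.disjoint_left.1 hdisj hx (Submonoid.mem_powers x))).1
  obtain ⟨c, hc, hcp⟩ := exists_mem_irregularityIdeal r _ j (h1 j)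
  exact hcp (hJp (Ideal.mem_map_of_mem _ (Ideal.mem_sup_left hc)))

/-- A regular fibre carries no torsion: if `f` times `a` lies in `(r)`, split off from `f` the
factors `X - t`. Near a point of the slice they can be cancelled modulo `(r)`, and the cofactor is a
unit because it does not vanish at `t`. So `a` lies in `(r)` locally, and its value lies in the
ideal of the fibre. -/
lemma evalAt_mem_of_mem_torsionClosure {r : Fin k → A[X]} {t : ℂ}
    (h : ∀ p : Ideal A, p.IsPrime → (∀ i, evalAt A t (r i) ∈ p) →
      IsWeaklyRegularAt (fun i => evalAt A t (r i)) p) {a : A[X]}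
    (ha : a ∈ torsionClosure (Ideal.span (Set.range r))) :
    evalAt A t a ∈ Ideal.span (Set.range fun i => evalAt A t (r i)) := by
  -- The colon ideal of the multipliers taking the value of `a` into the ideal of the fibre. A
  -- maximal ideal above `Q` is automatically a point of the zero locus, the only place where
  -- regularity is assumed.
  let Q : Ideal A := Submodule.comap (LinearMap.mulRight A (evalAt A t a))
    (Ideal.span (Set.range fun i => evalAt A t (r i)))
  suffices hQ : Q = ⊤ by
    have : (1 : A) ∈ Q := by rw [hQ]; trivial
    simpa [Q] using this
  by_contra hQ
  obtain ⟨p, hpm, hQp⟩ := Ideal.exists_le_maximal Q hQ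
  have hp := hpm.isPrime
  have hr : ∀ i, evalAt A t (r i) ∈ p := fun i =>
    hQp (Ideal.mul_mem_right (evalAt A t a) _ (Ideal.subset_span (Set.mem_range_self i)))
  have h1 := ((isWeaklyRegularAt_evalAt_iff r t p hr).1 (h p hp hr)).2
  obtain ⟨f, hf, hfa⟩ := ha
  obtain ⟨g, hg, hgt⟩ := exists_eq_pow_rootMultiplicity_mul_and_not_dvd f hf t
  have h2 : algebraMap A[X] (Localization.AtPrime (p.comap (evalAt A t))) a ∈
      (Ideal.span (Set.range r)).map (algebraMap A[X] _) := by
    have h3 := Ideal.mem_map_of_mem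
      (algebraMap A[X] (Localization.AtPrime (p.comap (evalAt A t)))) hfa
    rw [hg, Polynomial.map_mul, Polynomial.map_pow, Polynomial.map_sub, map_X, map_C,
      mul_assoc, map_mul, map_pow] at h3
    generalize rootMultiplicity t f = n at h3
    have h4 : algebraMap A[X] (Localization.AtPrime (p.comap (evalAt A t)))
        (g.map (algebraMap ℂ A) * a) ∈ (Ideal.span (Set.range r)).map (algebraMap A[X] _) := by
      clear hg
      induction n with
      | zero => simpa using h3
      | succ n ih =>
        refine ih (h1 _ ?_)
        rw [pow_succ] at h3
        convert h3 using 1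
        ring
    rw [map_mul] at h4
    refine (Ideal.unit_mul_mem_iff_mem _ ?_).1 h4
    have hgp : g.map (algebraMap ℂ A) ∈ (p.comap (evalAt A t)).primeCompl := by
      intro hmem
      have h5 : evalAt A t (g.map (algebraMap ℂ A)) = algebraMap ℂ A (g.eval t) := by
        simp [evalAt, eval_map_algebraMap, aeval_algebraMap_apply]
      rw [SetLike.mem_coe, Ideal.mem_comap, h5] at hmem
      refine hp.ne_top (Ideal.eq_top_of_isUnit_mem _ hmem ((IsUnit.mk0 _ ?_).map _))
      exact fun h => hgt (dvd_iff_isRoot.2 h)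
    exact IsLocalization.map_units (M := (p.comap (evalAt A t)).primeCompl) _ ⟨_, hgp⟩
  have h3 := Ideal.mem_map_of_mem (localEvalAt t p) h2
  rw [localEvalAt_algebraMap, Ideal.map_span, Ideal.map_span] at h3
  have h4 : (localEvalAt t p) '' (algebraMap A[X] (Localization.AtPrime (p.comap (evalAt A t))) ''
      Set.range r) = algebraMap A (Localization.AtPrime p) ''
        (Set.range fun i => evalAt A t (r i)) := by
    rw [← Set.range_comp, ← Set.range_comp, ← Set.range_comp]
    congr 1
    funext i
    exact localEvalAt_algebraMap t p (r i)
  rw [h4, ← Ideal.map_span, IsLocalization.algebraMap_mem_map_algebraMap_iff p.primeCompl] at h3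
  obtain ⟨u, hu, h3⟩ := h3
  exact hu (hQp h3)

end Pencil


/-! ### Inverting one element -/

section Away

open Polynomial

/-- The injective homomorphism `g` is the localization inverting the element `x`. -/
structure IsAway {A A' : Type} [CommRing A] [CommRing A'] (g : A →+* A') (x : A) : Prop where
  isUnit : IsUnit (g x)
  surj : ∀ a', ∃ (n : ℕ) (a : A), a' * g x ^ n = g a
  injective : Function.Injective g

namespace IsAway

variable {A A' : Type} [CommRing A] [CommRing A'] {g : A →+* A'} {x : A} (hg : IsAway g x)

include hg

lemma polynomial : IsAway (mapRingHom g) (C x) where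
  isUnit := by
    rw [coe_mapRingHom, map_C]
    exact hg.isUnit.map C
  injective := map_injective g hg.injective
  surj p := by
    rw [coe_mapRingHom, map_C]
    induction p using Polynomial.induction_on' with
    | add p q hp hq =>
      obtain ⟨m, a, ha⟩ := hp
      obtain ⟨n, b, hb⟩ := hq
      refine ⟨m + n, a * C x ^ n + b * C x ^ m, ?_⟩
      rw [Polynomial.map_add, Polynomial.map_mul, Polynomial.map_mul, ← ha, ← hb,
        Polynomial.map_pow, Polynomial.map_pow, map_C]
      ring
    | monomial d c =>
      obtain ⟨n, a, ha⟩ := hg.surj c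
      exact ⟨n, monomial d a, by rw [map_monomial, ← ha, ← C_pow, monomial_mul_C]⟩

lemma mem_map_iff {I : Ideal A} {a : A} : g a ∈ I.map g ↔ ∃ n : ℕ, x ^ n * a ∈ I := by
  constructor
  · intro h
    have key : ∀ b ∈ I.map g, ∃ (n : ℕ) (c : A), c ∈ I ∧ b * g x ^ n = g c := by
      intro b hb
      induction hb using Submodule.span_induction with
      | mem b hb =>
        obtain ⟨c, hc, rfl⟩ := hb
        exact ⟨0, c, hc, by simp⟩
      | zero => exact ⟨0, 0, zero_mem _, by simp⟩
      | add b c _ _ h1 h2 =>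
        obtain ⟨m, a, haI, ha⟩ := h1
        obtain ⟨n, b, hbI, hb⟩ := h2
        refine ⟨m + n, a * x ^ n + b * x ^ m,
          add_mem (Ideal.mul_mem_right _ _ haI) (Ideal.mul_mem_right _ _ hbI), ?_⟩
        rw [map_add, map_mul, map_mul, ← ha, ← hb, map_pow, map_pow]
        ring
      | smul c b _ h1 =>
        obtain ⟨m, a, haI, ha⟩ := h1
        obtain ⟨n, d, hd⟩ := hg.surj c
        refine ⟨n + m, d * a, Ideal.mul_mem_left _ _ haI, ?_⟩
        rw [map_mul, ← ha, ← hd, smul_eq_mul]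
        ring
    obtain ⟨n, c, hc, h2⟩ := key _ h
    refine ⟨n, ?_⟩
    rw [← map_pow, ← map_mul] at h2
    rwa [mul_comm, hg.injective h2]
  · rintro ⟨n, h⟩
    have := Ideal.mem_map_of_mem g h
    rw [map_mul, map_pow] at this
    exact (Ideal.unit_mul_mem_iff_mem _ (hg.isUnit.pow n)).1 this

lemma mul_pow_mem_iff {I : Ideal A'} {a : A'} (n : ℕ) : a * g x ^ n ∈ I ↔ a ∈ I :=
  Ideal.mul_unit_mem_iff_mem _ (hg.isUnit.pow n)

/-- Contraction to a subring commutes with inverting an element, provided the element comes from the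
subring. It is used for degree-zero parts, hence the need for monomials of degree zero. -/
lemma map_comap {B B' : Type} [CommRing B] [CommRing B'] {h : B →+* B'} {y : B} (hh : IsAway h y)
    {φ : B →+* A} {φ' : B' →+* A'} (hcomm : ∀ b, φ' (h b) = g (φ b)) (hxy : φ y = x) (I : Ideal A) :
    (I.comap φ).map h = (I.map g).comap φ' := by
  apply le_antisymm
  · rw [Ideal.map_le_iff_le_comap]
    intro b hb
    rw [Ideal.mem_comap, Ideal.mem_comap, hcomm]
    exact Ideal.mem_map_of_mem _ hb
  · intro b hb
    obtain ⟨n, c, hc⟩ := hh.surj b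
    have h1 : g (φ c) ∈ I.map g := by
      rw [← hcomm, ← hc, map_mul]
      exact Ideal.mul_mem_right _ _ hb
    obtain ⟨m, hm⟩ := hg.mem_map_iff.1 h1
    have h2 : y ^ m * c ∈ I.comap φ := by
      rwa [Ideal.mem_comap, map_mul, map_pow, hxy]
    rw [← hh.mul_pow_mem_iff n, hc]
    exact hh.mem_map_iff.2 ⟨m, h2⟩

/-- The multipliers in `ℂ[X]` are the same on both sides, so only a power of `x` has to be cleared.
-/
lemma map_torsionClosure [Algebra ℂ A] [Algebra ℂ A']
    (hgC : g.comp (algebraMap ℂ A) = algebraMap ℂ A') (I : Ideal A[X]) :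
    (torsionClosure I).map (mapRingHom g) = torsionClosure (I.map (mapRingHom g)) := by
  have hmap : ∀ f : ℂ[X], (f.map (algebraMap ℂ A)).map g = f.map (algebraMap ℂ A') := by
    intro f
    rw [Polynomial.map_map, hgC]
  apply le_antisymm
  · rw [Ideal.map_le_iff_le_comap]
    rintro a ⟨f, hf, hfa⟩
    refine ⟨f, hf, ?_⟩
    have := Ideal.mem_map_of_mem (mapRingHom g) hfa
    rwa [map_mul, coe_mapRingHom, hmap] at this
  · rintro a ⟨f, hf, hfa⟩
    obtain ⟨n, b, hb⟩ := hg.polynomial.surj a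
    rw [← hg.polynomial.mul_pow_mem_iff n, mul_assoc, hb] at hfa
    rw [← hg.polynomial.mul_pow_mem_iff n, hb, hg.polynomial.mem_map_iff]
    rw [← hmap, ← coe_mapRingHom, ← map_mul, hg.polynomial.mem_map_iff] at hfa
    obtain ⟨m, hm⟩ := hfa
    exact ⟨m, f, hf, by rwa [mul_left_comm]⟩

/-- Both sides concern the same local ring: a prime of the localization contracts to one that avoids
`x`, so powers of `x` are admissible multipliers. -/
lemma isWeaklyRegularAt_comp_iff {k : ℕ} (r : Fin k → A) (p : Ideal A') [hp : p.IsPrime] :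
    IsWeaklyRegularAt (fun i => g (r i)) p ↔ IsWeaklyRegularAt r (p.comap g) := by
  have hx : x ∉ p.comap g := fun h => hp.ne_top (Ideal.eq_top_of_isUnit_mem _ h hg.isUnit)
  have hmap : ∀ i, Ideal.span ((fun i => g (r i)) '' Set.Iio i) =
      (Ideal.span (r '' Set.Iio i)).map g := by
    intro i
    rw [Ideal.map_span, Set.image_image]
  refine forall_congr' fun i => ?_
  rw [hmap]
  constructor
  · intro h a ha
    obtain ⟨u, hu, hua⟩ := h (g a) (by rw [← map_mul]; exact Ideal.mem_map_of_mem _ ha)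
    obtain ⟨n, v, hv⟩ := hg.surj u
    rw [← hg.mul_pow_mem_iff n, mul_right_comm, hv, ← map_mul, hg.mem_map_iff] at hua
    obtain ⟨m, hm⟩ := hua
    refine ⟨x ^ m * v, fun h => ?_, by rwa [mul_assoc]⟩
    rcases (hp.comap g).mem_or_mem h with h | h
    · exact hx ((hp.comap g).mem_of_pow_mem _ h)
    · rw [Ideal.mem_comap, ← hv, hg.mul_pow_mem_iff] at h
      exact hu h
  · intro h a ha
    obtain ⟨n, b, hb⟩ := hg.surj a
    rw [← hg.mul_pow_mem_iff n, mul_right_comm, hb, ← map_mul, hg.mem_map_iff] at ha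
    obtain ⟨m, hm⟩ := ha
    rw [← mul_assoc] at hm
    obtain ⟨u, hu, hub⟩ := h _ hm
    refine ⟨g (u * x ^ m), fun h => ?_, ?_⟩
    · rcases (hp.comap g).mem_or_mem (show u * x ^ m ∈ p.comap g from h) with h | h
      · exact hu h
      · exact hx ((hp.comap g).mem_of_pow_mem _ h)
    · rw [← hg.mul_pow_mem_iff n, mul_assoc, hb, ← map_mul, mul_assoc]
      exact Ideal.mem_map_of_mem _ hub

end IsAway

lemma span_image_mul_of_isUnit {S ι : Type} [CommRing S] {u : ι → S} (hu : ∀ i, IsUnit (u i))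
    (r : ι → S) (s : Set ι) :
    Ideal.span ((fun i => u i * r i) '' s) = Ideal.span (r '' s) := by
  apply le_antisymm
  · rw [Ideal.span_le]
    rintro _ ⟨i, hi, rfl⟩
    exact Ideal.mul_mem_left _ _ (Ideal.subset_span ⟨i, hi, rfl⟩)
  · rw [Ideal.span_le]
    rintro _ ⟨i, hi, rfl⟩
    exact (Ideal.unit_mul_mem_iff_mem _ (hu i)).1 (Ideal.subset_span ⟨i, hi, rfl⟩)

lemma isWeaklyRegularAt_mul_iff {S : Type} [CommRing S] {k : ℕ} {u : Fin k → S}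
    (hu : ∀ i, IsUnit (u i)) (r : Fin k → S) (p : Ideal S) :
    IsWeaklyRegularAt (fun i => u i * r i) p ↔ IsWeaklyRegularAt r p := by
  refine forall_congr' fun i => forall_congr' fun a => ?_
  rw [span_image_mul_of_isUnit hu, mul_left_comm, Ideal.unit_mul_mem_iff_mem _ (hu i)]

end Away


/-! ### Gradings and homogeneous ideals -/

section Degree

open Polynomial

/-- The projections of a graded ring onto its graded pieces. -/
structure DegreeProj (A Λ : Type) [CommRing A] [AddCommGroup Λ] where
  proj : Λ → A →+ A
  proj_proj : ∀ χ a, proj χ (proj χ a) = proj χ a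
  proj_mul : ∀ χ ψ a b, proj ψ b = b → proj χ (a * b) = proj (χ - ψ) a * b
  exists_sum : ∀ a, ∃ T : Finset Λ, (∀ χ, χ ∉ T → proj χ a = 0) ∧ a = ∑ χ ∈ T, proj χ a

namespace DegreeProj

variable {A Λ : Type} [CommRing A] [AddCommGroup Λ] (d : DegreeProj A Λ)

/-- An ideal is homogeneous if it contains the graded components of its elements. -/
def IsHomogeneous (I : Ideal A) : Prop := ∀ a ∈ I, ∀ χ, d.proj χ a ∈ I

lemma isHomogeneous_sup {I J : Ideal A} (hI : d.IsHomogeneous I) (hJ : d.IsHomogeneous J) :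
    d.IsHomogeneous (I ⊔ J) := by
  intro a ha χ
  obtain ⟨x, hx, y, hy, rfl⟩ := Submodule.mem_sup.1 ha
  rw [map_add]
  exact add_mem (Ideal.mem_sup_left (hI x hx χ)) (Ideal.mem_sup_right (hJ y hy χ))

lemma isHomogeneous_span {ι : Type} {r : ι → A} {ψ : ι → Λ} (hr : ∀ i, d.proj (ψ i) (r i) = r i)
    (s : Set ι) : d.IsHomogeneous (Ideal.span (r '' s)) := by
  intro a ha χ
  induction ha using Submodule.closure_induction with
  | zero => rw [map_zero]; exact zero_mem _
  | add x y _ _ hx hy => rw [map_add]; exact add_mem hx hy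
  | smul_mem c x hx =>
    obtain ⟨i, hi, rfl⟩ := hx
    rw [smul_eq_mul, d.proj_mul χ (ψ i) _ _ (hr i)]
    exact Ideal.mul_mem_left _ _ (Ideal.subset_span ⟨i, hi, rfl⟩)

/-- A colon of homogeneous ideals is homogeneous. The test element `a` is split into components,
each of which is again a test element because `r j` is homogeneous; against a homogeneous test
element the components of `c` separate. -/
lemma isHomogeneous_irregularityIdeal {k : ℕ} {r : Fin k → A} {ψ : Fin k → Λ}
    (hr : ∀ i, d.proj (ψ i) (r i) = r i) (j : Fin k) : d.IsHomogeneous (irregularityIdeal r j) := by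
  have hI := d.isHomogeneous_span hr (Set.Iio j)
  intro c hc χ a ha
  obtain ⟨T, -, hT⟩ := d.exists_sum a
  rw [hT, Finset.mul_sum]
  refine sum_mem fun ξ _ => ?_
  have h1 : d.proj ξ a * r j ∈ Ideal.span (r '' Set.Iio j) := by
    have := hI _ ha (ξ + ψ j)
    rwa [d.proj_mul _ _ _ _ (hr j), add_sub_cancel_right] at this
  have h2 := hI _ (hc _ h1) (χ + ξ)
  rwa [d.proj_mul _ _ _ _ (d.proj_proj ξ a), add_sub_cancel_right] at h2

/-- Application of an additive map to the coefficients of a polynomial. -/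
def mapCoeff (g : A →+ A) : A[X] →+ A[X] where
  toFun p := ∑ n ∈ p.support, monomial n (g (p.coeff n))
  map_zero' := by simp
  map_add' p q := by
    ext m
    have key : ∀ f : A[X], (∑ n ∈ f.support, monomial n (g (f.coeff n))).coeff m =
        g (f.coeff m) := by
      intro f
      rw [finsetSum_coeff]
      simp only [coeff_monomial, Finset.sum_ite_eq']
      split_ifs with h
      · rfl
      · rw [notMem_support_iff.1 h, map_zero]
    rw [coeff_add, key, key, key, coeff_add, map_add]

lemma coeff_mapCoeff (g : A →+ A) (p : A[X]) (m : ℕ) :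
    (mapCoeff g p).coeff m = g (p.coeff m) := by
  change (∑ n ∈ p.support, monomial n (g (p.coeff n))).coeff m = _
  rw [finsetSum_coeff]
  simp only [coeff_monomial, Finset.sum_ite_eq']
  split_ifs with h
  · rfl
  · rw [notMem_support_iff.1 h, map_zero]

/-- The grading of `A[t]` with `t` in degree `0`. -/
def polynomial : DegreeProj A[X] Λ where
  proj χ := mapCoeff (d.proj χ)
  proj_proj χ a := by
    ext n
    rw [coeff_mapCoeff, coeff_mapCoeff, d.proj_proj]
  proj_mul χ ψ a b hb := by
    ext n
    rw [coeff_mapCoeff, coeff_mul, coeff_mul, map_sum]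
    refine Finset.sum_congr rfl fun x _ => ?_
    rw [coeff_mapCoeff, d.proj_mul χ ψ]
    rw [← coeff_mapCoeff, hb]
  exists_sum a := by
    classical
    choose T hT hT' using d.exists_sum
    refine ⟨a.support.biUnion fun n => T (a.coeff n), fun χ hχ => ?_, ?_⟩
    · ext n
      rw [coeff_mapCoeff, coeff_zero]
      by_cases hn : n ∈ a.support
      · exact hT _ _ fun h => hχ (Finset.mem_biUnion.2 ⟨n, hn, h⟩)
      · rw [notMem_support_iff.1 hn, map_zero]
    · ext n
      rw [finsetSum_coeff]
      simp only [coeff_mapCoeff]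
      by_cases hn : n ∈ a.support
      · conv_lhs => rw [hT' (a.coeff n)]
        exact Finset.sum_subset (Finset.subset_biUnion_of_mem (fun n => T (a.coeff n)) hn)
          fun χ _ h => hT _ _ h
      · simp [notMem_support_iff.1 hn]

lemma polynomial_proj_coeff (χ : Λ) (p : A[X]) (n : ℕ) :
    (d.polynomial.proj χ p).coeff n = d.proj χ (p.coeff n) := coeff_mapCoeff _ _ _

end DegreeProj

end Degree


/-! ### Function rings of the open sets `(ℂˣ)^I × ℂ^{[R] ∖ I}` -/

section Laurent

open GITData

variable {R : ℕ}

/-- The Laurent polynomial ring in `R` variables. -/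
abbrev Laurent (R : ℕ) : Type := AddMonoidAlgebra ℂ (Fin R → ℤ)

lemma coxChart_mono {I J : Finset (Fin R)} (h : I ⊆ J) : coxChart R I ≤ coxChart R J :=
  fun _ hf e he i hi => hf e he i fun hI => hi (h hI)

lemma support_single_subset (e : Fin R → ℤ) (c : ℂ) {e' : Fin R → ℤ}
    (h : e' ∈ (AddMonoidAlgebra.single e c : Laurent R).coeff.support) : e' = e := by
  rw [AddMonoidAlgebra.coeff_single] at h
  exact Finset.mem_singleton.1 (Finsupp.support_single_subset h)

lemma eq_sum_single (f : Laurent R) :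
    f = ∑ e ∈ f.coeff.support, AddMonoidAlgebra.single e (f.coeff e) :=
  f.sum_coeff_single.symm

/-- The monomial `x^e` as a function on `(ℂˣ)^I × ℂ^{[R] ∖ I}`. -/
def mono (I : Finset (Fin R)) (e : Fin R → ℤ) (he : ∀ i, i ∉ I → 0 ≤ e i) : coxChart R I :=
  ⟨AddMonoidAlgebra.single e 1, single_mem_coxChart he 1⟩

lemma coe_mono (I : Finset (Fin R)) (e : Fin R → ℤ) (he : ∀ i, i ∉ I → 0 ≤ e i) :
    (mono I e he : Laurent R) = AddMonoidAlgebra.single e 1 := rfl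

lemma mono_mul_mono {I : Finset (Fin R)} {e e' : Fin R → ℤ} (he : ∀ i, i ∉ I → 0 ≤ e i)
    (he' : ∀ i, i ∉ I → 0 ≤ e' i) : mono I e he * mono I e' he' =
      mono I (e + e') fun i hi => add_nonneg (he i hi) (he' i hi) := by
  ext1
  rw [MulMemClass.coe_mul, coe_mono, coe_mono, coe_mono, AddMonoidAlgebra.single_mul_single, mul_one]

lemma mono_pow {I : Finset (Fin R)} {e : Fin R → ℤ} (he : ∀ i, i ∉ I → 0 ≤ e i) (n : ℕ) :
    mono I e he ^ n = mono I (n • e) fun i hi => nsmul_nonneg (he i hi) n := by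
  ext1
  rw [SubmonoidClass.coe_pow, coe_mono, coe_mono, AddMonoidAlgebra.single_pow, one_pow]

lemma isUnit_mono {I : Finset (Fin R)} {e : Fin R → ℤ} (he : ∀ i, i ∉ I → e i = 0) :
    IsUnit (mono I e fun i hi => (he i hi).ge) := by
  refine IsUnit.of_mul_eq_one (mono I (-e) fun i hi => by simp [he i hi]) ?_
  rw [mono_mul_mono]
  ext1
  rw [coe_mono, add_neg_cancel]
  rfl

instance (I : Finset (Fin R)) : IsDomain (coxChart R I) := inferInstance

/-- The inclusion of function rings given by the inclusion of the open set indexed by `J` into the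
one indexed by `I`. -/
abbrev coxIncl {I J : Finset (Fin R)} (h : I ⊆ J) : coxChart R I →ₐ[ℂ] coxChart R J :=
  Subalgebra.inclusion (coxChart_mono h)

lemma exists_mul_pow_mem_coxChart {I J : Finset (Fin R)} {m : Fin R → ℤ}
    (hm : ∀ i, i ∉ I → i ∈ J → 0 < m i) (hm0 : ∀ i, i ∉ I → 0 ≤ m i) {f : Laurent R}
    (hf : f ∈ coxChart R J) :
    ∃ n : ℕ, f * AddMonoidAlgebra.single (n • m) 1 ∈ coxChart R I := by
  classical
  have h1 : ∀ e : Fin R → ℤ, ∃ n : ℕ, (∀ i, i ∉ J → 0 ≤ e i) →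
      ∀ N : ℕ, n ≤ N → ∀ i, i ∉ I → 0 ≤ e i + N * m i := by
    intro e
    -- A crude bound on every `-e i`; it suffices since `m i ≥ 1` wherever the exponent can be
    -- negative. It works for all larger `N` as well, so the bounds for the finitely many monomials
    -- of `f` can be added up.
    refine ⟨∑ i, (e i).natAbs, fun he N hN i hi => ?_⟩
    by_cases hJ : i ∈ J
    · have h2 : (e i).natAbs ≤ ∑ i, (e i).natAbs :=
        Finset.single_le_sum (f := fun i => (e i).natAbs) (fun _ _ => Nat.zero_le _)
          (Finset.mem_univ i)
      have h3 : (1 : ℤ) ≤ m i := hm i hi hJ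
      have h4 : -((e i).natAbs : ℤ) ≤ e i := by omega
      have h5 : ((e i).natAbs : ℤ) ≤ N := by exact_mod_cast h2.trans hN
      nlinarith
    · exact add_nonneg (he i hJ) (mul_nonneg (Nat.cast_nonneg N) (hm0 i hi))
  choose n hn using h1
  refine ⟨∑ e ∈ f.coeff.support, n e, ?_⟩
  rw [eq_sum_single f, Finset.sum_mul]
  refine sum_mem fun e he => ?_
  rw [AddMonoidAlgebra.single_mul_single]
  refine single_mem_coxChart (fun i hi => ?_) _
  have := hn e (hf e he) _ (Finset.single_le_sum (f := n) (fun _ _ => Nat.zero_le _) he) i hi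
  rw [← eq_sum_single]
  simpa using this

/-- The open set of `J` is the locus in that of `I` where `x^m` does not vanish. -/
lemma isAway_coxIncl {I J : Finset (Fin R)} (h : I ⊆ J) {m : Fin R → ℤ}
    (hm : ∀ i, i ∉ I → i ∈ J → 0 < m i) (hm0 : ∀ i, i ∉ I → 0 ≤ m i) (hmJ : ∀ i, i ∉ J → m i = 0) :
    IsAway (coxIncl h).toRingHom (mono I m hm0) where
  isUnit := isUnit_mono hmJ
  injective := Subalgebra.inclusion_injective _
  surj a := by
    obtain ⟨n, hn⟩ := exists_mul_pow_mem_coxChart hm hm0 a.2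
    refine ⟨n, ⟨_, hn⟩, ?_⟩
    ext1
    rw [← map_pow, mono_pow]
    rfl

instance isNoetherianRing_coxChart_empty : IsNoetherianRing (coxChart R ∅) := by
  let φ : MvPolynomial (Fin R) ℂ →ₐ[ℂ] coxChart R ∅ :=
    MvPolynomial.aeval fun i => mono ∅ (Pi.single i 1) fun j _ => by
      by_cases h : j = i
      · subst h; simp
      · simp [h]
  have h1 : ∀ (e : Fin R → ℕ) (T : Finset (Fin R)), ∃ p, (φ p : Laurent R) =
      AddMonoidAlgebra.single (∑ i ∈ T, Pi.single i (e i : ℤ)) 1 := by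
    classical
    intro e T
    induction T using Finset.induction_on with
    | empty => exact ⟨1, by rw [map_one]; rfl⟩
    | insert i T hi ih =>
      obtain ⟨p, hp⟩ := ih
      refine ⟨MvPolynomial.X i ^ e i * p, ?_⟩
      rw [map_mul, MulMemClass.coe_mul, hp, map_pow, MvPolynomial.aeval_X, mono_pow, coe_mono,
        AddMonoidAlgebra.single_mul_single, Finset.sum_insert hi, mul_one]
      congr 2
      ext j
      by_cases h : j = i
      · subst h; simp
      · simp [h]
  have hs : Function.Surjective φ := by
    intro f
    have h2 : ∀ T : Finset (Fin R → ℤ), T ⊆ f.1.coeff.support → ∃ p, (φ p : Laurent R) =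
        ∑ e ∈ T, AddMonoidAlgebra.single e (f.1.coeff e) := by
      classical
      intro T
      induction T using Finset.induction_on with
      | empty => intro _; exact ⟨0, by rw [map_zero]; rfl⟩
      | insert e T he ih =>
        intro hT
        obtain ⟨p, hp⟩ := ih fun x hx => hT (Finset.mem_insert_of_mem hx)
        obtain ⟨q, hq⟩ := h1 (fun i => (e i).toNat) Finset.univ
        refine ⟨f.1.coeff e • q + p, ?_⟩
        have he0 : ∑ i, Pi.single i (((e i).toNat : ℕ) : ℤ) = e := by
          rw [Finset.univ_sum_single]
          funext i
          exact Int.toNat_of_nonneg (f.2 e (hT (Finset.mem_insert_self _ _)) i (by simp))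
        rw [he0] at hq
        rw [map_add, map_smul, AddMemClass.coe_add, hp, SetLike.val_smul, hq,
          Finset.sum_insert he, AddMonoidAlgebra.smul_single, smul_eq_mul, mul_one]
    obtain ⟨p, hp⟩ := h2 _ (Finset.Subset.refl _)
    exact ⟨p, Subtype.ext (hp.trans (eq_sum_single f.1).symm)⟩
  exact isNoetherianRing_of_surjective _ _ φ.toRingHom hs

/-- Every ideal of the localization is extended from its contraction. -/
lemma IsAway.isNoetherianRing {A A' : Type} [CommRing A] [CommRing A'] {g : A →+* A'} {x : A}
    (hg : IsAway g x) [IsNoetherianRing A] : IsNoetherianRing A' := by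
  rw [isNoetherianRing_iff_ideal_fg]
  intro I
  have : (I.comap g).map g = I := by
    refine le_antisymm Ideal.map_comap_le fun a ha => ?_
    obtain ⟨n, b, hb⟩ := hg.surj a
    rw [← hg.mul_pow_mem_iff n, hb]
    refine Ideal.mem_map_of_mem _ ?_
    rw [Ideal.mem_comap, ← hb]
    exact Ideal.mul_mem_right _ _ ha
  rw [← this]
  exact ((isNoetherianRing_iff_ideal_fg _).1 inferInstance _).map g

/-- The exponent vector of `∏_{i ∈ I} x_i`. -/
def indicator (I : Finset (Fin R)) : Fin R → ℤ := fun i => if i ∈ I then 1 else 0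

lemma indicator_nonneg (I : Finset (Fin R)) (i : Fin R) : 0 ≤ indicator I i := by
  unfold indicator
  split_ifs <;> simp

lemma isAway_coxIncl_empty (I : Finset (Fin R)) :
    IsAway (coxIncl (Finset.empty_subset I)).toRingHom
      (mono ∅ (indicator I) fun i _ => indicator_nonneg I i) :=
  isAway_coxIncl _ (fun i _ hi => by simp [indicator, hi]) _ fun i hi => by simp [indicator, hi]

instance isNoetherianRing_coxChart (I : Finset (Fin R)) : IsNoetherianRing (coxChart R I) :=
  (isAway_coxIncl_empty I).isNoetherianRing

end Laurent


/-! ### The grading of Laurent polynomials by a degree of exponents -/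

section Grading

open GITData

variable {R : ℕ} {Λ : Type} [AddCommGroup Λ] (deg : (Fin R → ℤ) →+ Λ)

open Classical in
/-- The component of degree `χ` of a Laurent polynomial. -/
def laurentProj (χ : Λ) : Laurent R →+ Laurent R where
  toFun f := AddMonoidAlgebra.ofCoeff (f.coeff.filter fun e => deg e = χ)
  map_zero' := congrArg AddMonoidAlgebra.ofCoeff (Finsupp.filter_zero _)
  map_add' f g := by
    rw [AddMonoidAlgebra.coeff_add, Finsupp.filter_add, AddMonoidAlgebra.ofCoeff_add]

lemma coeff_laurentProj (χ : Λ) (f : Laurent R) :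
    open Classical in
    (laurentProj deg χ f).coeff = f.coeff.filter fun e => deg e = χ := rfl

lemma laurentProj_single_of_eq {χ : Λ} {e : Fin R → ℤ} (h : deg e = χ) (c : ℂ) :
    laurentProj deg χ (AddMonoidAlgebra.single e c) = AddMonoidAlgebra.single e c := by
  classical
  refine AddMonoidAlgebra.coeff_injective ?_
  rw [coeff_laurentProj, AddMonoidAlgebra.coeff_single, Finsupp.filter_single_of_pos (fun e => deg e = χ) h]

lemma laurentProj_single_of_ne {χ : Λ} {e : Fin R → ℤ} (h : deg e ≠ χ) (c : ℂ) :
    laurentProj deg χ (AddMonoidAlgebra.single e c) = 0 := by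
  classical
  refine AddMonoidAlgebra.coeff_injective ?_
  rw [coeff_laurentProj, AddMonoidAlgebra.coeff_single, Finsupp.filter_single_of_neg (fun e => deg e = χ) h]
  rfl

lemma laurentProj_eq_self_iff {χ : Λ} {f : Laurent R} :
    laurentProj deg χ f = f ↔ ∀ e ∈ f.coeff.support, deg e = χ := by
  classical
  rw [← AddMonoidAlgebra.coeff_inj, coeff_laurentProj, Finsupp.filter_eq_self_iff]
  simp only [Finsupp.mem_support_iff]

lemma laurentProj_proj (χ : Λ) (f : Laurent R) :
    laurentProj deg χ (laurentProj deg χ f) = laurentProj deg χ f := by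
  classical
  rw [laurentProj_eq_self_iff, coeff_laurentProj]
  intro e he
  rw [Finsupp.support_filter] at he
  exact (Finset.mem_filter.1 he).2

lemma laurentProj_mul (χ ψ : Λ) (f g : Laurent R) (hg : laurentProj deg ψ g = g) :
    laurentProj deg χ (f * g) = laurentProj deg (χ - ψ) f * g := by
  rw [laurentProj_eq_self_iff] at hg
  rw [eq_sum_single f, eq_sum_single g]
  simp only [map_sum, Finset.sum_mul_sum]
  refine Finset.sum_congr rfl fun e _ => ?_
  refine Finset.sum_congr rfl fun e' he' => ?_
  rw [AddMonoidAlgebra.single_mul_single]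
  by_cases h : deg e = χ - ψ
  · rw [laurentProj_single_of_eq deg h, laurentProj_single_of_eq,
      AddMonoidAlgebra.single_mul_single]
    rw [map_add, h, hg e' he', sub_add_cancel]
  · rw [laurentProj_single_of_ne deg h, zero_mul, laurentProj_single_of_ne]
    rw [map_add, hg e' he']
    exact fun h' => h (eq_sub_of_add_eq h')

lemma laurentProj_mem_coxChart {I : Finset (Fin R)} (χ : Λ) {f : Laurent R}
    (hf : f ∈ coxChart R I) : laurentProj deg χ f ∈ coxChart R I := by
  classical
  intro e he
  rw [coeff_laurentProj, Finsupp.support_filter] at he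
  exact hf e (Finset.mem_filter.1 he).1

/-- The grading of the ring of functions on `(ℂˣ)^I × ℂ^{[R] ∖ I}` by a degree function on
exponent vectors. -/
def coxProj (I : Finset (Fin R)) : DegreeProj (coxChart R I) Λ where
  proj χ :=
    { toFun f := ⟨laurentProj deg χ f.1, laurentProj_mem_coxChart deg χ f.2⟩
      map_zero' := by
        ext1
        exact map_zero _
      map_add' f g := by
        ext1
        exact map_add _ _ _ }
  proj_proj χ f := Subtype.ext (laurentProj_proj deg χ f.1)
  proj_mul χ ψ f g hg := Subtype.ext (laurentProj_mul deg χ ψ f.1 g.1 (congrArg Subtype.val hg))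
  exists_sum f := by
    classical
    refine ⟨f.1.coeff.support.image deg, fun χ hχ => ?_, ?_⟩
    · ext1
      refine AddMonoidAlgebra.coeff_injective ?_
      change (laurentProj deg χ f.1).coeff = 0
      rw [coeff_laurentProj, Finsupp.filter_eq_zero_iff]
      intro e he
      by_contra hne
      exact hχ (Finset.mem_image.2 ⟨e, Finsupp.mem_support_iff.2 hne, he⟩)
    · ext1
      rw [AddSubmonoidClass.coe_finsetSum]
      change f.1 = ∑ χ ∈ _, laurentProj deg χ f.1
      refine AddMonoidAlgebra.coeff_injective (Finsupp.ext fun e => ?_)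
      rw [AddMonoidAlgebra.coeff_sum, Finsupp.finsetSum_apply]
      simp only [coeff_laurentProj, Finsupp.filter_apply]
      by_cases he : f.1.coeff e = 0
      · simp [he]
      · rw [Finset.sum_ite_eq, if_pos]
        exact Finset.mem_image_of_mem _ (Finsupp.mem_support_iff.2 he)

lemma coe_coxProj (I : Finset (Fin R)) (χ : Λ) (f : coxChart R I) :
    ((coxProj deg I).proj χ f : Laurent R) = laurentProj deg χ f := rfl

lemma coxProj_eq_self_iff {I : Finset (Fin R)} {χ : Λ} {f : coxChart R I} :
    (coxProj deg I).proj χ f = f ↔ ∀ e ∈ f.1.coeff.support, deg e = χ := by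
  rw [← laurentProj_eq_self_iff, ← coe_coxProj, Subtype.ext_iff]

end Grading

/-! ### Charts of `Y` as degree-zero parts of Cox charts -/

lemma isAway_of_isLocalization {A A' : Type} [CommRing A] [CommRing A'] {g : A →+* A'} {x : A}
    (h : @IsLocalization.Away A _ x A' _ g.toAlgebra) (hg : Function.Injective g) :
    IsAway g x := by
  algebraize [g]
  refine ⟨IsLocalization.Away.algebraMap_isUnit (S := A') x, fun a => ?_, hg⟩
  obtain ⟨n, b, hb⟩ := IsLocalization.Away.surj x a
  exact ⟨n, b, hb⟩

namespace GITData

variable {𝕃 : Type} [AddCommGroup 𝕃] {R : ℕ} (Θ : GITData 𝕃 R)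

/-- The character `∑ e_i D_i` with which `K` acts on the monomial `x^e`. -/
def degree : (Fin R → ℤ) →+ Module.Dual ℤ 𝕃 where
  toFun e := ∑ i, e i • Θ.D i
  map_zero' := by simp
  map_add' e e' := by simp [add_smul, Finset.sum_add_distrib]

lemma degree_apply (e : Fin R → ℤ) : Θ.degree e = ∑ i, e i • Θ.D i := rfl

lemma degree_exponent (m : Module.Dual ℤ Θ.N) : Θ.degree (Θ.exponent m) = 0 := Θ.relation m

lemma exponent_injective : Function.Injective Θ.exponent := by
  intro m m' h
  refine Submodule.linearMap_qext _ (LinearMap.pi_ext' fun i => LinearMap.ext_ring ?_)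
  exact congrFun h i

lemma exponent_ofRelation (z : Fin R → ℤ) (hz : ∑ i, z i • Θ.D i = 0) :
    Θ.exponent (Θ.ofRelation z hz) = z := funext fun i => Θ.ofRelation_ρ z hz i

lemma mem_dualMonoid_cone_iff {I : Finset (Fin R)} {m : Module.Dual ℤ Θ.N} :
    m ∈ dualMonoid (Θ.cone I) ↔ ∀ i, i ∉ I → 0 ≤ m (Θ.ρ i) := by
  constructor
  · intro hm i hi
    exact Θ.exponent_nonneg ⟨m, hm⟩ i hi
  · intro hm x hx
    obtain ⟨d, h1, h2, rfl⟩ := Θ.exists_of_mem_cone hx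
    rw [pair_sum]
    refine Finset.sum_nonneg fun i _ => ?_
    by_cases hi : i ∈ I
    · rw [h2 i hi, zero_mul]
    · exact mul_nonneg (h1 i) (by exact_mod_cast hm i hi)

lemma chartHom_single (I : Finset (Fin R)) (m : dualMonoid (Θ.cone I)) (c : ℂ) :
    (Θ.chartHom I (AddMonoidAlgebra.single m c) : Laurent R) =
      AddMonoidAlgebra.single (Θ.exponent m.1) c := by
  simp [chartHom]

lemma coe_chartHom (I : Finset (Fin R)) (b : coordRing (Θ.cone I)) :
    (Θ.chartHom I b : Laurent R) = AddMonoidAlgebra.mapDomain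
      (Θ.exponent.comp (dualMonoid (Θ.cone I)).subtype) b := rfl

lemma chartHom_injective (I : Finset (Fin R)) : Function.Injective (Θ.chartHom I) := by
  intro a b h
  refine AddMonoidAlgebra.mapDomain_injective (f := Θ.exponent.comp (dualMonoid (Θ.cone I)).subtype)
    (fun m m' h' => Subtype.ext (Θ.exponent_injective h')) ?_
  rw [← coe_chartHom, ← coe_chartHom, h]

lemma proj_chartHom (I : Finset (Fin R)) (b : coordRing (Θ.cone I)) :
    (coxProj Θ.degree I).proj 0 (Θ.chartHom I b) = Θ.chartHom I b := by
  induction b using AddMonoidAlgebra.induction_linear with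
  | zero => simp
  | add f g hf hg => rw [map_add, map_add, hf, hg]
  | single m c =>
    ext1
    rw [coe_coxProj, chartHom_single, laurentProj_single_of_eq _ (Θ.degree_exponent _)]

/-- With `chartHom_injective` and `proj_chartHom`, this identifies the ring of `U_σ` with the
invariants of `K`: an exponent vector of degree zero is a relation among the `D_i`, that is, a
character in `M`. -/
lemma exists_chartHom_eq {I : Finset (Fin R)} {f : coxChart R I}
    (hf : (coxProj Θ.degree I).proj 0 f = f) : ∃ b, Θ.chartHom I b = f := by
  rw [coxProj_eq_self_iff] at hf
  have h1 : ∀ T : Finset (Fin R → ℤ), T ⊆ f.1.coeff.support → ∃ b, (Θ.chartHom I b : Laurent R) =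
      ∑ e ∈ T, AddMonoidAlgebra.single e (f.1.coeff e) := by
    classical
    intro T
    induction T using Finset.induction_on with
    | empty => intro _; exact ⟨0, by rw [map_zero]; rfl⟩
    | insert e T he ih =>
      intro hT
      obtain ⟨b, hb⟩ := ih fun x hx => hT (Finset.mem_insert_of_mem hx)
      have heT := hT (Finset.mem_insert_self e T)
      have hdeg : ∑ i, e i • Θ.D i = 0 := hf e heT
      have hm : Θ.ofRelation e hdeg ∈ dualMonoid (Θ.cone I) := by
        rw [mem_dualMonoid_cone_iff]
        intro i hi
        rw [ofRelation_ρ]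
        exact f.2 e heT i hi
      refine ⟨AddMonoidAlgebra.single ⟨_, hm⟩ (f.1.coeff e) + b, ?_⟩
      rw [map_add, AddMemClass.coe_add, hb, chartHom_single, exponent_ofRelation,
        Finset.sum_insert he]
  obtain ⟨b, hb⟩ := h1 _ (Finset.Subset.refl _)
  exact ⟨b, Subtype.ext (hb.trans (eq_sum_single f.1).symm)⟩

/-- The difference of two positive expressions of `ω` is a relation among the `D_i`. With
denominators cleared it is a character separating the cones of `I` and `J`. -/
lemma exists_dual_of_covers {I J : Finset (Fin R)} (hI : I ∈ Θ.covers) (hJ : J ∈ Θ.covers) :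
    ∃ m : Module.Dual ℤ Θ.N, (∀ i, i ∉ I → 0 ≤ m (Θ.ρ i)) ∧ (∀ i, i ∉ I → i ∈ J → 0 < m (Θ.ρ i)) ∧
      ∀ i, i ∉ J → m (Θ.ρ i) ≤ 0 := by
  classical
  obtain ⟨a, ha, haω⟩ := hI
  obtain ⟨b, hb, hbω⟩ := hJ
  obtain ⟨n, m, hn, hm⟩ := Θ.exists_dual
    (fun i => (if i ∈ J then b i else 0) - (if i ∈ I then a i else 0)) (by
      simp only [sub_smul, ite_smul, zero_smul, Finset.sum_sub_distrib, Finset.sum_ite_mem,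
        Finset.univ_inter]
      rw [← haω, ← hbω, sub_self])
  have hn' : (0 : ℚ) < n := by exact_mod_cast hn
  refine ⟨m, fun i hi => ?_, fun i hi hj => ?_, fun i hi => ?_⟩
  · have : (0 : ℚ) ≤ (m (Θ.ρ i) : ℚ) := by
      rw [hm, if_neg hi, sub_zero]
      split_ifs with h
      · exact mul_nonneg hn'.le (hb i h).le
      · simp
    exact_mod_cast this
  · have : (0 : ℚ) < (m (Θ.ρ i) : ℚ) := by
      rw [hm, if_neg hi, sub_zero, if_pos hj]
      exact mul_pos hn' (hb i hj)
    exact_mod_cast this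
  · have : (m (Θ.ρ i) : ℚ) ≤ 0 := by
      rw [hm, if_neg hi, zero_sub]
      split_ifs with h
      · exact mul_nonpos_of_nonneg_of_nonpos hn'.le (neg_nonpos.2 (ha i h).le)
      · simp
    exact_mod_cast this

lemma cone_anti {I J : Finset (Fin R)} (h : I ⊆ J) : Θ.cone J ≤ Θ.cone I :=
  Submodule.span_mono (Set.image_mono fun _ hi hI => hi (h hI))

lemma mem_cone_iff_of_dual {I J : Finset (Fin R)} {m : Module.Dual ℤ Θ.N}
    (h0 : ∀ i, i ∉ I → 0 ≤ m (Θ.ρ i)) (h1 : ∀ i, i ∉ I → i ∈ J → 0 < m (Θ.ρ i))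
    {x : ℚ ⊗[ℤ] Θ.N} (hx : x ∈ Θ.cone I) (hm : pair m x ≤ 0) : x ∈ Θ.cone (I ∪ J) := by
  obtain ⟨d, hd, hdI, rfl⟩ := Θ.exists_of_mem_cone hx
  rw [pair_sum] at hm
  have hnn : ∀ i ∈ Finset.univ, 0 ≤ d i * (m (Θ.ρ i) : ℚ) := by
    intro i _
    by_cases hi : i ∈ I
    · rw [hdI i hi, zero_mul]
    · exact mul_nonneg (hd i) (by exact_mod_cast h0 i hi)
  have h3 := (Finset.sum_eq_zero_iff_of_nonneg hnn).1 (le_antisymm hm (Finset.sum_nonneg hnn))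
  refine Θ.sum_mem_cone hd fun i hi => ?_
  by_cases hiI : i ∈ I
  · exact hdI i hiI
  · refine (mul_eq_zero.1 (h3 i (Finset.mem_univ i))).resolve_right ?_
    exact_mod_cast (h1 i hiI ((Finset.mem_union.1 hi).resolve_left hiI)).ne'

/-- The separating character is nonnegative on the first cone and nonpositive on the second, hence
zero on the intersection; this forces the coefficients at `J ∖ I` to vanish. -/
lemma cone_inf_cone {I J : Finset (Fin R)} (hI : I ∈ Θ.covers) (hJ : J ∈ Θ.covers) :
    Θ.cone I ⊓ Θ.cone J = Θ.cone (I ∪ J) := by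
  refine le_antisymm ?_ (le_inf (Θ.cone_anti Finset.subset_union_left)
    (Θ.cone_anti Finset.subset_union_right))
  rintro x ⟨hxI, hxJ⟩
  obtain ⟨m, h0, h1, h2⟩ := Θ.exists_dual_of_covers hI hJ
  refine Θ.mem_cone_iff_of_dual h0 h1 hxI ?_
  obtain ⟨d, hd, hdJ, rfl⟩ := Θ.exists_of_mem_cone hxJ
  rw [pair_sum]
  refine Finset.sum_nonpos fun i _ => ?_
  by_cases hi : i ∈ J
  · rw [hdJ i hi, zero_mul]
  · exact mul_nonpos_of_nonneg_of_nonpos (hd i) (by exact_mod_cast h2 i hi)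

/-- For `I ⊆ J`, a monomial of degree zero inverting which turns the chart of `I` into that of
`J`. -/
lemma exists_isAway {I J : Finset (Fin R)} (hI : I ∈ Θ.covers) (hJ : J ∈ Θ.covers) (h : I ⊆ J) :
    ∃ m : dualMonoid (Θ.cone I),
      IsAway (restrictHom (Θ.cone_anti h)).toRingHom (AddMonoidAlgebra.single m 1) ∧
      IsAway (coxIncl h).toRingHom (Θ.chartHom I (AddMonoidAlgebra.single m 1)) := by
  obtain ⟨m, h0, h1, h2⟩ := Θ.exists_dual_of_covers hI hJ
  have hm : m ∈ dualMonoid (Θ.cone I) := Θ.mem_dualMonoid_cone_iff.2 h0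
  have h3 : ∀ i, i ∉ J → m (Θ.ρ i) = 0 := fun i hi =>
    le_antisymm (h2 i hi) (h0 i fun hI => hi (h hI))
  refine ⟨⟨m, hm⟩, ?_, ?_⟩
  · have hface : ∀ x, x ∈ Θ.cone J ↔ x ∈ Θ.cone I ∧ pair m x = 0 := by
      intro x
      constructor
      · intro hx
        refine ⟨Θ.cone_anti h hx, ?_⟩
        obtain ⟨d, hd, hdJ, rfl⟩ := Θ.exists_of_mem_cone hx
        rw [pair_sum]
        refine Finset.sum_eq_zero fun i _ => ?_
        by_cases hi : i ∈ J
        · rw [hdJ i hi, zero_mul]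
        · rw [h3 i hi, Int.cast_zero, mul_zero]
      · rintro ⟨hx, hx0⟩
        have := Θ.mem_cone_iff_of_dual h0 h1 hx hx0.le
        rwa [Finset.union_eq_right.2 h] at this
    refine isAway_of_isLocalization (isLocalization_restrictHom (Submodule.fg_span (Set.toFinite _))
      (Θ.cone_anti h) hm hface) (AddMonoidAlgebra.mapDomain_injective ?_)
    exact AddSubmonoid.inclusion_injective _
  · have := isAway_coxIncl h (m := Θ.exponent m) (fun i hi hj => h1 i hi hj) h0 h3
    convert this using 1
    exact Subtype.ext (Θ.chartHom_single I ⟨m, hm⟩ 1)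

end GITData


/-! ### Zero loci and the family in the charts -/

namespace GITData

open Polynomial

variable {𝕃 : Type} [AddCommGroup 𝕃] {R : ℕ} (Θ : GITData 𝕃 R) {k : ℕ}
  {χ : Fin k → Module.Dual ℤ 𝕃}

/-- The sections `s_1, …, s_k` as functions on `(ℂˣ)^I × ℂ^{[R] ∖ I}`. -/
def localSection (s : ∀ j, Θ.sections (χ j)) (I : Θ.covers) (j : Fin k) : coxChart R I.1 :=
  ⟨(s j).1, (s j).2.1 I.1 I.2⟩

/-- Only points of the zero locus are tested, where the germs lie in the maximal ideal. So the
properness clause of regularity is automatic and weak regularity remains. -/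
lemma isRegularSection_iff (s : ∀ j, Θ.sections (χ j)) : Θ.IsRegularSection s ↔
    ∀ (I : Θ.covers) (p : Ideal (coxChart R I.1)), p.IsPrime → (∀ j, Θ.localSection s I j ∈ p) →
      IsWeaklyRegularAt (Θ.localSection s I) p := by
  refine forall_congr' fun I => forall_congr' fun p => forall_congr' fun hp => ?_
  have h1 : Θ.coxIdeal s I ≤ p ↔ ∀ j, Θ.localSection s I j ∈ p := by
    rw [coxIdeal, Ideal.span_le, Set.range_subset_iff]
    rfl
  rw [h1]
  refine forall_congr' fun h => ?_
  rw [← isWeaklyRegular_atPrime_iff]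
  refine ⟨fun H => H.1, fun H => ?_⟩
  refine RingTheory.Sequence.IsRegular.of_isWeaklyRegular_of_mem_maximalIdeal _ ?_ H
  intro r hr
  obtain ⟨j, rfl⟩ := List.mem_ofFn.1 hr
  exact (IsLocalization.AtPrime.to_map_mem_maximal_iff _ p _).2 (h j)

lemma proj_localSection (s : ∀ j, Θ.sections (χ j)) (I : Θ.covers) (j : Fin k) :
    (coxProj Θ.degree I.1).proj (χ j) (Θ.localSection s I j) = Θ.localSection s I j :=
  (coxProj_eq_self_iff _).2 (s j).2.2

lemma map_coxIdeal (s : ∀ j, Θ.sections (χ j)) {I J : Θ.covers} (h : I.1 ⊆ J.1) :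
    (Θ.coxIdeal s I).map (coxIncl h).toRingHom = Θ.coxIdeal s J := by
  rw [coxIdeal, Ideal.map_span, ← Set.range_comp]
  rfl

lemma chartHom_restrictHom {I J : Finset (Fin R)} (h : I ⊆ J) (b : coordRing (Θ.cone I)) :
    Θ.chartHom J (restrictHom (Θ.cone_anti h) b) = coxIncl h (Θ.chartHom I b) := by
  induction b using AddMonoidAlgebra.induction_linear with
  | zero => simp
  | add f g hf hg => rw [map_add, map_add, hf, hg, map_add, map_add]
  | single m c =>
    ext1
    rw [restrictHom_single, chartHom_single]
    exact (Θ.chartHom_single I m c).symm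

lemma map_chartIdeal (s : ∀ j, Θ.sections (χ j)) {I J : Θ.covers} (h : I.1 ⊆ J.1) :
    (Θ.chartIdeal s I).map (restrictHom (Θ.cone_anti h)).toRingHom = Θ.chartIdeal s J := by
  obtain ⟨m, h1, h2⟩ := Θ.exists_isAway I.2 J.2 h
  have := h2.map_comap h1 (φ := (Θ.chartHom I.1).toRingHom) (φ' := (Θ.chartHom J.1).toRingHom)
    (Θ.chartHom_restrictHom h) rfl (Θ.coxIdeal s I)
  rw [map_coxIdeal] at this
  exact this

/-- The pencil `(1 - X) a + X b` of sections, as functions on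
`((ℂˣ)^I × ℂ^{[R] ∖ I}) × 𝔸¹`. -/
def pencilSection (a b : ∀ j, Θ.sections (χ j)) (I : Θ.covers) (j : Fin k) :
    (coxChart R I.1)[X] :=
  C (Θ.localSection a I j) + C (Θ.localSection b I j - Θ.localSection a I j) * X

lemma evalAt_pencilSection (a b : ∀ j, Θ.sections (χ j)) (I : Θ.covers) (j : Fin k) (t : ℂ) :
    evalAt _ t (Θ.pencilSection a b I j) =
      Θ.localSection (fun j => (1 - t) • a j + t • b j) I j := by
  have h : Θ.localSection (fun j => (1 - t) • a j + t • b j) I j =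
      (1 - t) • Θ.localSection a I j + t • Θ.localSection b I j := rfl
  rw [h, pencilSection, evalAt, map_add, map_mul, coe_evalRingHom, eval_C, eval_C, eval_X, sub_smul,
    one_smul, sub_mul, Algebra.smul_def, Algebra.smul_def]
  ring

lemma proj_pencilSection (a b : ∀ j, Θ.sections (χ j)) (I : Θ.covers) (j : Fin k) :
    (coxProj Θ.degree I.1).polynomial.proj (χ j) (Θ.pencilSection a b I j) =
      Θ.pencilSection a b I j := by
  ext1 n
  rw [DegreeProj.polynomial_proj_coeff, pencilSection]
  simp only [coeff_add, coeff_C, coeff_C_mul_X]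
  split_ifs <;> simp [proj_localSection]

/-- The ideal of the family over `𝔸¹` in `U_{σ_I} × 𝔸¹`: the closure of the zero locus of the pencil
over the generic point of `𝔸¹`. -/
def familyIdeal (a b : ∀ j, Θ.sections (χ j)) (I : Θ.covers) : Ideal (coordRing (Θ.cone I.1))[X] :=
  (torsionClosure (Ideal.span (Set.range (Θ.pencilSection a b I)))).comap
    (mapRingHom (Θ.chartHom I.1).toRingHom)

lemma map_familyIdeal (a b : ∀ j, Θ.sections (χ j)) {I J : Θ.covers} (h : I.1 ⊆ J.1) :
    (Θ.familyIdeal a b I).map (mapRingHom (restrictHom (Θ.cone_anti h)).toRingHom) =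
      Θ.familyIdeal a b J := by
  obtain ⟨m, h1, h2⟩ := Θ.exists_isAway I.2 J.2 h
  have := h2.polynomial.map_comap h1.polynomial (φ := mapRingHom (Θ.chartHom I.1).toRingHom)
    (φ' := mapRingHom (Θ.chartHom J.1).toRingHom) (fun f => by
      simp only [coe_mapRingHom, Polynomial.map_map]
      congr 1
      exact RingHom.ext (Θ.chartHom_restrictHom h)) (by simp)
    (torsionClosure (Ideal.span (Set.range (Θ.pencilSection a b I))))
  rw [h2.map_torsionClosure (coxIncl h).comp_algebraMap, Ideal.map_span, ← Set.range_comp] at this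
  have e : (mapRingHom (coxIncl h).toRingHom) ∘ Θ.pencilSection a b I = Θ.pencilSection a b J := by
    funext j
    simp only [Function.comp_apply, pencilSection, coe_mapRingHom, Polynomial.map_add,
      Polynomial.map_mul, map_C, map_X]
    rfl
  rw [e] at this
  exact this

/-- One inclusion is the absence of torsion over `t`. The other lifts an element of the ideal of the
fibre to a combination of the pencil with coefficients constant in `X`; the coefficients must be
chosen homogeneous so that the lift has degree zero and descends to `Y`. -/
lemma map_evalAt_familyIdeal (a b : ∀ j, Θ.sections (χ j)) (t : ℂ)
    (ht : Θ.IsRegularSection fun j => (1 - t) • a j + t • b j) (I : Θ.covers) :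
    (Θ.familyIdeal a b I).map (evalAt _ t) =
      Θ.chartIdeal (fun j => (1 - t) • a j + t • b j) I := by
  have hev : ∀ f : (coordRing (Θ.cone I.1))[X], evalAt _ t (mapRingHom (Θ.chartHom I.1).toRingHom f) =
      Θ.chartHom I.1 (evalAt _ t f) := by
    intro f
    rw [coe_mapRingHom, evalAt, coe_evalRingHom, ← (Θ.chartHom I.1).commutes t]
    exact eval_map_apply _ _
  apply le_antisymm
  · rw [Ideal.map_le_iff_le_comap]
    intro f hf
    rw [isRegularSection_iff] at ht
    have h1 := evalAt_mem_of_mem_torsionClosure (r := Θ.pencilSection a b I) (t := t)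
      (by simpa only [evalAt_pencilSection] using ht I) hf
    simp only [evalAt_pencilSection] at h1
    rw [hev] at h1
    exact h1
  · intro f hf
    obtain ⟨c, hc⟩ := (Ideal.mem_span_range_iff_exists_fun).1
      (show Θ.chartHom I.1 f ∈ Θ.coxIdeal _ I from hf)
    -- Only the component of `c j` of degree `-χ j` contributes to a function of degree zero, so the
    -- other components are dropped.
    let q : (coxChart R I.1)[X] :=
      ∑ j, C ((coxProj Θ.degree I.1).proj (0 - χ j) (c j)) * Θ.pencilSection a b I j
    have hq : evalAt _ t q = Θ.chartHom I.1 f := by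
      rw [← Θ.proj_chartHom, ← hc, map_sum, map_sum]
      refine Finset.sum_congr rfl fun j _ => ?_
      rw [map_mul, evalAt_C, evalAt_pencilSection]
      exact ((coxProj Θ.degree I.1).proj_mul _ _ _ _ (Θ.proj_localSection _ I j)).symm
    have hq0 : (coxProj Θ.degree I.1).polynomial.proj 0 q = q := by
      rw [map_sum]
      refine Finset.sum_congr rfl fun j _ => ?_
      rw [DegreeProj.proj_mul _ _ _ _ _ (Θ.proj_pencilSection a b I j)]
      congr 1
      ext1 n
      rw [DegreeProj.polynomial_proj_coeff, coeff_C]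
      split_ifs
      · exact DegreeProj.proj_proj _ _ _
      · exact map_zero _
    obtain ⟨g, hg⟩ : ∃ g : (coordRing (Θ.cone I.1))[X], g.map (Θ.chartHom I.1).toRingHom = q := by
      rw [← mem_lifts, lifts_iff_coeff_lifts]
      intro n
      refine Θ.exists_chartHom_eq ?_
      rw [← DegreeProj.polynomial_proj_coeff, hq0]
    have h1 : evalAt _ t g = f := by
      apply Θ.chartHom_injective
      rw [← hev, coe_mapRingHom, hg, hq]
    rw [← h1]
    refine Ideal.mem_map_of_mem _ ?_
    refine le_torsionClosure _ ?_
    rw [coe_mapRingHom, hg]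
    exact sum_mem fun j _ => Ideal.mul_mem_left _ _ (Ideal.subset_span ⟨j, rfl⟩)

lemma mem_familyIdeal_of_mul_mem (a b : ∀ j, Θ.sections (χ j)) (I : Θ.covers) {f : ℂ[X]}
    (hf : f ≠ 0) {g : (coordRing (Θ.cone I.1))[X]}
    (h : mapRingHom (algebraMap ℂ (coordRing (Θ.cone I.1))) f * g ∈ Θ.familyIdeal a b I) :
    g ∈ Θ.familyIdeal a b I := by
  refine mem_torsionClosure_of_mul_mem hf ?_
  rw [familyIdeal, Ideal.mem_comap, map_mul] at h
  convert h using 2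
  rw [coe_mapRingHom, coe_mapRingHom, Polynomial.map_map]
  congr 1
  exact ((Θ.chartHom I.1).comp_algebraMap).symm

end GITData


/-! ### Gluing the zero locus and the family -/

lemma Fan.isPullback_chart_of_eq {N : Type} [AddCommGroup N] (F : Fan N)
    {σ τ υ : PointedCone ℚ (ℚ ⊗[ℤ] N)} (hσ : σ ∈ F.cones) (hτ : τ ∈ F.cones) (h : σ ⊓ τ = υ)
    (h₁ : υ ≤ σ) (h₂ : υ ≤ τ) :
    IsPullback (Fan.incl h₁) (Fan.incl h₂) (F.chart σ hσ) (F.chart τ hτ) := by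
  subst h
  exact F.isPullback_chart hσ hτ

namespace GITData

variable {𝕃 : Type} [AddCommGroup 𝕃] {R : ℕ} (Θ : GITData 𝕃 R) {k : ℕ}
  {χ : Fin k → Module.Dual ℤ 𝕃} (h : Θ.IsOrbifold)

/-- The chart of `Y` of a set `I` that covers `ω`. -/
abbrev coverChart (I : Θ.covers) : Spec (CommRingCat.of (coordRing (Θ.cone I.1))) ⟶ Θ.Y h :=
  (Θ.fan h).chart (Θ.cone I.1) ⟨I.1, I.2, rfl⟩

instance isOpenImmersion_coverChart (I : Θ.covers) : IsOpenImmersion (Θ.coverChart h I) :=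
  (Θ.fan h).isOpenImmersion_chart _ _

instance quasiCompact_coverChart (I : Θ.covers) : QuasiCompact (Θ.coverChart h I) :=
  (Θ.fan h).quasiCompact_chart _ _

lemma exists_mem_range_coverChart (y : Θ.Y h) : ∃ I, y ∈ Set.range (Θ.coverChart h I) := by
  obtain ⟨_, ⟨I, hI, rfl⟩, hy⟩ := (Θ.fan h).exists_mem_range_chart y
  exact ⟨⟨I, hI⟩, hy⟩

lemma coverChart_structureMap (I : Θ.covers) : Θ.coverChart h I ≫ (Θ.fan h).structureMap =
    Spec.map (CommRingCat.ofHom (algebraMap ℂ (coordRing (Θ.cone I.1)))) :=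
  (Θ.fan h).chart_structureMap _ _

/-- The union of two sets that cover `ω`. -/
def unionCover {Θ : GITData 𝕃 R} (h : Θ.IsOrbifold) (I J : Θ.covers) : Θ.covers :=
  ⟨I.1 ∪ J.1, covers_mono h I.2 Finset.subset_union_left⟩

lemma isPullback_coverChart (I J : Θ.covers) :
    IsPullback (Fan.incl (Θ.cone_anti (Finset.subset_union_left : I.1 ⊆ (unionCover h I J).1)))
      (Fan.incl (Θ.cone_anti (Finset.subset_union_right : J.1 ⊆ (unionCover h I J).1)))
      (Θ.coverChart h I) (Θ.coverChart h J) :=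
  (Θ.fan h).isPullback_chart_of_eq _ _ (Θ.cone_inf_cone I.2 J.2) _ _

lemma comap_zeroIdeal (s : ∀ j, Θ.sections (χ j)) (I : Θ.covers) :
    (Θ.zeroIdeal h s).comap (Θ.coverChart h I) =
      specIdeal (R := CommRingCat.of (coordRing (Θ.cone I.1))) (Θ.chartIdeal s I) := by
  have h1 : Θ.zeroIdeal h s = ⨅ I : Θ.covers, (specIdeal
      (R := CommRingCat.of (coordRing (Θ.cone I.1))) (Θ.chartIdeal s I)).map (Θ.coverChart h I) := by
    refine iInf_congr fun I => ?_
    rw [specIdeal, Scheme.IdealSheafData.map_ker]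
  rw [h1]
  refine comap_iInf_map (fun I : Θ.covers => Θ.coverChart h I) _ (fun I J => ?_) I
  refine ⟨_, _, _, (Θ.isPullback_coverChart h I J).flip, ?_⟩
  rw [specIdeal_comap, specIdeal_comap]
  congr 1
  exact (Θ.map_chartIdeal s (J := unionCover h I J) Finset.subset_union_left).trans
    (Θ.map_chartIdeal s (J := unionCover h I J) Finset.subset_union_right).symm

/-- The chart of `Y × 𝔸¹` of a set `I` that covers `ω`. -/
abbrev coverLineChart (I : Θ.covers) :
    Spec (CommRingCat.of (Polynomial (coordRing (Θ.cone I.1)))) ⟶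
      timesLine (Θ.fan h).structureMap :=
  lineChart (Θ.fan h).structureMap (Θ.coverChart h I) (Θ.coverChart_structureMap h I)

instance isOpenImmersion_coverLineChart (I : Θ.covers) : IsOpenImmersion (Θ.coverLineChart h I) :=
  inferInstanceAs (IsOpenImmersion (lineChart _ (Θ.coverChart h I) _))

instance quasiCompact_coverLineChart (I : Θ.covers) : QuasiCompact (Θ.coverLineChart h I) :=
  inferInstanceAs (QuasiCompact (lineChart _ (Θ.coverChart h I) _))

/-- The ideal sheaf on `Y × 𝔸¹` of the family swept out by the zero loci of the sections
`(1 - t) a + t b`. -/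
def familySheaf (a b : ∀ j, Θ.sections (χ j)) :
    (timesLine (Θ.fan h).structureMap).IdealSheafData :=
  ⨅ I : Θ.covers, (specIdeal (R := CommRingCat.of (Polynomial (coordRing (Θ.cone I.1))))
    (Θ.familyIdeal a b I)).map (Θ.coverLineChart h I)

lemma comap_familySheaf (a b : ∀ j, Θ.sections (χ j)) (I : Θ.covers) :
    (Θ.familySheaf h a b).comap (Θ.coverLineChart h I) =
      specIdeal (R := CommRingCat.of (Polynomial (coordRing (Θ.cone I.1))))
        (Θ.familyIdeal a b I) := by
  refine comap_iInf_map (fun I : Θ.covers => Θ.coverLineChart h I) _ (fun I J => ?_) I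
  refine ⟨_, _, _, (isPullback_lineChart_inter _ _ _ _ _ _ _ ?_
    (Θ.isPullback_coverChart h I J)).flip, ?_⟩
  · exact (AlgHom.comp_algebraMap (restrictHom (Θ.cone_anti
      (Finset.subset_union_left : I.1 ⊆ (unionCover h I J).1)))).trans
      (AlgHom.comp_algebraMap (restrictHom (Θ.cone_anti Finset.subset_union_right))).symm
  rw [specIdeal_comap, specIdeal_comap]
  congr 1
  exact (Θ.map_familyIdeal a b (J := unionCover h I J) Finset.subset_union_left).trans
    (Θ.map_familyIdeal a b (J := unionCover h I J) Finset.subset_union_right).symm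

lemma comap_slice_familySheaf (a b : ∀ j, Θ.sections (χ j)) (t : ℂ)
    (ht : Θ.IsRegularSection fun j => (1 - t) • a j + t • b j) :
    (Θ.familySheaf h a b).comap (slice (Θ.fan h).structureMap (𝟙 _) t) =
      Θ.zeroIdeal h fun j => (1 - t) • a j + t • b j := by
  refine ext_of_comap_eq (fun I : Θ.covers => Θ.coverChart h I)
    (Θ.exists_mem_range_coverChart h) fun I => ?_
  rw [comap_zeroIdeal, ← Scheme.IdealSheafData.comap_comp,
    chart_slice _ _ (Θ.coverChart_structureMap h I), Scheme.IdealSheafData.comap_comp, comap_familySheaf, specIdeal_comap]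
  congr 1
  exact Θ.map_evalAt_familyIdeal a b t ht I

lemma isEmbeddedFiber_familySheaf (a b : ∀ j, Θ.sections (χ j)) (t : ℂ)
    (ht : Θ.IsRegularSection fun j => (1 - t) • a j + t • b j) :
    IsEmbeddedFiber (Θ.fan h).structureMap (Θ.familySheaf h a b).subschemeι t
      (Θ.zeroIdeal h fun j => (1 - t) • a j + t • b j).subschemeι := by
  refine isEmbeddedFiber_of_ker_eq _ _ t _ ?_
  rw [Scheme.IdealSheafData.ker_subschemeι, Θ.comap_slice_familySheaf h a b t ht]

lemma flat_familySheaf (a b : ∀ j, Θ.sections (χ j)) :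
    Flat ((Θ.familySheaf h a b).subschemeι ≫
      Limits.pullback.snd (Θ.fan h).structureMap affineLineMap) :=
  flat_subschemeι_snd _ _ (fun I : Θ.covers => coordRing (Θ.cone I.1)) (Θ.coverChart h)
    (Θ.exists_mem_range_coverChart h) (Θ.coverChart_structureMap h) (Θ.familyIdeal a b)
    (Θ.comap_familySheaf h a b) fun I _ hp _ hg => Θ.mem_familyIdeal_of_mul_mem a b I hp hg

end GITData


/-! ### The binomial sections form a regular sequence -/

open GITData

namespace ConvexPartition

variable {𝕃 : Type} [AddCommGroup 𝕃] {R : ℕ} {Θ : GITData 𝕃 R} {k : ℕ} (P : ConvexPartition Θ k)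

/-- A chosen element of `S_j`. -/
def pivot (j : Fin k) : Fin R := (P.S_nonempty j).choose

lemma pivot_mem (j : Fin k) : P.pivot j ∈ P.S j := (P.S_nonempty j).choose_spec

lemma expB_of_notMem {i : Fin R} (hi : i ∉ P.B) (j : Fin k) : P.expB j i = 0 := dif_neg hi

lemma expB_nonneg (j : Fin k) (i : Fin R) : 0 ≤ P.expB j i := by
  unfold expB
  split_ifs
  · exact P.l_nonneg _ j
  · exact le_rfl

lemma expS_nonneg (j : Fin k) (i : Fin R) : 0 ≤ P.expS j i := by
  unfold expS
  split_ifs <;> simp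

lemma notMem_B {j : Fin k} {i : Fin R} (hi : i ∈ P.S j) : i ∉ P.B :=
  Finset.disjoint_right.1 (P.disjoint_B_S j) hi

lemma expB_of_mem_S {j : Fin k} {i : Fin R} (hi : i ∈ P.S j) (j' : Fin k) : P.expB j' i = 0 :=
  P.expB_of_notMem (P.notMem_B hi) j'

lemma expS_of_mem_S {j : Fin k} {i : Fin R} (hi : i ∈ P.S j) (j' : Fin k) :
    P.expS j' i = if j' = j then 1 else 0 := by
  unfold expS
  congr 1
  refine propext ⟨fun h => ?_, fun h => h ▸ hi⟩
  by_contra hne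
  exact Finset.disjoint_left.1 (P.disjoint_S_S _ _ hne) h hi

/-- The exponent vector of the quotient of the two monomials in the `j`-th binomial section. -/
def relator (j : Fin k) : Fin R → ℤ := P.expS j - P.expB j

lemma relator_of_mem_S {j : Fin k} {i : Fin R} (hi : i ∈ P.S j) (j' : Fin k) :
    P.relator j' i = if j' = j then 1 else 0 := by
  rw [relator, Pi.sub_apply, P.expB_of_mem_S hi, sub_zero, P.expS_of_mem_S hi]

lemma u_ρ (j : Fin k) (i : Fin R) : P.u j (Θ.ρ i) = P.relator j i := Θ.ofRelation_ρ _ _ i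

lemma u_pivot (j j' : Fin k) : P.u j' (Θ.ρ (P.pivot j)) = if j' = j then 1 else 0 := by
  rw [u_ρ, P.relator_of_mem_S (P.pivot_mem j)]

/-- The projection of exponent vectors along the relators of `j ∈ T`, which makes the exponents at
their pivots vanish. -/
def reduce (T : Finset (Fin k)) : (Fin R → ℤ) →+ (Fin R → ℤ) where
  toFun e := e - ∑ j ∈ T, e (P.pivot j) • P.relator j
  map_zero' := by simp
  map_add' e e' := by
    simp only [Pi.add_apply, add_smul, Finset.sum_add_distrib]
    abel

lemma reduce_apply (T : Finset (Fin k)) (e : Fin R → ℤ) :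
    P.reduce T e = e - ∑ j ∈ T, e (P.pivot j) • P.relator j := rfl

lemma reduce_relator_of_mem {T : Finset (Fin k)} {j : Fin k} (hj : j ∈ T) :
    P.reduce T (P.relator j) = 0 := by
  rw [reduce_apply, Finset.sum_eq_single_of_mem j hj, P.relator_of_mem_S (P.pivot_mem j), if_pos rfl,
    one_smul, sub_self]
  intro j' _ hne
  rw [P.relator_of_mem_S (P.pivot_mem j'), if_neg hne.symm, zero_smul]

lemma reduce_relator_of_notMem {T : Finset (Fin k)} {j : Fin k} (hj : j ∉ T) :
    P.reduce T (P.relator j) = P.relator j := by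
  rw [reduce_apply, Finset.sum_eq_zero, sub_zero]
  intro j' hj'
  rw [P.relator_of_mem_S (P.pivot_mem j'), if_neg (fun h : j = j' => hj (h ▸ hj')), zero_smul]

lemma relator_ne_zero (j : Fin k) : P.relator j ≠ 0 := by
  intro h
  have := P.relator_of_mem_S (P.pivot_mem j) j
  rw [h, if_pos rfl] at this
  exact zero_ne_one this

/-- The substitution on the chart of `I` given by `reduce`. -/
def reduceHom (T : Finset (Fin k)) (I : Finset (Fin R)) : coxChart R I →ₐ[ℂ] Laurent R :=
  (AddMonoidAlgebra.mapDomainAlgHom ℂ ℂ (P.reduce T)).comp (coxChart R I).val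

lemma reduceHom_apply (T : Finset (Fin k)) (I : Finset (Fin R)) (f : coxChart R I) :
    P.reduceHom T I f = AddMonoidAlgebra.mapDomain (P.reduce T) f.1 := rfl

lemma reduceHom_binomial (T : Finset (Fin k)) (I : Θ.covers) (j : Fin k) :
    P.reduceHom T I.1 (Θ.localSection P.binomial I j) =
      AddMonoidAlgebra.single (P.reduce T (P.expB j)) 1 -
        AddMonoidAlgebra.single (P.reduce T (P.expS j)) 1 := by
  change AddMonoidAlgebra.mapDomainAlgHom ℂ ℂ (P.reduce T)
    (AddMonoidAlgebra.single (P.expB j) 1 - AddMonoidAlgebra.single (P.expS j) 1) = _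
  rw [map_sub, AddMonoidAlgebra.mapDomainAlgHom_apply, AddMonoidAlgebra.mapDomainAlgHom_apply,
    AddMonoidAlgebra.mapDomain_single, AddMonoidAlgebra.mapDomain_single]

lemma reduce_expS_sub_expB (T : Finset (Fin k)) (j : Fin k) :
    P.reduce T (P.expS j) - P.reduce T (P.expB j) = P.reduce T (P.relator j) :=
  (map_sub _ _ _).symm

lemma reduceHom_binomial_of_mem {T : Finset (Fin k)} (I : Θ.covers) {j : Fin k} (hj : j ∈ T) :
    P.reduceHom T I.1 (Θ.localSection P.binomial I j) = 0 := by
  have := P.reduce_expS_sub_expB T j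
  rw [P.reduce_relator_of_mem hj, sub_eq_zero] at this
  rw [reduceHom_binomial, this, sub_self]

lemma reduceHom_binomial_of_notMem {T : Finset (Fin k)} (I : Θ.covers) {j : Fin k} (hj : j ∉ T) :
    P.reduceHom T I.1 (Θ.localSection P.binomial I j) ≠ 0 := by
  rw [reduceHom_binomial, sub_ne_zero]
  intro h
  have h1 := P.reduce_expS_sub_expB T j
  rw [P.reduce_relator_of_notMem hj, AddMonoidAlgebra.single_left_injective one_ne_zero h,
    sub_self] at h1
  exact P.relator_ne_zero j h1.symm

section kernel

variable (T : Finset (Fin k)) (I : Θ.covers)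

/-- The ideal generated by the binomial sections with indices in `T`. -/
abbrev binomialIdeal : Ideal (coxChart R I.1) :=
  Ideal.span (Θ.localSection P.binomial I '' (T : Set (Fin k)))

variable {T I}

/-- `x - y` divides `x^n - y^n`. -/
lemma mono_expS_pow_sub_mem {j : Fin k} (hj : j ∈ T) (n : ℕ) :
    mono I.1 (P.expS j) (fun i _ => P.expS_nonneg j i) ^ n -
      mono I.1 (P.expB j) (fun i _ => P.expB_nonneg j i) ^ n ∈ P.binomialIdeal T I := by
  refine Ideal.mem_of_dvd _ (sub_dvd_pow_sub_pow _ _ n) ?_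
  have : Θ.localSection P.binomial I j ∈ P.binomialIdeal T I := Ideal.subset_span ⟨j, hj, rfl⟩
  rw [← neg_mem_iff, neg_sub]
  exact this

/-- The factors `∏_{i ∈ S_j} x_i` are exchanged for `∏ x_b^{l_{b,j}}` one index `j` at a time, and
the differences telescope. -/
lemma mono_sub_mono_mem {T' : Finset (Fin k)} (hT : T' ⊆ T) (n : Fin k → ℕ) (g : Fin R → ℤ)
    (hg : ∀ i, i ∉ I.1 → 0 ≤ g i) :
    mono I.1 (g + ∑ j ∈ T', n j • P.expS j) (fun i hi => add_nonneg (hg i hi) (by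
      rw [Finset.sum_apply]
      exact Finset.sum_nonneg fun j _ => nsmul_nonneg (P.expS_nonneg j i) _)) -
    mono I.1 (g + ∑ j ∈ T', n j • P.expB j) (fun i hi => add_nonneg (hg i hi) (by
      rw [Finset.sum_apply]
      exact Finset.sum_nonneg fun j _ => nsmul_nonneg (P.expB_nonneg j i) _)) ∈
        P.binomialIdeal T I := by
  classical
  induction T' using Finset.induction_on generalizing g with
  | empty => simp
  | insert j T' hj ih =>
    have h1 := ih ((Finset.subset_insert _ _).trans hT) (g + n j • P.expS j)
      fun i hi => add_nonneg (hg i hi) (nsmul_nonneg (P.expS_nonneg j i) _)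
    have h2 : ∀ i, i ∉ I.1 → 0 ≤ (g + ∑ j ∈ T', n j • P.expB j) i := fun i hi =>
      add_nonneg (hg i hi) (by
        rw [Finset.sum_apply]
        exact Finset.sum_nonneg fun j _ => nsmul_nonneg (P.expB_nonneg j i) _)
    have h3 := Ideal.mul_mem_left _ (mono I.1 _ h2)
      (P.mono_expS_pow_sub_mem (I := I) (hT (Finset.mem_insert_self j T')) (n j))
    rw [mul_sub, mono_pow, mono_pow, mono_mul_mono, mono_mul_mono] at h3
    have h4 := add_mem h1 h3
    convert h4 using 1
    rw [← sub_eq_zero]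
    ext1
    simp only [AddSubgroupClass.coe_sub, AddMemClass.coe_add, coe_mono, Finset.sum_insert hj]
    have e1 : g + (n j • P.expS j + ∑ x ∈ T', n x • P.expS x) =
      g + n j • P.expS j + ∑ x ∈ T', n x • P.expS x := by abel
    have e2 : g + (n j • P.expB j + ∑ x ∈ T', n x • P.expB x) =
      g + ∑ x ∈ T', n x • P.expB x + n j • P.expB j := by abel
    have e3 : g + n j • P.expS j + ∑ x ∈ T', n x • P.expB x =
      g + ∑ x ∈ T', n x • P.expB x + n j • P.expS j := by abel
    rw [e1, e2, e3]
    simp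

/-- For `i ∈ S_j` with `j ∈ T`, disjointness of the parts gives `e i - e' i = n j`. Since `e i` and
`e' i` are nonnegative, `e i ≥ max (n j) 0`. So the monomial `x^e` is divisible by the `S`-monomials
that are to be exchanged. -/
lemma sub_sum_nonneg {e e' : Fin R → ℤ} (he : ∀ i, i ∉ I.1 → 0 ≤ e i)
    (he' : ∀ i, i ∉ I.1 → 0 ≤ e' i) {n : Fin k → ℤ}
    (h : e - e' = ∑ j ∈ T, n j • P.relator j) (i : Fin R) (hi : i ∉ I.1) :
    0 ≤ (e - ∑ j ∈ T, (n j).toNat • P.expS j) i := by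
  rw [Pi.sub_apply, Finset.sum_apply]
  by_cases hS : ∃ j ∈ T, i ∈ P.S j
  · obtain ⟨j, hj, hij⟩ := hS
    have h1 := congrFun h i
    rw [Pi.sub_apply, Finset.sum_apply, Finset.sum_eq_single_of_mem j hj] at h1
    · rw [Finset.sum_eq_single_of_mem j hj]
      · rw [Pi.smul_apply, P.relator_of_mem_S hij, if_pos rfl] at h1
        rw [Pi.smul_apply, P.expS_of_mem_S hij, if_pos rfl]
        have := he i hi
        have := he' i hi
        simp only [smul_eq_mul, mul_one, nsmul_eq_mul] at h1 ⊢
        omega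
      · intro j' _ hne
        rw [Pi.smul_apply, P.expS_of_mem_S hij, if_neg hne, smul_zero]
    · intro j' _ hne
      rw [Pi.smul_apply, P.relator_of_mem_S hij, if_neg hne, smul_zero]
  · rw [Finset.sum_eq_zero, sub_zero]
    · exact he i hi
    · intro j hj
      have : P.expS j i = 0 := if_neg fun h => hS ⟨j, hj, h⟩
      rw [Pi.smul_apply, this, smul_zero]

/-- The exponents differ by a combination of relators. Exchanging `S`-monomials for `B`-monomials in
`x^e` at the positive coefficients, and in `x^e'` at the negative ones, yields the same monomial. -/
lemma mono_sub_mono_mem_of_reduce_eq {e e' : Fin R → ℤ} (he : ∀ i, i ∉ I.1 → 0 ≤ e i)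
    (he' : ∀ i, i ∉ I.1 → 0 ≤ e' i) (h : P.reduce T e = P.reduce T e') :
    mono I.1 e he - mono I.1 e' he' ∈ P.binomialIdeal T I := by
  obtain ⟨n, hn⟩ : ∃ n : Fin k → ℤ, e - e' = ∑ j ∈ T, n j • P.relator j := by
    refine ⟨fun j => (e - e') (P.pivot j), ?_⟩
    have h1 : P.reduce T (e - e') = 0 := by rw [map_sub, h, sub_self]
    rwa [reduce_apply, sub_eq_zero] at h1
  have hn' : e' - e = ∑ j ∈ T, (-n j) • P.relator j := by
    simp only [neg_smul, Finset.sum_neg_distrib]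
    rw [← hn, neg_sub]
  have h1 := P.mono_sub_mono_mem (Finset.Subset.refl T) (fun j => (n j).toNat) _
    (P.sub_sum_nonneg he he' hn)
  have h2 := P.mono_sub_mono_mem (Finset.Subset.refl T) (fun j => (-n j).toNat) _
    (P.sub_sum_nonneg he' he hn')
  convert sub_mem h1 h2 using 1
  ext1
  simp only [AddSubgroupClass.coe_sub, coe_mono, sub_add_cancel]
  have e1 : e - ∑ j ∈ T, (n j).toNat • P.expS j + ∑ j ∈ T, (n j).toNat • P.expB j =
      e' - ∑ j ∈ T, (-n j).toNat • P.expS j + ∑ j ∈ T, (-n j).toNat • P.expB j := by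
    have e2 : ∑ j ∈ T, n j • P.relator j =
        ∑ j ∈ T, (n j).toNat • P.expS j - ∑ j ∈ T, (n j).toNat • P.expB j -
        (∑ j ∈ T, (-n j).toNat • P.expS j - ∑ j ∈ T, (-n j).toNat • P.expB j) := by
      simp only [← Finset.sum_sub_distrib]
      refine Finset.sum_congr rfl fun j _ => ?_
      have e3 : n j = ((n j).toNat : ℤ) - ((-n j).toNat : ℤ) := by omega
      conv_lhs => rw [e3, relator]
      rw [sub_smul, natCast_zsmul, natCast_zsmul, smul_sub, smul_sub]
    rw [e2, sub_eq_iff_eq_add] at hn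
    rw [hn]
    abel
  rw [e1]
  abel

end kernel

/-- The ideal of the binomial sections with indices in `T` is the kernel of a monomial map. -/
lemma ker_reduceHom (T : Finset (Fin k)) (I : Θ.covers) :
    RingHom.ker (P.reduceHom T I.1) = P.binomialIdeal T I := by
  classical
  refine le_antisymm (fun f hf => ?_) ?_
  swap
  · rw [Ideal.span_le]
    rintro _ ⟨j, hj, rfl⟩
    exact P.reduceHom_binomial_of_mem I hj
  let Q : (Fin R → ℤ) → (Fin R → ℤ) → Prop := fun v e => (∀ i, i ∉ I.1 → 0 ≤ e i) ∧ P.reduce T e = v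
  -- A representative of each fibre of the reduction among the exponents allowed on the chart; the
  -- value `0` outside the image is never used in the end.
  let sec : (Fin R → ℤ) → (Fin R → ℤ) := fun v => if h : ∃ e, Q v e then h.choose else 0
  have hsec : ∀ v, (∃ e, Q v e) → Q v (sec v) := by
    intro v hv
    simp only [sec, dif_pos hv]
    exact hv.choose_spec
  have hsec0 : ∀ v i, i ∉ I.1 → 0 ≤ sec v i := by
    intro v i hi
    by_cases hv : ∃ e, Q v e
    · exact (hsec v hv).1 i hi
    · simp [sec, dif_neg hv]
  have h1 : AddMonoidAlgebra.mapDomain sec (P.reduceHom T I.1 f) = 0 := by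
    rw [RingHom.mem_ker] at hf
    rw [hf, AddMonoidAlgebra.mapDomain_zero]
  have hsupp : ∀ e ∈ f.1.coeff.support, ∀ i, i ∉ I.1 → 0 ≤ e i := f.2
  -- The subtracted terms add up to the image under `sec` of the reduction of `f`, which is zero.
  -- This writes `f` as a combination of differences of monomials with equal reduction.
  have h2 : f = ∑ e ∈ f.1.coeff.support.attach, f.1.coeff e.1 •
      (mono I.1 e.1 (hsupp e.1 e.2) - mono I.1 (sec (P.reduce T e.1)) (hsec0 _)) := by
    ext1
    rw [AddSubmonoidClass.coe_finsetSum]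
    have h3 : ∀ e : f.1.coeff.support, ((f.1.coeff e.1 • (mono I.1 e.1 (hsupp e.1 e.2) -
        mono I.1 (sec (P.reduce T e.1)) (hsec0 _)) : coxChart R I.1) : Laurent R) =
        AddMonoidAlgebra.single e.1 (f.1.coeff e.1) -
          AddMonoidAlgebra.single (sec (P.reduce T e.1)) (f.1.coeff e.1) := by
      intro e
      rw [SetLike.val_smul, AddSubgroupClass.coe_sub, coe_mono, coe_mono, smul_sub,
        AddMonoidAlgebra.smul_single, AddMonoidAlgebra.smul_single, smul_eq_mul, mul_one]
    simp only [h3]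
    rw [Finset.sum_attach f.1.coeff.support (fun e => AddMonoidAlgebra.single e (f.1.coeff e) -
      AddMonoidAlgebra.single (sec (P.reduce T e)) (f.1.coeff e)), Finset.sum_sub_distrib,
      ← eq_sum_single]
    have h4 : ∑ e ∈ f.1.coeff.support,
        (AddMonoidAlgebra.single (sec (P.reduce T e)) (f.1.coeff e) : Laurent R) = 0 := by
      rw [← h1, reduceHom_apply]
      conv_rhs => rw [eq_sum_single f.1]
      have : ∀ g h : (Fin R → ℤ) → (Fin R → ℤ), ∀ F : Finset (Fin R → ℤ), ∀ c : (Fin R → ℤ) → ℂ,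
          (AddMonoidAlgebra.mapDomain g (∑ e ∈ F, AddMonoidAlgebra.single (h e) (c e)) :
            Laurent R) = ∑ e ∈ F, AddMonoidAlgebra.single (g (h e)) (c e) := by
        intro g h F c
        induction F using Finset.induction_on with
        | empty => simp
        | insert e F he ih =>
          rw [Finset.sum_insert he, Finset.sum_insert he, AddMonoidAlgebra.mapDomain_add, ih,
            AddMonoidAlgebra.mapDomain_single]
      exact ((congrArg _ (this _ (fun e => e) _ _)).trans (this _ _ _ _)).symm
    rw [h4, sub_zero]
  rw [h2]
  refine sum_mem fun e _ => Submodule.smul_of_tower_mem _ _ ?_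
  have h5 : ∃ e', Q (P.reduce T e.1) e' := ⟨e.1, hsupp e.1 e.2, rfl⟩
  exact P.mono_sub_mono_mem_of_reduce_eq _ _ (hsec _ h5).2.symm

/-- The binomial sections form a regular section. -/
lemma isRegularSection_binomial : Θ.IsRegularSection P.binomial := by
  rw [isRegularSection_iff]
  intro I p hp _ i a ha
  -- No localization is needed: the sequence is regular globally, because the quotient by the
  -- earlier binomials embeds in the Laurent ring, a domain, where the next binomial stays nonzero.
  refine ⟨1, fun h => hp.ne_top ((Ideal.eq_top_iff_one _).2 h), ?_⟩
  have h : ∀ b, b ∈ Ideal.span (Θ.localSection P.binomial I '' Set.Iio i) ↔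
      P.reduceHom (Finset.Iio i) I.1 b = 0 := by
    intro b
    rw [← RingHom.mem_ker, ker_reduceHom, binomialIdeal, Finset.coe_Iio]
  rw [one_mul]
  rw [h] at ha ⊢
  rw [map_mul] at ha
  exact (mul_eq_zero.1 ha).resolve_right (P.reduceHom_binomial_of_notMem I (by simp))

end ConvexPartition


/-! ### The binomial locus is the toric variety `X'` -/

open GITData Fan

lemma isClosedImmersion_pullback_snd {W X Y Z : Scheme.{0}} {a : W ⟶ X} {b : W ⟶ Y} {f : X ⟶ Z}
    {g : Y ⟶ Z} (H : IsPullback a b f g) [IsClosedImmersion b] :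
    IsClosedImmersion (Limits.pullback.snd f g) := by
  rw [← H.isoPullback_inv_snd]
  infer_instance

namespace ConvexPartition

variable {𝕃 : Type} [AddCommGroup 𝕃] {R : ℕ} {Θ : GITData 𝕃 R} {k : ℕ} (P : ConvexPartition Θ k)

lemma sum_u_pivot_smul (c : Fin k → ℤ) (j' : Fin k) :
    P.u j' (∑ j, c j • Θ.ρ (P.pivot j)) = c j' := by
  rw [map_sum, Finset.sum_eq_single_of_mem j' (Finset.mem_univ _)]
  · rw [map_smul, u_pivot, if_pos rfl, smul_eq_mul, mul_one]
  · intro j _ hne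
    rw [map_smul, u_pivot, if_neg hne.symm, smul_zero]

/-- A retraction of `N` onto `N'`. -/
def retraction : Θ.N →ₗ[ℤ] hyperplaneInter P.u :=
  LinearMap.codRestrict _
    (LinearMap.id - ∑ j, (P.u j).smulRight (Θ.ρ (P.pivot j))) fun v => by
      refine (Submodule.mem_iInf _).2 fun j' => ?_
      rw [LinearMap.mem_ker, LinearMap.sub_apply, LinearMap.id_apply, LinearMap.sum_apply, map_sub]
      simp only [LinearMap.smulRight_apply]
      rw [P.sum_u_pivot_smul (fun j => P.u j v), sub_self]

lemma coe_retraction (v : Θ.N) :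
    (P.retraction v : Θ.N) = v - ∑ j, P.u j v • Θ.ρ (P.pivot j) := by
  change (LinearMap.id - ∑ j, (P.u j).smulRight (Θ.ρ (P.pivot j)) : Θ.N →ₗ[ℤ] Θ.N) v = _
  rw [LinearMap.sub_apply, LinearMap.id_apply, LinearMap.sum_apply]
  rfl

lemma retraction_coe (v : hyperplaneInter P.u) : P.retraction v = v := by
  ext1
  rw [coe_retraction, Finset.sum_eq_zero, sub_zero]
  intro j _
  rw [show P.u j v = 0 from (Submodule.mem_iInf _).1 v.2 j, zero_smul]

lemma retraction_ρ_of_notMem {i : Fin R} (hB : i ∉ P.B) (hS : ∀ j, i ∉ P.S j) :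
    (P.retraction (Θ.ρ i) : Θ.N) = Θ.ρ i := by
  rw [coe_retraction, Finset.sum_eq_zero, sub_zero]
  intro j _
  rw [P.u_ρ_of_notMem_B j i hB, if_neg (hS j), zero_smul]

/-- The extension of characters from `N'` to `N` along the retraction. -/
def extendDual : Module.Dual ℤ (hyperplaneInter P.u) →+ Module.Dual ℤ Θ.N where
  toFun m := m ∘ₗ P.retraction
  map_zero' := LinearMap.zero_comp _
  map_add' _ _ := LinearMap.add_comp _ _ _

lemma extendDual_apply (m : Module.Dual ℤ (hyperplaneInter P.u)) (v : Θ.N) :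
    P.extendDual m v = m (P.retraction v) := rfl

lemma extendDual_comp_subtype (m : Module.Dual ℤ (hyperplaneInter P.u)) :
    P.extendDual m ∘ₗ (hyperplaneInter P.u).subtype = m := by
  ext v
  rw [LinearMap.comp_apply, extendDual_apply, Submodule.subtype_apply, retraction_coe]

lemma extendDual_injective : Function.Injective P.extendDual := by
  intro m m' h
  rw [← P.extendDual_comp_subtype m, h, extendDual_comp_subtype]

/-- The link between the two descriptions: reducing all pivots is dual to the retraction of `N` onto
`N'`, since `u_j` takes the values of the `j`-th relator on the rays. -/
lemma reduce_exponent (m : Module.Dual ℤ Θ.N) : P.reduce Finset.univ (Θ.exponent m) =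
    Θ.exponent (P.extendDual (m ∘ₗ (hyperplaneInter P.u).subtype)) := by
  funext i
  change _ = m (P.retraction (Θ.ρ i))
  rw [coe_retraction, map_sub, map_sum, reduce_apply, Pi.sub_apply, Finset.sum_apply]
  congr 1
  refine Finset.sum_congr rfl fun j _ => ?_
  rw [map_smul, u_ρ, Pi.smul_apply, smul_eq_mul, smul_eq_mul, mul_comm]
  rfl

lemma reduceHom_chartHom (I : Finset (Fin R)) (b : coordRing (Θ.cone I)) :
    P.reduceHom Finset.univ I (Θ.chartHom I b) = AddMonoidAlgebra.mapDomain
      ((Θ.exponent.comp P.extendDual).comp (dualMonoid (restrictCone P.u (Θ.cone I))).subtype)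
      (sublatticeHom P.u (Θ.cone I) b) := by
  induction b using AddMonoidAlgebra.induction_linear with
  | zero => simp [AddMonoidAlgebra.mapDomain_zero]
  | add f g hf hg =>
    rw [map_add, map_add, map_add, AddMonoidAlgebra.mapDomain_add, hf, hg]
  | single m c =>
    rw [sublatticeHom, AddMonoidAlgebra.mapDomainAlgHom_apply, AddMonoidAlgebra.mapDomain_single,
      AddMonoidAlgebra.mapDomain_single, reduceHom_apply, chartHom_single,
      AddMonoidAlgebra.mapDomain_single]
    congr 1
    exact P.reduce_exponent m

/-- Restricting characters to `N'` and then extending them injectively along the retraction is the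
substitution `reduceHom`, whose kernel is generated by the binomials. -/
lemma ker_sublatticeHom (I : Θ.covers) :
    RingHom.ker (sublatticeHom P.u (Θ.cone I.1)) = Θ.chartIdeal P.binomial I := by
  have h1 : Θ.coxIdeal P.binomial I = RingHom.ker (P.reduceHom Finset.univ I.1) := by
    rw [ker_reduceHom, binomialIdeal, Finset.coe_univ, Set.image_univ]
    rfl
  ext b
  rw [chartIdeal, h1, Ideal.mem_comap, RingHom.mem_ker, RingHom.mem_ker, reduceHom_chartHom]
  refine ⟨fun h => by rw [h, AddMonoidAlgebra.mapDomain_zero], fun h => ?_⟩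
  refine AddMonoidAlgebra.mapDomain_injective (f := (Θ.exponent.comp P.extendDual).comp
    (dualMonoid (restrictCone P.u (Θ.cone I.1))).subtype) (fun m m' h' => ?_)
    (h.trans (AddMonoidAlgebra.mapDomain_zero _).symm)
  exact Subtype.ext (P.extendDual_injective (Θ.exponent_injective h'))

/-- Any extension `m₀` of the character may be corrected by multiples `μ_j` of the `u_j`, which
vanish on `N'`. On a ray in `S_j` the correction is `-μ_j`, on a ray `b` in `B` it is `∑ l_{b,j}
μ_j`, and on the rays in `U` it is zero. So each `μ_j` should be as large as the rays of `S_j` in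
the cone permit. -/
lemma restrictDual_surjective (I : Finset (Fin R)) :
    Function.Surjective (restrictDual P.u (Θ.cone I)) := by
  classical
  intro m'
  let m₀ := P.extendDual m'.1
  have hm₀ : ∀ (v : Θ.N), v ∈ hyperplaneInter P.u → (1 : ℚ) ⊗ₜ[ℤ] v ∈ Θ.cone I → 0 ≤ m₀ v := by
    intro v hv hc
    have h1 := m'.2 ((1 : ℚ) ⊗ₜ[ℤ] (⟨v, hv⟩ : hyperplaneInter P.u)) hc
    rw [pair_tmul, one_mul] at h1
    have h2 : m₀ v = m'.1 ⟨v, hv⟩ := congrArg m'.1 (P.retraction_coe ⟨v, hv⟩)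
    rw [h2]
    exact_mod_cast h1
  -- The indices `j` for which some ray of `S_j` lies in the cone; for the others nothing bounds
  -- `μ_j` from above.
  let T : Finset (Fin k) := Finset.univ.filter fun j => ¬ P.S j ⊆ I
  have hq : ∀ j, ∃ i, j ∈ T → (i ∈ P.S j ∧ i ∉ I) ∧
      ∀ i', i' ∈ P.S j → i' ∉ I → m₀ (Θ.ρ i) ≤ m₀ (Θ.ρ i') := by
    intro j
    by_cases hj : j ∈ T
    · obtain ⟨x, hx⟩ : (P.S j \ I).Nonempty :=
        Finset.sdiff_nonempty.2 (Finset.mem_filter.1 hj).2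
      obtain ⟨i, hi, hmin⟩ := Finset.exists_min_image (P.S j \ I) (fun i => m₀ (Θ.ρ i)) ⟨x, hx⟩
      exact ⟨i, fun _ => ⟨Finset.mem_sdiff.1 hi, fun i' h1 h2 =>
        hmin i' (Finset.mem_sdiff.2 ⟨h1, h2⟩)⟩⟩
    · exact ⟨P.pivot j, fun h => (hj h).elim⟩
  choose q hq using hq
  let d : Fin R → ℤ := fun i => m₀ (Θ.ρ i) + ∑ j ∈ T, P.expB j i * m₀ (Θ.ρ (q j))
  -- Here `d i` is the value on a ray of `B` obtained from the indices in `T` alone. `Λ` outweighs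
  -- it as soon as some `l_{b,j}` with `j ∉ T` is positive.
  let Λ : ℤ := ∑ i, |d i|
  have hΛ : ∀ i, |d i| ≤ Λ := fun i =>
    Finset.single_le_sum (f := fun i => |d i|) (fun i _ => abs_nonneg _) (Finset.mem_univ i)
  have hΛ0 : 0 ≤ Λ := Finset.sum_nonneg fun i _ => abs_nonneg _
  let μ : Fin k → ℤ := fun j => if j ∈ T then m₀ (Θ.ρ (q j)) else Λ
  let m : Module.Dual ℤ Θ.N := m₀ - ∑ j, μ j • P.u j
  have hmρ : ∀ i, m (Θ.ρ i) = m₀ (Θ.ρ i) - ∑ j, μ j * P.u j (Θ.ρ i) := by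
    intro i
    simp [m, LinearMap.sum_apply]
  have hm : m ∈ dualMonoid (Θ.cone I) := by
    rw [mem_dualMonoid_cone_iff]
    intro i hi
    rw [hmρ]
    by_cases hB : i ∈ P.B
    · have h1 : ∀ j, P.u j (Θ.ρ i) = -P.expB j i := by
        intro j
        rw [P.u_ρ_of_mem_B j ⟨i, hB⟩, expB, dif_pos hB]
      have h2 : m₀ (Θ.ρ i) - ∑ j, μ j * P.u j (Θ.ρ i) =
          d i + ∑ j ∈ Tᶜ, P.expB j i * Λ := by
        rw [← Finset.sum_add_sum_compl T, sub_eq_add_neg, neg_add, ← add_assoc,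
          ← Finset.sum_neg_distrib, ← Finset.sum_neg_distrib]
        congr 1
        · congr 1
          refine Finset.sum_congr rfl fun j hj => ?_
          rw [h1]
          simp only [μ, if_pos hj]
          ring
        · refine Finset.sum_congr rfl fun j hj => ?_
          rw [h1]
          simp only [μ, if_neg (Finset.mem_compl.1 hj)]
          ring
      rw [h2]
      by_cases h3 : ∃ j ∈ Tᶜ, P.expB j i ≠ 0
      · obtain ⟨j, hj, hne⟩ := h3
        have h4 : 1 ≤ P.expB j i := lt_of_le_of_ne (P.expB_nonneg j i) hne.symm
        have h5 : P.expB j i * Λ ≤ ∑ j ∈ Tᶜ, P.expB j i * Λ :=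
          Finset.single_le_sum (f := fun j => P.expB j i * Λ)
            (fun j _ => mul_nonneg (P.expB_nonneg j i) hΛ0) hj
        have h6 := hΛ i
        have h7 := neg_abs_le (d i)
        nlinarith
      · push Not at h3
        rw [Finset.sum_eq_zero fun j hj => by rw [h3 j hj, zero_mul], add_zero]
        -- All `l_{b,j}` with `j ∉ T` vanish here, so adding `l_{b,j}` times the minimising ray of
        -- each `S_j`, `j ∈ T`, brings the ray of `B` into `N'` without leaving the cone. The value
        -- of `m₀` on this vector is `d i`.
        have h4 := hm₀ (Θ.ρ i + ∑ j ∈ T, P.expB j i • Θ.ρ (q j)) ?_ ?_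
        · rw [map_add, map_sum] at h4
          simpa only [map_smul, smul_eq_mul] using h4
        · refine (Submodule.mem_iInf _).2 fun j' => ?_
          rw [LinearMap.mem_ker, map_add, map_sum, h1]
          have h5 : ∀ j ∈ T, P.u j' (P.expB j i • Θ.ρ (q j)) =
              if j' = j then P.expB j' i else 0 := by
            intro j hj
            rw [map_smul, u_ρ, P.relator_of_mem_S (hq j hj).1.1, smul_eq_mul, mul_ite, mul_one,
              mul_zero]
            split_ifs with h
            · rw [h]
            · rfl
          rw [Finset.sum_congr rfl h5, Finset.sum_ite_eq]
          split_ifs with h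
          · exact neg_add_cancel _
          · rw [h3 j' (Finset.mem_compl.2 h), neg_zero, add_zero]
        · rw [TensorProduct.tmul_add, TensorProduct.tmul_sum]
          refine add_mem (Θ.ray_mem_cone hi) (sum_mem fun j hj => ?_)
          have h5 : (1 : ℚ) ⊗ₜ[ℤ] (P.expB j i • Θ.ρ (q j)) =
              (P.expB j i : ℚ) • ((1 : ℚ) ⊗ₜ[ℤ] Θ.ρ (q j)) := by
            rw [TensorProduct.tmul_smul, Int.cast_smul_eq_zsmul]
          rw [h5]
          exact PointedCone.smul_mem _ (by exact_mod_cast P.expB_nonneg j i)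
            (Θ.ray_mem_cone (hq j hj).1.2)
    · by_cases hS : ∃ j, i ∈ P.S j
      · obtain ⟨j, hj⟩ := hS
        have hjT : j ∈ T := Finset.mem_filter.2 ⟨Finset.mem_univ _, fun h => hi (h hj)⟩
        rw [Finset.sum_eq_single_of_mem j (Finset.mem_univ _), u_ρ, P.relator_of_mem_S hj,
          if_pos rfl, mul_one]
        · simp only [μ, if_pos hjT]
          exact sub_nonneg.2 ((hq j hjT).2 i hj hi)
        · intro j' _ hne
          rw [u_ρ, P.relator_of_mem_S hj, if_neg hne, mul_zero]
      · push Not at hS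
        rw [Finset.sum_eq_zero, sub_zero]
        · refine hm₀ _ ?_ (Θ.ray_mem_cone hi)
          rw [← P.retraction_ρ_of_notMem hB hS]
          exact (P.retraction _).2
        · intro j _
          rw [P.u_ρ_of_notMem_B j i hB, if_neg (hS j), mul_zero]
  refine ⟨⟨m, hm⟩, Subtype.ext ?_⟩
  change m ∘ₗ (hyperplaneInter P.u).subtype = m'.1
  rw [← P.extendDual_comp_subtype m'.1]
  ext v
  simp only [LinearMap.comp_apply, Submodule.subtype_apply, m, LinearMap.sub_apply,
    LinearMap.sum_apply, LinearMap.smul_apply]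
  rw [Finset.sum_eq_zero, sub_zero]
  intro j _
  rw [show P.u j v = 0 from (Submodule.mem_iInf _).1 v.2 j, smul_zero]

lemma sublatticeHom_surjective (I : Finset (Fin R)) :
    Function.Surjective (sublatticeHom P.u (Θ.cone I)) := by
  intro b
  induction b using AddMonoidAlgebra.induction_linear with
  | zero => exact ⟨0, map_zero _⟩
  | add f g hf hg =>
    obtain ⟨a, rfl⟩ := hf
    obtain ⟨b, rfl⟩ := hg
    exact ⟨a + b, map_add _ _ _⟩
  | single m c =>
    obtain ⟨m, rfl⟩ := P.restrictDual_surjective I m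
    exact ⟨AddMonoidAlgebra.single m c, AddMonoidAlgebra.mapDomain_single⟩

variable (h : Θ.IsOrbifold)

lemma isPullback_restrictMap_coverChart (I : Θ.covers) :
    IsPullback (sublatticeMap P.u (Θ.cone I.1)) (((Θ.fan h).restrict P.u).chart (restrictCone P.u (Θ.cone I.1))
      ((Θ.fan h).restrictCone_mem P.u ⟨I.1, I.2, rfl⟩)) (Θ.coverChart h I)
      ((Θ.fan h).restrictMap P.u) :=
  (Θ.fan h).isPullback_restrictMap P.u _

instance isClosedImmersion_sublatticeMap (I : Θ.covers) :
    IsClosedImmersion (sublatticeMap P.u (Θ.cone I.1)) :=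
  IsClosedImmersion.spec_of_surjective _ (P.sublatticeHom_surjective I.1)

instance isClosedImmersion_restrictMap : IsClosedImmersion ((Θ.fan h).restrictMap P.u) := by
  let 𝒰 : (Θ.Y h).OpenCover :=
    { I₀ := Θ.covers
      X := fun I => Spec (CommRingCat.of (coordRing (Θ.cone I.1)))
      f := fun I => Θ.coverChart h I
      mem₀ := by
        rw [Scheme.presieve₀_mem_precoverage_iff]
        exact ⟨fun y => Θ.exists_mem_range_coverChart h y, fun I => inferInstance⟩ }
  refine (IsZariskiLocalAtTarget.iff_of_openCover (P := @IsClosedImmersion) 𝒰).2 fun I => ?_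
  have := P.isClosedImmersion_sublatticeMap I
  exact isClosedImmersion_pullback_snd (P.isPullback_restrictMap_coverChart h I).flip

/-- Checked on the charts, over which the morphism is the closed immersion given by `sublatticeHom`.
-/
lemma ker_restrictMap : ((Θ.fan h).restrictMap P.u).ker = Θ.zeroIdeal h P.binomial := by
  have := P.isClosedImmersion_restrictMap h
  have : QuasiCompact ((Θ.fan h).restrictMap P.u) := inferInstance
  refine ext_of_comap_eq (fun I : Θ.covers => Θ.coverChart h I)
    (Θ.exists_mem_range_coverChart h) fun I => ?_
  rw [comap_zeroIdeal, ker_comap_of_isPullback (P.isPullback_restrictMap_coverChart h I),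
    ker_specMap_eq_specIdeal, ← ker_sublatticeHom]
  rfl

end ConvexPartition


/-! ### Degrees in which monomials are divisible by high powers of covers -/

namespace GITData

variable {𝕃 : Type} [AddCommGroup 𝕃] {R : ℕ} (Θ : GITData 𝕃 R)

lemma toQ_degree (e : Fin R → ℤ) : toQ (Θ.degree e) = ∑ i, (e i : ℚ) • toQ (Θ.D i) := by
  ext x
  simp [degree_apply, toQ_apply, LinearMap.sum_apply]

lemma toQ_injective : Function.Injective (toQ : Module.Dual ℤ 𝕃 → 𝕃 →ₗ[ℤ] ℚ) := by
  intro χ ψ h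
  ext x
  have := LinearMap.congr_fun h x
  rw [toQ_apply, toQ_apply] at this
  exact_mod_cast this

/-- The nonnegative exponent vectors of a given degree are finite in number. -/
lemma finite_degree (lam : Module.Dual ℤ 𝕃) :
    {e : Fin R → ℤ | (∀ i, 0 ≤ e i) ∧ Θ.degree e = lam}.Finite := by
  obtain ⟨ℓ, hℓ⟩ := Θ.strictly_convex
  refine (Set.finite_Icc (0 : Fin R → ℤ) (fun _ => lam ℓ)).subset ?_
  rintro e ⟨he, rfl⟩
  refine ⟨he, fun i => ?_⟩
  rw [degree_apply, LinearMap.sum_apply]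
  have h1 : e i * Θ.D i ℓ ≤ ∑ i, e i * Θ.D i ℓ :=
    Finset.single_le_sum (f := fun i => e i * Θ.D i ℓ)
      (fun i _ => mul_nonneg (he i) (hℓ i).le) (Finset.mem_univ i)
  have h2 := he i
  have h3 := hℓ i
  have h4 : e i ≤ e i * Θ.D i ℓ := by nlinarith
  exact h4.trans h1

lemma eq_zero_of_degree_eq_zero {e : Fin R → ℤ} (he : ∀ i, 0 ≤ e i) (h : Θ.degree e = 0) :
    e = 0 := by
  obtain ⟨ℓ, hℓ⟩ := Θ.strictly_convex
  have h1 := LinearMap.congr_fun h ℓ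
  rw [degree_apply, LinearMap.sum_apply] at h1
  have h2 := (Finset.sum_eq_zero_iff_of_nonneg
    (fun i _ => mul_nonneg (he i) (hℓ i).le)).1 h1
  funext i
  exact (mul_eq_zero.1 (h2 i (Finset.mem_univ i))).resolve_right (hℓ i).ne'

/-- `N` is a common denominator of the positive expressions of `ω` over all covers, of which there
are finitely many. -/
lemma exists_scaling (h : Θ.covers.Nonempty) : ∃ (N : ℕ) (ν : Module.Dual ℤ 𝕃), 0 < N ∧
    toQ ν = (N : ℚ) • Θ.ω ∧ ∀ I ∈ Θ.covers, ∃ e : Fin R → ℤ, (∀ i ∈ I, 0 < e i) ∧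
      (∀ i, i ∉ I → e i = 0) ∧ Θ.degree e = ν := by
  classical
  have h1 : ∀ I : Θ.covers, ∃ a : Fin R → ℚ, (∀ i ∈ I.1, 0 < a i) ∧
      Θ.ω = ∑ i ∈ I.1, a i • toQ (Θ.D i) := fun I => I.2
  choose a ha hω using h1
  let N : ℕ := ∏ I : Θ.covers, ∏ i, (a I i).den
  have hN : 0 < N := Finset.prod_pos fun I _ => Finset.prod_pos fun i _ => (a I i).den_pos
  have hz : ∀ I i, ∃ z : ℤ, (z : ℚ) = N * a I i := by
    intro I i
    obtain ⟨c, hc⟩ : (a I i).den ∣ N :=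
      (Finset.dvd_prod_of_mem (fun i => (a I i).den) (Finset.mem_univ i)).trans
        (Finset.dvd_prod_of_mem (fun I => ∏ i, (a I i).den) (Finset.mem_univ I))
    refine ⟨c * (a I i).num, ?_⟩
    rw [hc]
    push_cast
    rw [mul_comm ((a I i).den : ℚ), mul_assoc, Rat.den_mul_eq_num]
  choose z hz using hz
  let e : Θ.covers → Fin R → ℤ := fun I i => if i ∈ I.1 then z I i else 0
  have hdeg : ∀ I, toQ (Θ.degree (e I)) = (N : ℚ) • Θ.ω := by
    intro I
    rw [toQ_degree, hω I, Finset.smul_sum, ← Finset.sum_subset (Finset.subset_univ I.1)]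
    · refine Finset.sum_congr rfl fun i hi => ?_
      simp only [e, if_pos hi]
      rw [hz, mul_smul]
    · intro i _ hi
      simp only [e, if_neg hi]
      simp
  obtain ⟨I₀, hI₀⟩ := h
  refine ⟨N, Θ.degree (e ⟨I₀, hI₀⟩), hN, hdeg _, fun I hI => ⟨e ⟨I, hI⟩, fun i hi => ?_,
    fun i hi => if_neg hi, toQ_injective ((hdeg _).trans (hdeg _).symm)⟩⟩
  simp only [e, if_pos hi]
  have : (0 : ℚ) < z ⟨I, hI⟩ i := by
    rw [hz]
    exact mul_pos (by exact_mod_cast hN) (ha _ i hi)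
  exact_mod_cast this

/-- For each `n` there is a degree in which each cover of `ω` is the support of a monomial, and in
which each monomial is divisible by the `n`-th power of the product of the variables in some cover
of `ω`. -/
lemma exists_degree (h : Θ.covers.Nonempty) (n : ℕ) : ∃ lam : Module.Dual ℤ 𝕃,
    (∀ I ∈ Θ.covers, ∃ e : Fin R → ℤ, (∀ i, 0 ≤ e i) ∧ (∀ i, i ∉ I → e i = 0) ∧
      Θ.degree e = lam) ∧
    ∀ e : Fin R → ℤ, (∀ i, 0 ≤ e i) → Θ.degree e = lam → ∃ I ∈ Θ.covers, ∀ i ∈ I, (n : ℤ) ≤ e i := by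
  classical
  obtain ⟨N, ν, hN, hν, hI⟩ := Θ.exists_scaling h
  let castHom : (Fin R → ℕ) →+ (Fin R → ℤ) :=
    { toFun e i := e i
      map_zero' := by ext; simp
      map_add' e e' := by ext; simp }
  let f : (Fin R → ℕ) × ℕ →+ Module.Dual ℤ 𝕃 :=
    (Θ.degree.comp castHom).comp (AddMonoidHom.fst _ _)
  let g : (Fin R → ℕ) × ℕ →+ Module.Dual ℤ 𝕃 :=
    (multiplesHom _ ν).comp (AddMonoidHom.snd _ _)
  -- The pairs `(e, M)` with `x^e` of degree `M ν` form a finitely generated monoid. The support of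
  -- a pair with `M > 0` is a cover, by dividing its expression of `M ν` by `N M`.
  obtain ⟨G, hG⟩ := AddSubmonoid.fg_eqLocusM f g
  have hmem : ∀ p : (Fin R → ℕ) × ℕ, p ∈ f.eqLocusM g ↔ Θ.degree (fun i => p.1 i) = p.2 • ν :=
    fun p => Iff.rfl
  have hcover : ∀ p ∈ f.eqLocusM g, 0 < p.2 → Finset.univ.filter (fun i => 0 < p.1 i) ∈ Θ.covers := by
    intro p hp h0
    rw [hmem] at hp
    refine ⟨fun i => ((N : ℚ) * p.2)⁻¹ * p.1 i, fun i hi => ?_, ?_⟩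
    · have := (Finset.mem_filter.1 hi).2
      positivity
    · have h1 : (N : ℚ) * p.2 ≠ 0 := by positivity
      have h2 : toQ (p.2 • ν) = ((N : ℚ) * p.2) • Θ.ω := by
        ext x
        have := LinearMap.congr_fun hν x
        rw [toQ_apply, LinearMap.smul_apply] at this
        rw [toQ_apply, LinearMap.smul_apply, LinearMap.smul_apply]
        rw [smul_eq_mul, nsmul_eq_mul] at *
        push_cast
        rw [this]
        ring
      rw [← hp, toQ_degree] at h2
      rw [Finset.sum_filter_of_ne]
      · simp only [mul_smul]
        rw [← Finset.smul_sum]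
        rw [eq_inv_smul_iff₀ h1, ← h2]
        simp
      · intro i _ hne
        by_contra h3
        have h4 : p.1 i = 0 := by omega
        refine hne ?_
        dsimp only
        rw [h4, Nat.cast_zero, mul_zero, zero_smul]
  -- Large enough that a decomposition of a pair of height `M` into generators must use some
  -- generator of positive height at least `n` times; the support of that generator is the required
  -- cover.
  let M : ℕ := n * (∑ p ∈ G, p.2) + 1
  refine ⟨M • ν, fun I hII => ?_, fun e he hdeg => ?_⟩
  · obtain ⟨e, h1, h2, h3⟩ := hI I hII
    refine ⟨M • e, fun i => ?_, fun i hi => by simp [h2 i hi], by rw [map_nsmul, h3]⟩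
    refine nsmul_nonneg ?_ _
    by_cases hi : i ∈ I
    · exact (h1 i hi).le
    · exact (h2 i hi).ge
  · have hp : ((fun i => (e i).toNat, M) : (Fin R → ℕ) × ℕ) ∈ AddSubmonoid.closure (G : Set _) := by
      rw [hG, hmem, ← hdeg]
      congr 1
      funext i
      exact Int.toNat_of_nonneg (he i)
    obtain ⟨c, -, hc⟩ := AddSubmonoid.mem_closure_finset.1 hp
    have hM : ∑ p ∈ G, c p * p.2 = M := by
      have := congrArg Prod.snd hc
      rw [Prod.snd_sum] at this
      simpa using this
    obtain ⟨p, hpG, hp2⟩ : ∃ p ∈ G, n * p.2 < c p * p.2 := by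
      refine Finset.exists_lt_of_sum_lt ?_
      rw [hM, ← Finset.mul_sum]
      exact Nat.lt_succ_self _
    have h0 : 0 < p.2 := by
      by_contra h0
      have : p.2 = 0 := by omega
      rw [this] at hp2
      simp at hp2
    have hnc : n ≤ c p := (lt_of_mul_lt_mul_right hp2 (Nat.zero_le _)).le
    refine ⟨_, hcover p (hG ▸ AddSubmonoid.subset_closure hpG) h0, fun i hi => ?_⟩
    have hpi : 0 < p.1 i := (Finset.mem_filter.1 hi).2
    have h5 : ∑ q ∈ G, c q * q.1 i = (e i).toNat := by
      have := congrFun (congrArg Prod.fst hc) i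
      rw [Prod.fst_sum, Finset.sum_apply] at this
      simpa using this
    have h6 : c p * p.1 i ≤ ∑ q ∈ G, c q * q.1 i :=
      Finset.single_le_sum (f := fun q => c q * q.1 i) (fun _ _ => Nat.zero_le _) hpG
    have h7 : c p ≤ c p * p.1 i := Nat.le_mul_of_pos_right _ hpi
    have := he i
    omega

end GITData


/-! ### A graded Nakayama lemma over `ℂ[X]` -/

open Polynomial

/-- The extension of a prime avoiding `x` is prime and contracts to it. -/
lemma IsAway.exists_isPrime {A A' : Type} [CommRing A] [CommRing A'] {g : A →+* A'} {x : A}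
    (hg : IsAway g x) {p : Ideal A} (hp : p.IsPrime) (hx : x ∉ p) :
    ∃ P : Ideal A', P.IsPrime ∧ P.comap g = p := by
  have h1 : ∀ a, g a ∈ p.map g ↔ a ∈ p := by
    intro a
    rw [hg.mem_map_iff]
    refine ⟨?_, fun h => ⟨0, by rwa [pow_zero, one_mul]⟩⟩
    rintro ⟨n, h⟩
    exact (hp.mem_or_mem h).resolve_left fun h => hx (hp.mem_of_pow_mem _ h)
  refine ⟨p.map g, ⟨fun h => hp.ne_top ((Ideal.eq_top_iff_one _).2 ?_), fun {a b} hab => ?_⟩,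
    Ideal.ext h1⟩
  · rw [← h1, h]
    trivial
  · obtain ⟨m, a', ha⟩ := hg.surj a
    obtain ⟨n, b', hb⟩ := hg.surj b
    rw [← hg.mul_pow_mem_iff m, ha, ← hg.mul_pow_mem_iff (a := b) n, hb, h1, h1]
    refine hp.mem_or_mem ((h1 _).1 ?_)
    rw [map_mul, ← ha, ← hb, mul_mul_mul_comm]
    exact Ideal.mul_mem_right _ _ hab

namespace GITData

variable {𝕃 : Type} [AddCommGroup 𝕃] {R : ℕ} (Θ : GITData 𝕃 R) {k : ℕ}
  {χ : Fin k → Module.Dual ℤ 𝕃}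

section homogeneous

/-- The nonnegative exponent vectors of degree `lam`. -/
abbrev DegreeExponents (lam : Module.Dual ℤ 𝕃) : Type :=
  {e : Fin R → ℤ // (∀ i, 0 ≤ e i) ∧ Θ.degree e = lam}

instance (lam : Module.Dual ℤ 𝕃) : Finite (Θ.DegreeExponents lam) :=
  (Θ.finite_degree lam).to_subtype

/-- The monomial of a nonnegative exponent vector. -/
abbrev degreeMono {lam : Module.Dual ℤ 𝕃} (e : Θ.DegreeExponents lam) : coxChart R ∅ :=
  mono ∅ e.1 fun i _ => e.2.1 i

variable (lam : Module.Dual ℤ 𝕃) [Fintype (Θ.DegreeExponents lam)]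

lemma coeff_sum_degreeMono (w : Θ.DegreeExponents lam → ℂ) (e : Θ.DegreeExponents lam) :
    (∑ e, w e • Θ.degreeMono e : coxChart R ∅).1.coeff e.1 = w e := by
  rw [AddSubmonoidClass.coe_finsetSum, AddMonoidAlgebra.coeff_sum, Finsupp.finsetSum_apply,
    Finset.sum_eq_single_of_mem e (Finset.mem_univ e)]
  · rw [SetLike.val_smul, coe_mono, AddMonoidAlgebra.coeff_smul, AddMonoidAlgebra.coeff_single,
      Finsupp.smul_apply, Finsupp.single_eq_same, smul_eq_mul, mul_one]
  · intro e' _ hne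
    rw [SetLike.val_smul, coe_mono, AddMonoidAlgebra.coeff_smul, AddMonoidAlgebra.coeff_single,
      Finsupp.smul_apply, Finsupp.single_eq_of_ne (fun h => hne (Subtype.ext h.symm)), smul_zero]

lemma coxProj_eq_sum_degreeMono (f : coxChart R ∅) : (coxProj Θ.degree ∅).proj lam f =
    ∑ e : Θ.DegreeExponents lam, f.1.coeff e.1 • Θ.degreeMono e := by
  classical
  ext1
  refine AddMonoidAlgebra.coeff_injective (Finsupp.ext fun e => ?_)
  rw [coe_coxProj, coeff_laurentProj, Finsupp.filter_apply]
  by_cases he : (∀ i, 0 ≤ e i) ∧ Θ.degree e = lam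
  · rw [if_pos he.2]
    exact (Θ.coeff_sum_degreeMono lam (fun e => f.1.coeff e.1) ⟨e, he⟩).symm
  · have h1 : (∑ e : Θ.DegreeExponents lam, f.1.coeff e.1 • Θ.degreeMono e :
        coxChart R ∅).1.coeff e = 0 := by
      rw [AddSubmonoidClass.coe_finsetSum, AddMonoidAlgebra.coeff_sum, Finsupp.finsetSum_apply]
      refine Finset.sum_eq_zero fun e' _ => ?_
      rw [SetLike.val_smul, coe_mono, AddMonoidAlgebra.coeff_smul, AddMonoidAlgebra.coeff_single,
        Finsupp.smul_apply, Finsupp.single_eq_of_ne (fun h : e = e'.1 => he (h ▸ e'.2)), smul_zero]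
    rw [h1]
    split_ifs with hdeg
    · by_contra hne
      exact he ⟨fun i => f.2 e (Finsupp.mem_support_iff.2 hne) i (Finset.notMem_empty i), hdeg⟩
    · rfl

/-- The `ℂ[X]`-linear combinations of the monomials of degree `lam`. -/
def degreeSum : (Θ.DegreeExponents lam → ℂ[X]) →+ (coxChart R ∅)[X] where
  toFun v := ∑ e, (v e).map (algebraMap ℂ (coxChart R ∅)) * C (Θ.degreeMono e)
  map_zero' := by simp
  map_add' v w := by
    simp only [Pi.add_apply, Polynomial.map_add, add_mul, Finset.sum_add_distrib]

lemma degreeSum_apply (v : Θ.DegreeExponents lam → ℂ[X]) : Θ.degreeSum lam v =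
    ∑ e, (v e).map (algebraMap ℂ (coxChart R ∅)) * C (Θ.degreeMono e) := rfl

lemma degreeSum_smul (f : ℂ[X]) (v : Θ.DegreeExponents lam → ℂ[X]) :
    Θ.degreeSum lam (f • v) = f.map (algebraMap ℂ (coxChart R ∅)) * Θ.degreeSum lam v := by
  rw [degreeSum_apply, degreeSum_apply, Finset.mul_sum]
  refine Finset.sum_congr rfl fun e _ => ?_
  rw [Pi.smul_apply, smul_eq_mul, Polynomial.map_mul, mul_assoc]

lemma evalAt_degreeSum (v : Θ.DegreeExponents lam → ℂ[X]) (t : ℂ) :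
    evalAt _ t (Θ.degreeSum lam v) = ∑ e, (v e).eval t • Θ.degreeMono e := by
  rw [degreeSum_apply, map_sum]
  refine Finset.sum_congr rfl fun e _ => ?_
  rw [map_mul, evalAt_C, Algebra.smul_def]
  congr 1
  exact eval_map_apply _ _

lemma exists_degreeSum_eq (q : (coxChart R ∅)[X]) :
    ∃ v, Θ.degreeSum lam v = (coxProj Θ.degree ∅).polynomial.proj lam q := by
  induction q using Polynomial.induction_on' with
  | add p q hp hq =>
    obtain ⟨v, hv⟩ := hp
    obtain ⟨w, hw⟩ := hq
    exact ⟨v + w, by rw [map_add, map_add, hv, hw]⟩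
  | monomial n a =>
    refine ⟨fun e => monomial n (a.1.coeff e.1), ?_⟩
    have h : (coxProj Θ.degree ∅).polynomial.proj lam (monomial n a) =
        monomial n ((coxProj Θ.degree ∅).proj lam a) := by
      ext1 m
      rw [DegreeProj.polynomial_proj_coeff, coeff_monomial, coeff_monomial]
      split_ifs
      · rfl
      · exact map_zero _
    rw [h, coxProj_eq_sum_degreeMono, map_sum, degreeSum_apply]
    refine Finset.sum_congr rfl fun e _ => ?_
    rw [map_monomial, monomial_mul_C, Algebra.smul_def]

end homogeneous

/-- The exponent vector of the product of the variables in `I`, as a monomial. -/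
abbrev coverMono (I : Finset (Fin R)) : coxChart R ∅ :=
  mono ∅ (indicator I) fun i _ => indicator_nonneg I i

/-- A graded form of Nakayama's lemma: if over `0 ∈ 𝔸¹` the homogeneous ideal `J` contains powers of
the monomials `∏_{i ∈ I} x_i` of all covers `I`, then so it does over a neighbourhood of `0`. -/
lemma exists_mul_pow_mem (hne : Θ.covers.Nonempty) {J : Ideal (coxChart R ∅)[X]}
    (hJ : (coxProj Θ.degree ∅).polynomial.IsHomogeneous J) {n : ℕ}
    (h : ∀ I ∈ Θ.covers, ∃ c ∈ J, evalAt _ 0 c = coverMono I ^ n) :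
    ∃ f : ℂ[X], f.eval 0 = 1 ∧ ∀ I ∈ Θ.covers, ∃ N : ℕ,
      f.map (algebraMap ℂ (coxChart R ∅)) * C (coverMono I ^ N) ∈ J := by
  classical
  obtain ⟨lam, h1, h2⟩ := Θ.exists_degree hne n
  let := Fintype.ofFinite (Θ.DegreeExponents lam)
  -- The degree-`lam` part of `J`, inside the free `ℂ[X]`-module of finite rank on the monomials of
  -- that degree.
  let W : Submodule ℂ[X] (Θ.DegreeExponents lam → ℂ[X]) :=
    { carrier := {v | Θ.degreeSum lam v ∈ J}
      zero_mem' := by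
        rw [Set.mem_ofPred_eq, map_zero]
        exact zero_mem _
      add_mem' := fun {v w} hv hw => by
        rw [Set.mem_ofPred_eq, map_add]
        exact add_mem hv hw
      smul_mem' := fun f v hv => by
        rw [Set.mem_ofPred_eq, degreeSum_smul]
        exact Ideal.mul_mem_left _ _ hv }
  have key : ∀ e₁ : Θ.DegreeExponents lam, (Pi.single e₁ 1 : Θ.DegreeExponents lam → ℂ[X]) ∈
      W ⊔ Ideal.span {(X : ℂ[X])} • (⊤ : Submodule ℂ[X] (Θ.DegreeExponents lam → ℂ[X])) := by
    intro e₁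
    obtain ⟨I, hI, hle⟩ := h2 e₁.1 e₁.2.1 e₁.2.2
    obtain ⟨c, hcJ, hc⟩ := h I hI
    have h3 : ∀ i, i ∉ (∅ : Finset (Fin R)) → 0 ≤ (e₁.1 - n • indicator I) i := by
      intro i _
      have := e₁.2.1 i
      by_cases hi : i ∈ I
      · have := hle i hi
        simp [indicator, hi]
        omega
      · simpa [indicator, hi] using this
    -- The monomial is divisible by the `n`-th power of the monomial of some cover `I`. Multiplying
    -- `c` by the cofactor gives an element of `J` whose value at `0` is the monomial; its
    -- degree-`lam` part lies in `W` and has the same value at `0`.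
    obtain ⟨v, hv⟩ := Θ.exists_degreeSum_eq lam (C (mono ∅ _ h3) * c)
    have hvW : v ∈ W := by
      change Θ.degreeSum lam v ∈ J
      rw [hv]
      exact hJ _ (Ideal.mul_mem_left _ _ hcJ) lam
    have h4 : evalAt _ 0 (C (mono ∅ _ h3) * c) = Θ.degreeMono e₁ := by
      rw [map_mul, evalAt_C, hc, mono_pow, mono_mul_mono]
      ext1
      rw [coe_mono, coe_mono, sub_add_cancel]
    have h5 : ∑ e, (v e).eval 0 • Θ.degreeMono e = Θ.degreeMono e₁ := by
      have h6 : ∀ q : (coxChart R ∅)[X], evalAt _ 0 q = q.coeff 0 := by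
        intro q
        rw [evalAt, map_zero, coe_evalRingHom, coeff_zero_eq_eval_zero]
      rw [← evalAt_degreeSum, hv, h6, DegreeProj.polynomial_proj_coeff, ← h6, h4,
        coxProj_eq_self_iff]
      intro e he
      rw [support_single_subset _ _ he]
      exact e₁.2.2
    have h7 : ∀ e, X ∣ (Pi.single e₁ 1 - v : Θ.DegreeExponents lam → ℂ[X]) e := by
      intro e
      have h8 := Θ.coeff_sum_degreeMono lam (fun e => (v e).eval 0) e
      rw [h5, coe_mono, AddMonoidAlgebra.coeff_single] at h8
      rw [X_dvd_iff, coeff_zero_eq_eval_zero, Pi.sub_apply, eval_sub, ← h8, sub_eq_zero]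
      by_cases hee : e = e₁
      · subst hee
        simp
      · rw [Pi.single_eq_of_ne hee, eval_zero,
          Finsupp.single_eq_of_ne (fun h => hee (Subtype.ext h))]
    choose w hw using h7
    have h9 : Pi.single e₁ 1 = v + (X : ℂ[X]) • w := by
      funext e
      rw [Pi.add_apply, Pi.smul_apply, smul_eq_mul, ← hw, Pi.sub_apply]
      ring
    rw [h9]
    exact add_mem (Submodule.mem_sup_left hvW) (Submodule.mem_sup_right
      (Submodule.smul_mem_smul (Ideal.mem_span_singleton_self _) Submodule.mem_top))
  -- `W` and the multiples of `X` together span the free module, so by Nakayama some `f ≡ 1` modulo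
  -- `X` multiplies the whole module into `W`.
  obtain ⟨f, hf1, hf⟩ := Submodule.exists_sub_one_mem_and_smul_le_of_fg_of_le_sup
    (I := Ideal.span {(X : ℂ[X])}) (N := W) (N' := ⊤) (P := ⊤) Module.Finite.fg_top le_rfl (by
      intro v _
      rw [pi_eq_sum_univ' v]
      exact sum_mem fun e _ => Submodule.smul_mem _ _ (key e))
  refine ⟨f, ?_, fun I hI => ?_⟩
  · obtain ⟨q, hq⟩ := Ideal.mem_span_singleton.1 hf1
    rw [sub_eq_iff_eq_add.1 hq]
    simp
  · obtain ⟨e, he0, heI, hdeg⟩ := h1 I hI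
    have h3 : f • Pi.single (⟨e, he0, hdeg⟩ : Θ.DegreeExponents lam) (1 : ℂ[X]) ∈ W :=
      hf (Submodule.smul_mem_pointwise_smul _ _ _ Submodule.mem_top)
    have h4 : f.map (algebraMap ℂ (coxChart R ∅)) * C (mono ∅ e fun i _ => he0 i) ∈ J := by
      have h5 : Θ.degreeSum lam _ ∈ J := h3
      rw [degreeSum_smul, degreeSum_apply, Finset.sum_eq_single_of_mem
        (⟨e, he0, hdeg⟩ : Θ.DegreeExponents lam) (Finset.mem_univ _)] at h5
      · simpa using h5
      · intro e' _ hne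
        rw [Pi.single_eq_of_ne hne, Polynomial.map_zero, zero_mul]
    -- `x^e` involves only variables in `I`, so it divides any power of `∏_{i ∈ I} x_i` that is at
    -- least the sum of its exponents.
    refine ⟨∑ i, (e i).toNat, ?_⟩
    have h6 : ∀ i, i ∉ (∅ : Finset (Fin R)) → 0 ≤ ((∑ i, (e i).toNat) • indicator I - e) i := by
      intro i _
      by_cases hi : i ∈ I
      · have h7 : (e i).toNat ≤ ∑ i, (e i).toNat :=
          Finset.single_le_sum (f := fun i => (e i).toNat) (fun _ _ => Nat.zero_le _)
            (Finset.mem_univ i)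
        have h8 : e i ≤ ((∑ i, (e i).toNat : ℕ) : ℤ) := by
          have := he0 i
          omega
        simpa [indicator, hi] using h8
      · simp [indicator, hi, heI i hi]
    have h9 := Ideal.mul_mem_right (C (mono ∅ _ h6)) _ h4
    rw [mul_assoc, ← C_mul, mono_mul_mono] at h9
    convert h9 using 4
    rw [mono_pow]
    ext1
    rw [coe_mono, coe_mono, add_sub_cancel]

end GITData


/-! ### All but finitely many members of a pencil are regular -/

open Polynomial

namespace GITData

variable {𝕃 : Type} [AddCommGroup 𝕃] {R : ℕ} (Θ : GITData 𝕃 R) {k : ℕ}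
  {χ : Fin k → Module.Dual ℤ 𝕃}

/-- The indices of the coordinates that vanish nowhere on `V_ω`. -/
def unitIndices : Finset (Fin R) :=
  open Classical in Finset.univ.filter fun i => ∀ I ∈ Θ.covers, i ∈ I

lemma mem_unitIndices {i : Fin R} : i ∈ Θ.unitIndices ↔ ∀ I ∈ Θ.covers, i ∈ I := by
  classical
  simp [unitIndices]

/-- A section can have negative exponents only at coordinates that vanish nowhere on `V_ω`.
Multiplying by their monomial, a unit on every chart, moves it to the polynomial ring without
changing regularity, so that all charts are treated over one graded ring. -/
lemma exists_clearing {ψ : Module.Dual ℤ 𝕃} (s : Θ.sections ψ) :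
    ∃ n : ℕ, ∀ N : ℕ, n ≤ N →
      s.1 * AddMonoidAlgebra.single (N • indicator Θ.unitIndices) 1 ∈ coxChart R ∅ := by
  have h1 : s.1 ∈ coxChart R Θ.unitIndices := by
    intro e he i hi
    rw [mem_unitIndices] at hi
    push Not at hi
    obtain ⟨I, hI, hiI⟩ := hi
    exact s.2.1 I hI e he i hiI
  obtain ⟨n, hn⟩ := exists_mul_pow_mem_coxChart (I := ∅) (m := indicator Θ.unitIndices)
    (fun i _ hi => by simp [indicator, hi]) (fun i _ => indicator_nonneg _ i) h1
  refine ⟨n, fun N hN => ?_⟩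
  obtain ⟨d, rfl⟩ := Nat.exists_eq_add_of_le hN
  have h2 : (AddMonoidAlgebra.single ((n + d) • indicator Θ.unitIndices) 1 : Laurent R) =
      AddMonoidAlgebra.single (n • indicator Θ.unitIndices) 1 *
        AddMonoidAlgebra.single (d • indicator Θ.unitIndices) 1 := by
    rw [AddMonoidAlgebra.single_mul_single, mul_one, add_smul]
  rw [h2, ← mul_assoc]
  exact mul_mem hn (single_mem_coxChart
    (fun i _ => nsmul_nonneg (indicator_nonneg Θ.unitIndices i) d) 1)

variable {Θ}

/-- The section `s`, with denominators cleared. -/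
def cleared {ψ : Module.Dual ℤ 𝕃} {s : Θ.sections ψ} {n : ℕ}
    (h : s.1 * AddMonoidAlgebra.single (n • indicator Θ.unitIndices) 1 ∈ coxChart R ∅) :
    coxChart R ∅ := ⟨_, h⟩

lemma proj_cleared {ψ : Module.Dual ℤ 𝕃} {s : Θ.sections ψ} {n : ℕ}
    (h : s.1 * AddMonoidAlgebra.single (n • indicator Θ.unitIndices) 1 ∈ coxChart R ∅) :
    (coxProj Θ.degree ∅).proj (ψ + Θ.degree (n • indicator Θ.unitIndices)) (cleared h) =
      cleared h := by
  ext1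
  rw [coe_coxProj, cleared, laurentProj_mul _ _ _ _ _ (laurentProj_single_of_eq _ rfl _),
    add_sub_cancel_right, (laurentProj_eq_self_iff _).2 s.2.2]

/-- The monomial of the unit coordinates. -/
def unitMono (I : Θ.covers) (n : ℕ) : coxChart R I.1 :=
  mono I.1 (n • indicator Θ.unitIndices) fun i _ => nsmul_nonneg (indicator_nonneg _ i) n

lemma isUnit_unitMono (I : Θ.covers) (n : ℕ) : IsUnit (unitMono I n) :=
  isUnit_mono fun i hi => by
    have : i ∉ Θ.unitIndices := fun h => hi (Θ.mem_unitIndices.1 h I.1 I.2)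
    simp [indicator, this]

/-- The inclusion of the polynomial ring into the functions on `(ℂˣ)^I × ℂ^{[R] ∖ I}`. -/
abbrev polyIncl (I : Finset (Fin R)) : coxChart R ∅ →+* coxChart R I :=
  (coxIncl (Finset.empty_subset I)).toRingHom

variable (a b : ∀ j, Θ.sections (χ j))

/-- The pencil spanned by `a` and `b`, with denominators cleared. -/
def clearedPencil {n : Fin k → ℕ}
    (ha : ∀ j, (a j).1 * AddMonoidAlgebra.single (n j • indicator Θ.unitIndices) 1 ∈ coxChart R ∅)
    (hb : ∀ j, (b j).1 * AddMonoidAlgebra.single (n j • indicator Θ.unitIndices) 1 ∈ coxChart R ∅)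
    (j : Fin k) : (coxChart R ∅)[X] :=
  C (cleared (ha j)) + C (cleared (hb j) - cleared (ha j)) * X

variable {a b} {n : Fin k → ℕ}
  (ha : ∀ j, (a j).1 * AddMonoidAlgebra.single (n j • indicator Θ.unitIndices) 1 ∈ coxChart R ∅)
  (hb : ∀ j, (b j).1 * AddMonoidAlgebra.single (n j • indicator Θ.unitIndices) 1 ∈ coxChart R ∅)

lemma proj_clearedPencil (j : Fin k) : (coxProj Θ.degree ∅).polynomial.proj
    (χ j + Θ.degree (n j • indicator Θ.unitIndices)) (clearedPencil a b ha hb j) =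
      clearedPencil a b ha hb j := by
  ext1 m
  rw [DegreeProj.polynomial_proj_coeff, clearedPencil]
  simp only [coeff_add, coeff_C, coeff_C_mul_X]
  split_ifs <;> simp only [map_add, map_sub, map_zero, add_zero, zero_add, proj_cleared]

lemma polyIncl_cleared {ψ : Module.Dual ℤ 𝕃} {s : Θ.sections ψ} {n : ℕ}
    (h : s.1 * AddMonoidAlgebra.single (n • indicator Θ.unitIndices) 1 ∈ coxChart R ∅)
    (I : Θ.covers) : polyIncl I.1 (cleared h) = unitMono I n * ⟨s.1, s.2.1 I.1 I.2⟩ := by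
  ext1
  exact mul_comm _ _

lemma polyIncl_evalAt_clearedPencil (t : ℂ) (I : Θ.covers) (j : Fin k) :
    polyIncl I.1 (evalAt _ t (clearedPencil a b ha hb j)) = unitMono I (n j) *
      Θ.localSection (fun j => (1 - t) • a j + t • b j) I j := by
  have h : Θ.localSection (fun j => (1 - t) • a j + t • b j) I j =
      (1 - t) • Θ.localSection a I j + t • Θ.localSection b I j := rfl
  have h1 : polyIncl I.1 (algebraMap ℂ (coxChart R ∅) t) = algebraMap ℂ (coxChart R I.1) t := rfl
  have h2 : polyIncl I.1 (cleared (ha j)) = unitMono I (n j) * Θ.localSection a I j :=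
    polyIncl_cleared (ha j) I
  have h3 : polyIncl I.1 (cleared (hb j)) = unitMono I (n j) * Θ.localSection b I j :=
    polyIncl_cleared (hb j) I
  rw [h, clearedPencil, evalAt, map_add, map_mul, coe_evalRingHom, eval_C, eval_C, eval_X,
    map_add, map_mul, map_sub, h1, h2, h3, sub_smul, one_smul, Algebra.smul_def, Algebra.smul_def]
  ring

lemma evalAt_clearedPencil_mem_iff (t : ℂ) (I : Θ.covers) (p : Ideal (coxChart R I.1)) (j : Fin k) :
    evalAt _ t (clearedPencil a b ha hb j) ∈ p.comap (polyIncl I.1) ↔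
      Θ.localSection (fun j => (1 - t) • a j + t • b j) I j ∈ p := by
  rw [Ideal.mem_comap, polyIncl_evalAt_clearedPencil,
    Ideal.unit_mul_mem_iff_mem _ (isUnit_unitMono I (n j))]

lemma isWeaklyRegularAt_evalAt_clearedPencil_iff (t : ℂ) (I : Θ.covers)
    (p : Ideal (coxChart R I.1)) [p.IsPrime] :
    IsWeaklyRegularAt (fun j => evalAt _ t (clearedPencil a b ha hb j)) (p.comap (polyIncl I.1)) ↔
      IsWeaklyRegularAt (Θ.localSection (fun j => (1 - t) • a j + t • b j) I) p := by
  rw [← (isAway_coxIncl_empty I.1).isWeaklyRegularAt_comp_iff,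
    ← isWeaklyRegularAt_mul_iff (fun j => isUnit_unitMono I (n j)) (Θ.localSection _ I)]
  refine iff_of_eq (congrArg (IsWeaklyRegularAt · p) ?_)
  funext j
  exact polyIncl_evalAt_clearedPencil ha hb t I j

/-- If one member of a pencil of sections is regular, then so are all but finitely many. -/
lemma finite_not_isRegularSection (h : Θ.IsRegularSection a) :
    {t : ℂ | ¬ Θ.IsRegularSection fun j => (1 - t) • a j + t • b j}.Finite := by
  classical
  rcases Θ.covers.eq_empty_or_nonempty with hne | hne
  -- Without covers `V_ω` is empty and every section is regular.
  · refine Set.finite_empty.subset fun t ht => (ht fun I => ?_).elim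
    exact ((hne ▸ I.2 : I.1 ∈ (∅ : Set (Finset (Fin R))))).elim
  have h1 : ∀ j, ∃ n : ℕ,
      (a j).1 * AddMonoidAlgebra.single (n • indicator Θ.unitIndices) 1 ∈ coxChart R ∅ ∧
      (b j).1 * AddMonoidAlgebra.single (n • indicator Θ.unitIndices) 1 ∈ coxChart R ∅ := by
    intro j
    obtain ⟨n, hn⟩ := Θ.exists_clearing (a j)
    obtain ⟨m, hm⟩ := Θ.exists_clearing (b j)
    exact ⟨max n m, hn _ (le_max_left _ _), hm _ (le_max_right _ _)⟩
  choose n ha hb using h1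
  let r := clearedPencil a b ha hb
  let J : Fin k → Ideal (coxChart R ∅)[X] := fun j =>
    irregularityIdeal r j ⊔ Ideal.span (Set.range r)
  have h0 : (fun j => (1 - (0 : ℂ)) • a j + (0 : ℂ) • b j) = a := by
    funext j
    rw [sub_zero, one_smul, zero_smul, add_zero]
  rw [isRegularSection_iff] at h
  have h2 : ∀ (I : Θ.covers) (j : Fin k), ∃ (m : ℕ), ∃ c ∈ J j, evalAt _ 0 c = coverMono I.1 ^ m := by
    intro I j
    obtain ⟨m, c, hc, hc'⟩ := exists_pow_eq_evalAt (r := r) (t := 0) (x := coverMono I.1)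
      (fun p hp hr hx => by
        obtain ⟨P, hP, rfl⟩ := (isAway_coxIncl_empty I.1).exists_isPrime hp hx
        rw [isWeaklyRegularAt_evalAt_clearedPencil_iff ha hb 0 I P, h0]
        refine h I P hP fun j => ?_
        have := (evalAt_clearedPencil_mem_iff ha hb 0 I P j).1 (hr j)
        rwa [h0] at this) j
    exact ⟨m, c, hc, hc'⟩
  choose m c hcJ hc using h2
  have h3 : ∀ j, ∃ f : ℂ[X], f.eval 0 = 1 ∧ ∀ I ∈ Θ.covers, ∃ N : ℕ,
      f.map (algebraMap ℂ (coxChart R ∅)) * C (coverMono I ^ N) ∈ J j := by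
    intro j
    -- One exponent has to serve all covers, and the sum of the individual ones dominates each of
    -- them.
    refine Θ.exists_mul_pow_mem hne (n := ∑ I, m I j) ?_ fun I hI => ?_
    · refine DegreeProj.isHomogeneous_sup _
        (DegreeProj.isHomogeneous_irregularityIdeal _ (proj_clearedPencil ha hb) j) ?_
      rw [← Set.image_univ]
      exact DegreeProj.isHomogeneous_span _ (proj_clearedPencil ha hb) _
    · have h4 : m ⟨I, hI⟩ j ≤ ∑ I, m I j :=
        Finset.single_le_sum (f := fun I => m I j) (fun _ _ => Nat.zero_le _) (Finset.mem_univ _)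
      obtain ⟨d, hd⟩ := Nat.exists_eq_add_of_le h4
      refine ⟨c ⟨I, hI⟩ j * C (coverMono I ^ d), Ideal.mul_mem_right _ _ (hcJ _ _), ?_⟩
      rw [map_mul, hc, evalAt_C, hd, pow_add]
  choose f hf0 hf using h3
  have hfin : (⋃ j, {t : ℂ | (f j).IsRoot t}).Finite := by
    refine Set.finite_iUnion fun j => Polynomial.finite_setOfPred_isRoot fun h => ?_
    have := hf0 j
    rw [h, eval_zero] at this
    exact zero_ne_one this
  -- The exceptional values: roots of some `f j`, where the irregularity locus may meet the slice,
  -- and values `t` at which `X - t` is a zero divisor modulo the pencil.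
  refine (hfin.union (finite_zeroDivisors (Ideal.span (Set.range r)))).subset fun t ht => ?_
  by_contra hnot
  rw [Set.mem_union, not_or, Set.mem_iUnion, not_exists] at hnot
  obtain ⟨hroot, hzd⟩ := hnot
  refine ht ((Θ.isRegularSection_iff _).2 fun I P hP hs => ?_)
  rw [← isWeaklyRegularAt_evalAt_clearedPencil_iff ha hb t I P]
  refine isWeaklyRegularAt_of_mem_irregularityIdeal (r := r)
    (fun j => (evalAt_clearedPencil_mem_iff ha hb t I P j).2 (hs j)) (fun j => ?_) fun x hx => ?_
  · obtain ⟨N, hN⟩ := hf j I.1 I.2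
    -- On the chart of `I` the monomial of `I` is a unit, and `f j` has the nonzero constant value
    -- `f j (t)` on the slice; so this element avoids every prime of the chart.
    refine ⟨_, hN, fun hmem => hP.ne_top (Ideal.eq_top_of_isUnit_mem _ hmem ?_)⟩
    rw [map_mul, evalAt_C, map_mul]
    refine IsUnit.mul ?_ ?_
    · have h5 : evalAt _ t ((f j).map (algebraMap ℂ (coxChart R ∅))) =
          algebraMap ℂ (coxChart R ∅) ((f j).eval t) := eval_map_apply _ _
      rw [h5]
      exact ((isUnit_iff_ne_zero.2 (hroot j)).map (algebraMap ℂ (coxChart R ∅))).map (polyIncl I.1)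
    · rw [map_pow]
      exact (isAway_coxIncl_empty I.1).isUnit.pow N
  · by_contra hxI
    exact hzd ⟨x, hxI, hx⟩

end GITData

/-! ### The degeneration of `X` to `X'` -/

namespace ConvexPartition

variable {𝕃 : Type} [AddCommGroup 𝕃] {R : ℕ} {Θ : GITData 𝕃 R} {k : ℕ} (P : ConvexPartition Θ k)
  (h : Θ.IsOrbifold) (s : ∀ j, Θ.sections (P.L j))

lemma pencil_zero : P.pencil s 0 = P.binomial := by
  funext j
  rw [pencil, sub_zero, one_smul, zero_smul, add_zero]

lemma pencil_one : P.pencil s 1 = s := by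
  funext j
  rw [pencil, sub_self, one_smul, zero_smul, zero_add]

/-- The degeneration of `X` to `X'` in `Y × 𝔸¹`. -/
abbrev degeneration : (timesLine (Θ.fan h).structureMap).IdealSheafData :=
  Θ.familySheaf h P.binomial s

lemma isEmbeddedFiber_degeneration {t : ℂ} (ht : Θ.IsRegularSection (P.pencil s t)) :
    IsEmbeddedFiber (Θ.fan h).structureMap (P.degeneration h s).subschemeι t
      (Θ.zeroIdeal h (P.pencil s t)).subschemeι :=
  Θ.isEmbeddedFiber_familySheaf h P.binomial s t ht

/-- The closed immersion `X' → Y` has the same ideal as the fibre over `0`, and it is a morphism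
over `ℂ`. -/
lemma hasFiber_degeneration_zero : HasFiber ((P.degeneration h s).subschemeι ≫
    Limits.pullback.snd (Θ.fan h).structureMap affineLineMap) 0 (P.fan' h).structureMap := by
  have := P.isClosedImmersion_restrictMap h
  have h0 : Θ.IsRegularSection (P.pencil s 0) := by
    rw [pencil_zero]
    exact P.isRegularSection_binomial
  have h1 : ((Θ.fan h).restrictMap P.u).ker =
      (P.degeneration h s).comap (slice (Θ.fan h).structureMap (𝟙 _) 0) := by
    rw [degeneration, Θ.comap_slice_familySheaf h P.binomial s 0 h0, ker_restrictMap]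
    exact congrArg (Θ.zeroIdeal h) (P.pencil_zero s).symm
  obtain ⟨j, -, hj⟩ := isEmbeddedFiber_of_ker_eq _ _ 0 _ h1
  rw [Fan.restrictMap_structureMap] at hj
  exact ⟨j, hj⟩

end ConvexPartition

end

end Toric

theorem mainTheorem1 (𝕃 : Type) [AddCommGroup 𝕃] [Module.Free ℤ 𝕃] [Module.Finite ℤ 𝕃] (R k : ℕ)
    (Θ : Toric.GITData 𝕃 R) (hΘ : Θ.IsOrbifold) (P : Toric.ConvexPartition Θ k)
    (s : ∀ j, Θ.sections (P.L j)) (hs : Θ.IsRegularSection s) :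
    ∃ (𝕏 : Scheme.{0}) (i : 𝕏 ⟶ Toric.timesLine (Θ.fan hΘ).structureMap),
      IsClosedImmersion i ∧
      Flat (i ≫ Limits.pullback.snd (Θ.fan hΘ).structureMap Toric.affineLineMap) ∧
      -- the general fibre, and the fibre over `0`, is cut out by a regular section in the pencil
      (∃ F : Set ℂ, F.Finite ∧ 0 ∉ F ∧ 1 ∉ F ∧ ∀ t, t ∉ F →
        Θ.IsRegularSection (P.pencil s t) ∧
        Toric.IsEmbeddedFiber (Θ.fan hΘ).structureMap i t
          (Θ.zeroIdeal hΘ (P.pencil s t)).subschemeι) ∧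
      -- the fibre over `1` is `X`
      Toric.IsEmbeddedFiber (Θ.fan hΘ).structureMap i 1 (Θ.zeroIdeal hΘ s).subschemeι ∧
      -- the fibre over `0` is the zero locus of the binomial sections, and is isomorphic to `X'`
      Toric.IsEmbeddedFiber (Θ.fan hΘ).structureMap i 0 (Θ.zeroIdeal hΘ P.binomial).subschemeι ∧
      Toric.HasFiber (i ≫ Limits.pullback.snd (Θ.fan hΘ).structureMap Toric.affineLineMap) 0
        (P.fan' hΘ).structureMap := by
  have h0 : Θ.IsRegularSection (P.pencil s 0) := by
    rw [P.pencil_zero]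
    exact P.isRegularSection_binomial
  have h1 : Θ.IsRegularSection (P.pencil s 1) := by
    rwa [P.pencil_one]
  have e0 := P.isEmbeddedFiber_degeneration hΘ s h0
  have e1 := P.isEmbeddedFiber_degeneration hΘ s h1
  rw [P.pencil_zero] at e0
  rw [P.pencil_one] at e1
  exact ⟨_, (P.degeneration hΘ s).subschemeι, inferInstance, Θ.flat_familySheaf hΘ P.binomial s,
    -- The exceptional set is exactly the set of irregular members. It is finite because the
    -- binomial member at `0` is regular, and it omits `1` because `s` is regular by assumption.
    ⟨{t | ¬ Θ.IsRegularSection (P.pencil s t)},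
      Toric.GITData.finite_not_isRegularSection P.isRegularSection_binomial,
      fun h => h h0, fun h => h h1, fun t ht =>
        ⟨not_not.1 ht, P.isEmbeddedFiber_degeneration hΘ s (not_not.1 ht)⟩⟩,
    e1, e0, P.hasFiber_degeneration_zero hΘ s⟩
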